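/- **Setting.** A Lorenz map is a $C^3$ map $f:[0,1]\setminus\{c\}\to[0,1]$, $c\in(0,1)$, with $f(0)=0$, $f(1)=1$ and $Df>0$ (one-sided derivatives at $0$ and $1$); $c_1^{-}=\lim_{x\to c^-}f(x)$ and $c_1^{+}=\lim_{x\to c^+}f(x)$ are its critical values, and it is nontrivial if $c_1^+<c<c_1^-$. Lorenz maps on other intervals $[p,q]$ are defined by affine rescaling. We consider nontrivial Lorenz maps $f$ that are * contracting: $Df(x)\to 0$ as $x\to c^{\pm}$; * non-flat at $c$: there are $u,v\in[0,1]$, $\alpha>1$ and $C^3$ diffeomorphisms $\phi:[0,c]\to[0,u^{1/\alpha}]$, $\psi:[c,1]\to[0,v^{1/\alpha}]$ with $\phi(c)=\psi(c)=0$, $\phi(0)=u^{1/\alpha}$, $\psi(1)=v^{1/\alpha}$, such that $f=u-\phi^\alpha$ on $[0,c)$ and $f=1-v+\psi^\alpha$ on $(c,1]$; * of negative Schwarzian derivative on $[0,1]\setminus\{c\}$, with $Df(0)>1$ and $Df(1)>1$. Such an $f$ is infinitely renormalizable if there are closed intervals $[0,1]=C_0\supsetneq C_1\supsetneq C_2\supsetneq\cdots$,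 each with $c$ in its interior, such that $C_{n+1}$ is maximal among the closed intervals $J\subsetneq C_n$ with $c\in\operatorname{int}J$ whose first return map under $f$ is defined on $J\setminus\{c\}$ and is a nontrivial Lorenz map up to affine rescaling. Put $C_n^-=C_n\cap[0,c)$ and $C_n^+=C_n\cap(c,1]$, let $S_n^\pm$ be the (constant) first return time of $C_n^\pm$ to $C_n$, and $$\Lambda_n=\bigcup_{k=0}^{S_n^--1}\overline{f^k(C_n^-)}\ \cup\ \bigcup_{k=0}^{S_n^+-1}\overline{f^k(C_n^+)} .$$ The components of $\Lambda_n$ are the intervals of generation $n$, and the components of $\Lambda_{n}\setminus\Lambda_{n+1}$ are the gaps of generation $n+1$. The map $f$ has bounded geometry if there are constants $K>1$ and $0<a<b<1$ such that for all $n\ge1$: $a<|J|/|I|<b$ and $a<|G|/|I|<b$ whenever $I$ is an interval of generation $n$ and $J\subset I$, $G\subset I$ are an interval and a gap of generation $n+1$; and $|C_n|/|C_n^{\pm}|\le K$. Let $\mathcal L_B$ be the class of all infinitely renormalizable maps $f$ as above that have bounded geometry. A probability measure $\mu$ on $[0,1]$ is invariant if $\mu(\{x\in[0,1]\setminus\{c\}: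 f(x)\in A\})=\mu(A)$ for all Borel sets $A$. An invariant probability measure $\mu$ is physical if the set of points $x\in[0,1]$ whose forward orbit does not meet $c$ and for which $\frac1n\sum_{k=1}^n\delta_{f^k(x)}\to\mu$ in the weak star topology has positive Lebesgue measure. **Lemma 3.3.** Let $f\in\mathcal L_B$. Then $f$ has a unique physical measure $\mu$, the function $\log Df$ is $\mu$-integrable, the forward orbits of $c_1^-$ and $c_1^+$ stay in $[0,1]$ and do not meet $c$, and the pointwise Lyapunov exponents at $c_1^-$ and $c_1^+$ exist and $$\lim_{n\to\infty}\frac1n\log Df^n(c_1^-)=\lim_{n\to\infty}\frac1n\log Df^n(c_1^+)=\int\log Df\,d\mu .$$ -/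

import Mathlib

open Set Filter Topology MeasureTheory

noncomputable section

namespace Lorenz

/-- The domain `[a, b] \ {c}` of a Lorenz map. A map `[a, b] \ {c} → [a, b]` is represented by a
function `ℝ → ℝ`; its values at `c` and outside `[a, b]` are irrelevant for all notions below. -/
def dom (a b c : ℝ) : Set ℝ := Icc a b \ {c}

/-- `g` is a nontrivial Lorenz map on `[a, b]` with singular point `c`: a `C³` map
`[a, b] \ {c} → [a, b]` that fixes `a` and `b`, has positive derivative, and satisfies
`g(c⁺) < c < g(c⁻)` (so that it is discontinuous at `c`). For `[a, b] = [0, 1]` these are the usual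
nontrivial Lorenz maps; for general `[a, b]` these are exactly the maps that are affinely conjugate
to them. -/
structure IsNontrivialLorenz (a b c : ℝ) (g : ℝ → ℝ) : Prop where
  singular_mem : c ∈ Ioo a b
  mapsTo : MapsTo g (dom a b c) (Icc a b)
  map_left : g a = a
  map_right : g b = b
  contDiffOn : ContDiffOn ℝ 3 g (dom a b c)
  deriv_pos : ∀ x ∈ dom a b c, 0 < derivWithin g (dom a b c) x
  nontrivial : Function.rightLim g c < c ∧ c < Function.leftLim g c

/-- `φ : s → t` is a `C³` diffeomorphism. -/
def IsC3Diffeo (φ : ℝ → ℝ) (s t : Set ℝ) : Prop :=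
  ContDiffOn ℝ 3 φ s ∧ MapsTo φ s t ∧
    ∃ g : ℝ → ℝ, ContDiffOn ℝ 3 g t ∧ MapsTo g t s ∧ InvOn g φ s t

/-- The singular point `c` of the Lorenz map `f` on `[0, 1]` is non-flat. -/
def IsNonFlat (f : ℝ → ℝ) (c : ℝ) : Prop :=
  ∃ u ∈ Icc (0 : ℝ) 1, ∃ v ∈ Icc (0 : ℝ) 1, ∃ α : ℝ, 1 < α ∧
    ∃ φ ψ : ℝ → ℝ,
      IsC3Diffeo φ (Icc 0 c) (Icc 0 (u ^ (1 / α))) ∧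
      IsC3Diffeo ψ (Icc c 1) (Icc 0 (v ^ (1 / α))) ∧
      φ c = 0 ∧ ψ c = 0 ∧ φ 0 = u ^ (1 / α) ∧ ψ 1 = v ^ (1 / α) ∧
      (∀ x ∈ Ico 0 c, f x = u - φ x ^ α) ∧
      (∀ x ∈ Ioc c 1, f x = 1 - v + ψ x ^ α)

/-- The Schwarzian derivative of `h` on `s`. -/
def schwarzian (h : ℝ → ℝ) (s : Set ℝ) (x : ℝ) : ℝ :=
  iteratedDerivWithin 3 h s x / derivWithin h s x
    - 3 / 2 * (iteratedDerivWithin 2 h s x / derivWithin h s x) ^ 2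

/-- `f` is a nontrivial contracting Lorenz map `[0, 1] \ {c} → [0, 1]` of class `C³` with non-flat
singular point `c`, with negative Schwarzian derivative outside `c`, and with hyperbolic repelling
fixed points `0` and `1`. -/
structure IsContractingLorenz (f : ℝ → ℝ) (c : ℝ) : Prop where
  lorenz : IsNontrivialLorenz 0 1 c f
  contracting_left : Tendsto (derivWithin f (dom 0 1 c)) (𝓝[<] c) (𝓝 0)
  contracting_right : Tendsto (derivWithin f (dom 0 1 c)) (𝓝[>] c) (𝓝 0)
  nonFlat : IsNonFlat f c
  schwarzian_neg : ∀ x ∈ dom 0 1 c, schwarzian f (dom 0 1 c) x < 0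
  repelling_zero : 1 < derivWithin f (dom 0 1 c) 0
  repelling_one : 1 < derivWithin f (dom 0 1 c) 1

/-- The first return time of `x` to `J`: the smallest `k ≥ 1` with `f^k(x) ∈ J`. -/
def returnTime (f : ℝ → ℝ) (J : Set ℝ) (x : ℝ) : ℕ := sInf {k | 0 < k ∧ f^[k] x ∈ J}

/-- The first return map to `J`. -/
def firstReturn (f : ℝ → ℝ) (J : Set ℝ) (x : ℝ) : ℝ := f^[returnTime f J x] x

/-- `J` is a closed interval in `[0, 1]` with `c` in its interior such that the first return map
of `f` to `J` is defined on `J \ {c}` and is affinely conjugate to a nontrivial Lorenz map. -/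
def IsReturnInterval (f : ℝ → ℝ) (c : ℝ) (J : Set ℝ) : Prop :=
  ∃ p q : ℝ, J = Icc p q ∧ c ∈ Ioo p q ∧ J ⊆ Icc 0 1 ∧
    (∀ x ∈ dom p q c, ∃ k, 0 < k ∧ f^[k] x ∈ J) ∧
    IsNontrivialLorenz p q c (firstReturn f J)

/-- `C 0 = [0, 1]`, and `C (n + 1)` is the renormalization interval of the `n`-th renormalization
of `f`, in the coordinates of `f`. The `n`-th renormalization is, up to affine rescaling, the first
return map of `f` to `C n`, and for a set `J ⊆ C n` the first return map of that map to `J` is the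
first return map of `f` to `J`. Hence `C (n + 1)` is maximal among the closed intervals
`J ⊊ C n` around `c` whose first return map is a nontrivial Lorenz map up to rescaling. The map
`f` is infinitely renormalizable if and only if there is such a sequence. -/
structure IsRenormalizationSequence (f : ℝ → ℝ) (c : ℝ) (C : ℕ → Set ℝ) : Prop where
  zero : C 0 = Icc 0 1
  succ : ∀ n, Maximal (fun J => IsReturnInterval f c J ∧ J ⊂ C n) (C (n + 1))

/-- The union of the closures of `f^k(s)` over `0 ≤ k < S`, where `S` is the first return time of
`s` to `J`. (The set after `''` is all of `s` if `k < S` and empty otherwise, whenever the return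
time has the constant value `S` on `s`, as it has on both sides of `c` in a return interval.) -/
def cycle (f : ℝ → ℝ) (J s : Set ℝ) : Set ℝ :=
  ⋃ k : ℕ, closure (f^[k] '' {x ∈ s | k < returnTime f J x})

/-- The set `Λₙ`, the union of the two level cycles `Λₙ⁻` and `Λₙ⁺` of the interval `J = C n`. -/
def level (f : ℝ → ℝ) (c : ℝ) (J : Set ℝ) : Set ℝ :=
  cycle f J (J ∩ Iio c) ∪ cycle f J (J ∩ Ioi c)

/-- `J` is a connected component of `A`. -/
def IsComponent (J A : Set ℝ) : Prop := ∃ x ∈ A, J = connectedComponentIn A x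

/-- Bounded geometry. The components of `Λₙ` are the intervals of generation `n`, the components of
`Λₙ \ Λₙ₊₁` are the gaps of generation `n + 1`. -/
def HasBoundedGeometry (f : ℝ → ℝ) (c : ℝ) (C : ℕ → Set ℝ) : Prop :=
  ∃ K a b : ℝ, 1 < K ∧ 0 < a ∧ a < b ∧ b < 1 ∧ ∀ n : ℕ, 1 ≤ n →
    (∀ I J, IsComponent I (level f c (C n)) → IsComponent J (level f c (C (n + 1))) → J ⊆ I →
      a < volume.real J / volume.real I ∧ volume.real J / volume.real I < b) ∧
    (∀ I G, IsComponent I (level f c (C n)) →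
      IsComponent G (level f c (C n) \ level f c (C (n + 1))) → G ⊆ I →
      a < volume.real G / volume.real I ∧ volume.real G / volume.real I < b) ∧
    volume.real (C n) / volume.real (C n ∩ Iio c) ≤ K ∧
    volume.real (C n) / volume.real (C n ∩ Ioi c) ≤ K

/-- The class of infinitely renormalizable contracting Lorenz maps with bounded geometry
(`c` is the singular point). -/
def ClassLB (f : ℝ → ℝ) (c : ℝ) : Prop :=
  IsContractingLorenz f c ∧
    ∃ C : ℕ → Set ℝ, IsRenormalizationSequence f c C ∧ HasBoundedGeometry f c C

/-- The points of `[0, 1]` whose forward orbit does not meet the singular point. -/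
def regularPoints (f : ℝ → ℝ) (c : ℝ) : Set ℝ := {x ∈ Icc 0 1 | ∀ n : ℕ, f^[n] x ≠ c}

/-- `μ` is invariant under the map `f`, which is defined on `[0, 1] \ {c}` only. (With `A = univ`
this gives that a finite invariant measure is carried by `[0, 1] \ {c}`.) -/
def IsInvariant (f : ℝ → ℝ) (c : ℝ) (μ : Measure ℝ) : Prop :=
  ∀ A : Set ℝ, MeasurableSet A → μ (dom 0 1 c ∩ f ⁻¹' A) = μ A

/-- The basin of `μ`: the points `x` for which the measures `1/n * ∑ k = 1..n, δ_{f^k(x)}` converge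
to `μ` in the weak star topology. -/
def basin (f : ℝ → ℝ) (c : ℝ) (μ : Measure ℝ) : Set ℝ :=
  {x ∈ regularPoints f c | ∀ g : ℝ → ℝ, Continuous g →
    Tendsto (fun n : ℕ => (1 / (n : ℝ)) * ∑ k ∈ Finset.Icc 1 n, g (f^[k] x)) atTop
      (𝓝 (∫ y, g y ∂μ))}

/-- Physical measures of `f`. -/
structure IsPhysical (f : ℝ → ℝ) (c : ℝ) (μ : Measure ℝ) : Prop where
  isProbabilityMeasure : IsProbabilityMeasure μ
  invariant : IsInvariant f c μ
  basin_pos : 0 < volume (basin f c μ)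

/-- The function `log Df`. -/
def logDeriv (f : ℝ → ℝ) (c : ℝ) (x : ℝ) : ℝ := Real.log (derivWithin f (dom 0 1 c) x)

/-- The orbit of `x` does not meet the singular point, and the pointwise Lyapunov exponent
`lim 1/n * log Df^n(x)` exists and equals `χ`. -/
def HasLyapunovExponent (f : ℝ → ℝ) (c x χ : ℝ) : Prop :=
  x ∈ regularPoints f c ∧
    Tendsto (fun n : ℕ => (1 / (n : ℝ)) * Real.log (derivWithin (f^[n]) (dom 0 1 c) x)) atTop
      (𝓝 χ)

end Lorenz

end

/-! The proof rests on a hierarchy of return intervals J_i around c, with return times k i on the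
left side and l i on the right side.

Topology. Negative Schwarzian derivative makes (Df)^(-1/2) strictly convex, so every monotone branch
of an iterate strictly expands cross ratios (`Expander.iterate_crossRatio_succ`). Hence the graph of
a branch cannot meet the diagonal in the pattern up, down, up (`Expander.not_sign_pattern`). This
has two consequences. The return maps have no fixed points inside their branches (`Level.left_ne`),
so the intervals J_i shrink strictly at both ends, orbits alternate between the two sides of c, and
k (i+1) and l (i+1) are both at least k i + l i. Moreover there are no periodic intervals of
monotonicity (`Expander.false_of_periodic`), and together with a Lebesgue density argument this
shows that almost every point enters every J_i (`Expander.volume_not_enters_eq_zero`).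

Continuous observables. Bounded geometry bounds the number of visits to J_i between returns to
J_(i+1) by a constant N, because different visits lie in disjoint components of definite size. The
components of the i-th level set have length at most b ^ i, so a continuous function is almost
constant along each step of a return block. A block average at level i+1 is a convex combination,
with weights bounded below, of two almost constant block averages at level i. The spread of the
averages therefore contracts (`Tower.averages_contract`), and all orbits that avoid c and enter
every J_i share the same limit (`Tower.exists_limit`). Almost every point and both critical values
are of this kind. The Riesz theorem turns the common limit into the measure μ; its basin has full
measure in [0, 1], which gives uniqueness.

The function log Df. It is unbounded below, but non-flatness and the lower bound on the size of J_i
give log Df ≥ -(A + B i) outside J_i. The orbit of a critical value visits J_i with frequency at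
most 2^(-i) at all times, including the initial ones (`Level.visits_mul_le_of_mem_hitSet`). So
truncating log Df changes its averages by a uniformly small amount
(`Tower.sum_truncLogDeriv_sub_le`). This yields at once μ {c} = 0, integrability, and convergence of
the exponents to the integral. Since c carries no mass, the discontinuity of f is harmless and μ is
invariant (`isInvariant_of_averages`). -/

namespace Lorenz

/-! ### Negative Schwarzian derivative and expansion of cross ratios -/

/-- If `g' = φ⁻²` with `φ` strictly convex, then `g` expands ratios more than the Möbius map
determined by the values of `φ` at `x` and `y`. -/
lemma ratio_lt_of_strictConvexOn {g φ : ℝ → ℝ} {s : Set ℝ} {x y b : ℝ} (hxy : x < y) (hyb : y < b)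
    (hs : StrictConvexOn ℝ s φ) (hxs : x ∈ s) (hsub : Ioo x b ⊆ s)
    (hg : ContinuousOn g (Icc x b)) (hd : ∀ z ∈ Ioo x b, HasDerivAt g (1 / (φ z) ^ 2) z)
    (hφ : ∀ z ∈ s, 0 < φ z) :
    (b - x) * φ y * (g b - g y) < (g b - g x) * (b - y) * φ x := by
  have hys : y ∈ s := hsub ⟨hxy, hyb⟩
  have hx0 := hφ x hxs
  have hy0 := hφ y hys
  -- `l` is the chord of φ through x and y, and `m` below is the Möbius map with m x = 0 and m' =
  -- l⁻². Convexity puts φ below l between x and y and above l beyond y, so g outgrows m first and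
  -- falls behind it afterwards.
  set σ := (φ y - φ x) / (y - x) with hσ
  set l : ℝ → ℝ := fun z => φ x + σ * (z - x) with hl
  have hyx : 0 < y - x := sub_pos.2 hxy
  have hly : l y = φ y := by simp only [hl, hσ]; field_simp; ring
  have hlx : l x = φ x := by simp [hl]
  set m : ℝ → ℝ := fun z => (z - x) / (φ x * l z) with hm
  have hmd : ∀ z, 0 < l z → HasDerivAt m (1 / (l z) ^ 2) z := by
    intro z hz
    have h1 : HasDerivAt l σ z := by
      simpa [hl] using (((hasDerivAt_id z).sub_const x).const_mul σ).const_add (φ x)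
    have h2 := ((hasDerivAt_id z).sub_const x).div (h1.const_mul (φ x)) (by positivity)
    have h3 : HasDerivAt m _ z := h2
    refine h3.congr_deriv ?_
    rw [div_eq_div_iff (by positivity) (by positivity)]
    simp only [hl, id]
    ring
  have hJ : (y - x) / (φ x * φ y) < g y - g x := by
    have hlpos : ∀ z ∈ Icc x y, 0 < l z := by
      intro z hz
      have : l z = ((y - z) * φ x + (z - x) * φ y) / (y - x) := by
        simp only [hl, hσ]; field_simp; ring
      rw [this]
      apply div_pos _ hyx
      rcases eq_or_lt_of_le hz.1 with h | h
      · subst h; nlinarith [mul_pos hyx hx0]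
      · nlinarith [mul_nonneg (sub_nonneg.2 hz.2) hx0.le, mul_pos (sub_pos.2 h) hy0]
    have hmono : StrictMonoOn (fun z => g z - m z) (Icc x y) := by
      apply strictMonoOn_of_deriv_pos (convex_Icc x y)
      · exact (hg.mono (Icc_subset_Icc_right hyb.le)).sub
          (fun z hz => (hmd z (hlpos z hz)).continuousAt.continuousWithinAt)
      · intro z hz
        rw [interior_Icc] at hz
        have hz' : z ∈ Icc x y := Ioo_subset_Icc_self hz
        have h1 := (hd z ⟨hz.1, hz.2.trans hyb⟩).sub (hmd z (hlpos z hz'))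
        have h2 : deriv (fun z => g z - m z) z = 1 / φ z ^ 2 - 1 / l z ^ 2 := h1.deriv
        rw [h2, sub_pos]
        have hzφ := hφ z (hsub ⟨hz.1, hz.2.trans hyb⟩)
        have hlt : φ z < l z := by
          have := hs.2 hxs hys hxy.ne (div_pos (sub_pos.2 hz.2) hyx)
            (div_pos (sub_pos.2 hz.1) hyx) (by field_simp; ring)
          simp only [smul_eq_mul] at this
          have e1 : (y - z) / (y - x) * x + (z - x) / (y - x) * y = z := by field_simp; ring
          have e2 : (y - z) / (y - x) * φ x + (z - x) / (y - x) * φ y = l z := by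
            simp only [hl, hσ]; field_simp; ring
          rwa [e1, e2] at this
        exact one_div_lt_one_div_of_lt (by positivity) (by gcongr)
    have := hmono (left_mem_Icc.2 hxy.le) (right_mem_Icc.2 hxy.le) hxy
    simp only [hm, hly, sub_self, zero_div] at this
    linarith
  have hbr : (b - x) * φ y - (b - y) * φ x = (y - x) * l b := by
    simp only [hl, hσ]; field_simp; ring
  have hby : 0 < b - y := sub_pos.2 hyb
  have hJ0 : 0 < g y - g x := lt_trans (by positivity) hJ
  have key : (g b - g y) * ((y - x) * l b) < (g y - g x) * (b - y) * φ x := by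
    have hgmono : MonotoneOn g (Icc x b) := by
      apply monotoneOn_of_deriv_nonneg (convex_Icc x b) hg
      · intro z hz; rw [interior_Icc] at hz
        exact (hd z hz).differentiableAt.differentiableWithinAt
      · intro z hz; rw [interior_Icc] at hz
        rw [(hd z hz).deriv]; positivity
    have hR0 : 0 ≤ g b - g y :=
      sub_nonneg.2 (hgmono ⟨hxy.le, hyb.le⟩ (right_mem_Icc.2 (hxy.trans hyb).le) hyb.le)
    -- If the chord has reached zero by b, the Möbius map has a pole and cannot be compared with g;
    -- but then the left side is nonpositive and the right side positive.
    rcases le_or_gt (l b) 0 with hb | hb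
    · have h1 : (g b - g y) * ((y - x) * l b) ≤ 0 :=
        mul_nonpos_of_nonneg_of_nonpos hR0 (mul_nonpos_of_nonneg_of_nonpos hyx.le hb)
      have : 0 < (g y - g x) * (b - y) * φ x := by positivity
      linarith
    · have hlpos : ∀ z ∈ Icc y b, 0 < l z := by
        intro z hz
        have : l z = ((b - z) * φ y + (z - y) * l b) / (b - y) := by
          rw [← hly]; simp only [hl]; field_simp; ring
        rw [this]
        apply div_pos _ hby
        rcases eq_or_lt_of_le hz.1 with h | h
        · subst h; nlinarith [mul_pos hby hy0]
        · nlinarith [mul_nonneg (sub_nonneg.2 hz.2) hy0.le, mul_pos (sub_pos.2 h) hb]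
      have hmono : MonotoneOn (fun z => m z - g z) (Icc y b) := by
        have hD : ∀ z ∈ Ioo y b, HasDerivAt (fun z => m z - g z) (1 / l z ^ 2 - 1 / φ z ^ 2) z :=
          fun z hz => (hmd z (hlpos z (Ioo_subset_Icc_self hz))).sub (hd z ⟨hxy.trans hz.1, hz.2⟩)
        apply monotoneOn_of_deriv_nonneg (convex_Icc y b)
        · exact ContinuousOn.sub
            (fun z hz => (hmd z (hlpos z hz)).continuousAt.continuousWithinAt)
            (hg.mono (Icc_subset_Icc_left hxy.le))
        · intro z hz; rw [interior_Icc] at hz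
          exact (hD z hz).differentiableAt.differentiableWithinAt
        · intro z hz
          rw [interior_Icc] at hz
          rw [(hD z hz).deriv, sub_nonneg]
          have hzs := hsub ⟨hxy.trans hz.1, hz.2⟩
          have hzx : 0 < z - x := by linarith [hz.1]
          have hlt : l z ≤ φ z := by
            have := hs.convexOn.2 hxs hzs (div_nonneg (sub_nonneg.2 hz.1.le) hzx.le)
              (div_nonneg hyx.le hzx.le)
              (by field_simp; ring)
            simp only [smul_eq_mul] at this
            have e1 : (z - y) / (z - x) * x + (y - x) / (z - x) * z = y := by field_simp; ring
            rw [e1] at this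
            have e2 : φ y * (z - x) ≤ (z - y) * φ x + (y - x) * φ z := by
              calc φ y * (z - x) ≤ ((z - y) / (z - x) * φ x + (y - x) / (z - x) * φ z) * (z - x) :=
                    by gcongr
                _ = _ := by field_simp
            have e3 : l z * (y - x) = φ x * (y - x) + (φ y - φ x) * (z - x) := by
              simp only [hl, hσ]; field_simp
            have : l z * (y - x) ≤ φ z * (y - x) := by rw [e3]; linarith
            exact le_of_mul_le_mul_right this hyx
          exact one_div_le_one_div_of_le
            (by have := hlpos z (Ioo_subset_Icc_self hz); positivity)
            (by have := hlpos z (Ioo_subset_Icc_self hz); gcongr)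
      have h1 := hmono (left_mem_Icc.2 hyb.le) (right_mem_Icc.2 hyb.le) hyb.le
      simp only [hm, hly] at h1
      have h2 : (b - x) / (φ x * l b) - (y - x) / (φ x * φ y) = (b - y) / (φ y * l b) := by
        have : l b = ((b - x) * φ y - (b - y) * φ x) / (y - x) := by
          rw [hbr]; field_simp
        field_simp
        linarith
      have h3 : g b - g y ≤ (b - y) / (φ y * l b) := by linarith
      calc (g b - g y) * ((y - x) * l b) ≤ (b - y) / (φ y * l b) * ((y - x) * l b) := by gcongr
        _ = (y - x) / (φ x * φ y) * (b - y) * φ x := by field_simp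
        _ < (g y - g x) * (b - y) * φ x := by gcongr
  rw [← hbr] at key
  linarith

/-- A map with `g' = φ⁻²`, `φ` strictly convex, strictly expands cross ratios. -/
lemma crossRatio_lt_of_strictConvexOn {g φ : ℝ → ℝ} {s : Set ℝ} {a x y b : ℝ} (hax : a < x)
    (hxy : x < y) (hyb : y < b) (hs : StrictConvexOn ℝ s φ) (hsub : Ioo a b ⊆ s)
    (hg : ContinuousOn g (Icc a b)) (hd : ∀ z ∈ Ioo a b, HasDerivAt g (1 / (φ z) ^ 2) z)
    (hφ : ∀ z ∈ s, 0 < φ z) :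
    (b - x) * (y - a) * ((g b - g y) * (g x - g a)) <
      (g b - g x) * (g y - g a) * ((b - y) * (x - a)) := by
  have hxs : x ∈ s := hsub ⟨hax, hxy.trans hyb⟩
  have hys : y ∈ s := hsub ⟨hax.trans hxy, hyb⟩
  have h1 := ratio_lt_of_strictConvexOn hxy hyb hs hxs
    (fun z hz => hsub ⟨hax.trans hz.1, hz.2⟩)
    (hg.mono (Icc_subset_Icc_left hax.le)) (fun z hz => hd z ⟨hax.trans hz.1, hz.2⟩) hφ
  have hs' : StrictConvexOn ℝ (Neg.neg ⁻¹' s) (fun z => φ (-z)) := by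
    refine ⟨hs.1.neg, ?_⟩
    intro u hu v hv huv α β hα hβ hαβ
    have := hs.2 hu hv (fun h => huv (neg_injective h)) hα hβ hαβ
    simp only [smul_eq_mul] at this ⊢
    rwa [show -(α * u + β * v) = α * -u + β * -v by ring]
  -- Reflection in the origin gives the companion inequality with x and y interchanged. In the
  -- product of the two the factor φ x * φ y cancels.
  have h2 := ratio_lt_of_strictConvexOn (g := fun z => - g (-z)) (φ := fun z => φ (-z))
    (s := Neg.neg ⁻¹' s) (x := -y) (y := -x) (b := -a) (by linarith) (by linarith) hs'
    (by simpa using hys)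
    (fun z hz => hsub ⟨by linarith [hz.2], by linarith [hz.1]⟩)
    (by
      apply ContinuousOn.neg
      exact hg.comp continuous_neg.continuousOn
        (fun z hz => ⟨by linarith [hz.2], by linarith [hz.1]⟩))
    (by
      intro z hz
      have := (hd (-z) ⟨by linarith [hz.2], by linarith [hz.1]⟩).comp z (hasDerivAt_neg z)
      have h := this.neg
      simp only [mul_neg, mul_one, neg_neg] at h
      exact h)
    (fun z hz => hφ _ hz)
  simp only [neg_neg] at h2
  have hx0 := hφ x hxs
  have hy0 := hφ y hys
  have hgmono : StrictMonoOn g (Icc a b) := by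
    apply strictMonoOn_of_deriv_pos (convex_Icc a b) hg
    intro z hz; rw [interior_Icc] at hz
    rw [(hd z hz).deriv]
    have := hφ z (hsub hz)
    positivity
  have ia : a ∈ Icc a b := ⟨le_rfl, by linarith⟩
  have ix : x ∈ Icc a b := ⟨by linarith, by linarith⟩
  have iy : y ∈ Icc a b := ⟨by linarith, by linarith⟩
  have ib : b ∈ Icc a b := ⟨by linarith, le_rfl⟩
  have g1 := hgmono ia ix hax
  have g2 := hgmono ix iy hxy
  have g3 := hgmono iy ib hyb
  have h := mul_lt_mul'' h1 h2
    (by have : 0 < g b - g y := by linarith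
        have : 0 < b - x := by linarith
        positivity)
    (by have : 0 < -g a - -g x := by linarith
        have : 0 < -a - -y := by linarith
        positivity)
  have e : 0 < φ x * φ y := by positivity
  refine lt_of_mul_lt_mul_right (a := φ x * φ y) ?_ e.le
  nlinarith [h]

/-! ### Contracting Lorenz maps as cross ratio expanders -/

/-- The properties of a contracting Lorenz map used in the topological part of the argument. -/
structure Expander (f : ℝ → ℝ) (c : ℝ) : Prop where
  pos : 0 < c
  lt_one : c < 1
  map_zero : f 0 = 0
  map_one : f 1 = 1
  mapsTo : ∀ x ∈ Icc (0 : ℝ) 1, x ≠ c → f x ∈ Icc (0 : ℝ) 1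
  cont : ∀ x ∈ Icc (0 : ℝ) 1, x ≠ c → ContinuousWithinAt f (Icc 0 1) x
  mono : ∀ x y, 0 ≤ x → y ≤ 1 → c ∉ Icc x y → x < y → f x < f y
  crossRatio : ∀ a x y b, 0 ≤ a → b ≤ 1 → c ∉ Icc a b → a < x → x < y → y < b →
    (b - x) * (y - a) * ((f b - f y) * (f x - f a)) <
      (f b - f x) * (f y - f a) * ((b - y) * (x - a))
  repelling_zero : ∃ ε > 0, ∃ r > 1, ∀ x ∈ Ioo 0 ε, r * x ≤ f x
  repelling_one : ∃ ε > 0, ∃ r > 1, ∀ x ∈ Ioo 0 ε, f (1 - x) ≤ 1 - r * x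

lemma uniqueDiffOn_dom {a b c : ℝ} (h : a < b) : UniqueDiffOn ℝ (dom a b c) := by
  rw [dom, sdiff_eq]
  exact (uniqueDiffOn_Icc h).inter isOpen_compl_singleton

lemma dom_mem_nhds {a b c x : ℝ} (hx : x ∈ Ioo a b) (hc : x ≠ c) : dom a b c ∈ 𝓝 x := by
  rw [dom, sdiff_eq]
  exact inter_mem (Icc_mem_nhds hx.1 hx.2) (isOpen_compl_singleton.mem_nhds hc)

lemma hasDerivAt_derivWithin_dom {f : ℝ → ℝ} {a b c x : ℝ} {n : WithTop ℕ∞}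
    (hf : ContDiffOn ℝ n f (dom a b c)) (hn : n ≠ 0) (hx : x ∈ Ioo a b) (hc : x ≠ c) :
    HasDerivAt f (derivWithin f (dom a b c) x) x := by
  have hs := dom_mem_nhds hx hc
  rw [derivWithin_of_mem_nhds hs]
  exact ((hf.differentiableOn hn).differentiableAt hs).hasDerivAt

/-- With D = Df, the second derivative of D^(-1/2) is -(1/2) D^(-1/2) times the Schwarzian
derivative of f, hence positive. -/
lemma strictConvexOn_rpow_derivWithin {f : ℝ → ℝ} {c a b : ℝ}
    (hf : ContDiffOn ℝ 3 f (dom 0 1 c)) (hpos : ∀ x ∈ dom 0 1 c, 0 < derivWithin f (dom 0 1 c) x)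
    (hS : ∀ x ∈ dom 0 1 c, schwarzian f (dom 0 1 c) x < 0) (ha : 0 ≤ a) (hb : b ≤ 1)
    (hc : c ∉ Ioo a b) :
    StrictConvexOn ℝ (Ioo a b) (fun z => (derivWithin f (dom 0 1 c) z) ^ (-(1 / 2) : ℝ)) := by
  set s := dom 0 1 c with hs
  have hu : UniqueDiffOn ℝ s := uniqueDiffOn_dom one_pos
  set d1 := derivWithin f s with hd1
  set d2 := derivWithin d1 s with hd2
  set d3 := derivWithin d2 s with hd3
  have c1 : ContDiffOn ℝ 2 d1 s := hf.derivWithin hu (by norm_num)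
  have c2 : ContDiffOn ℝ 1 d2 s := c1.derivWithin hu (by norm_num)
  have hin : ∀ z ∈ Ioo a b, z ∈ Ioo (0 : ℝ) 1 ∧ z ≠ c := fun z hz =>
    ⟨⟨lt_of_le_of_lt ha hz.1, lt_of_lt_of_le hz.2 hb⟩, fun h => hc (h ▸ hz)⟩
  have hdom : ∀ z ∈ Ioo a b, z ∈ s := fun z hz =>
    ⟨Ioo_subset_Icc_self (hin z hz).1, (hin z hz).2⟩
  have h1 : ∀ z ∈ Ioo a b, HasDerivAt d1 (d2 z) z := fun z hz =>
    hasDerivAt_derivWithin_dom c1 (by norm_num) (hin z hz).1 (hin z hz).2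
  have h2 : ∀ z ∈ Ioo a b, HasDerivAt d2 (d3 z) z := fun z hz =>
    hasDerivAt_derivWithin_dom c2 (by norm_num) (hin z hz).1 (hin z hz).2
  have hφ : ∀ z ∈ Ioo a b, HasDerivAt (fun z => d1 z ^ (-(1 / 2) : ℝ))
      (d2 z * (-(1 / 2)) * d1 z ^ (-(1 / 2) - 1 : ℝ)) z := fun z hz =>
    (h1 z hz).rpow_const (Or.inl (hpos z (hdom z hz)).ne')
  apply strictConvexOn_of_deriv2_pos (convex_Ioo a b)
  · exact fun z hz => (hφ z hz).continuousAt.continuousWithinAt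
  · intro z hz
    rw [isOpen_Ioo.interior_eq] at hz
    have e : deriv (fun z => d1 z ^ (-(1 / 2) : ℝ)) =ᶠ[𝓝 z]
        fun z => d2 z * (-(1 / 2)) * d1 z ^ (-(1 / 2) - 1 : ℝ) := by
      filter_upwards [isOpen_Ioo.mem_nhds hz] with w hw using (hφ w hw).deriv
    have hp := hpos z (hdom z hz)
    have h3 := ((h2 z hz).mul_const (-(1 / 2) : ℝ)).mul
      ((h1 z hz).rpow_const (p := (-(1 / 2) - 1 : ℝ)) (Or.inl hp.ne'))
    simp only [Function.iterate_succ, Function.iterate_zero, Function.comp, id]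
    rw [e.deriv_eq]
    have h4 : deriv (fun z => d2 z * (-(1 / 2)) * d1 z ^ (-(1 / 2) - 1 : ℝ)) z = _ := h3.deriv
    rw [h4]
    have hS' := hS z (hdom z hz)
    simp only [schwarzian, iteratedDerivWithin_succ, iteratedDerivWithin_zero] at hS'
    rw [← hd1, ← hd2, ← hd3] at hS'
    change 0 < d1 z at hp
    rw [Real.rpow_sub hp (-(1 / 2) - 1), Real.rpow_sub hp (-(1 / 2)), Real.rpow_one]
    have hq : 0 < d1 z ^ (-(1 / 2) : ℝ) := Real.rpow_pos_of_pos hp _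
    have : d3 z * -(1 / 2) * (d1 z ^ (-(1 / 2) : ℝ) / d1 z) + d2 z * -(1 / 2) *
        (d2 z * (-(1 / 2) - 1) * (d1 z ^ (-(1 / 2) : ℝ) / d1 z / d1 z)) =
        - (1 / 2) * d1 z ^ (-(1 / 2) : ℝ) * (d3 z / d1 z - 3 / 2 * (d2 z / d1 z) ^ 2) := by
      field_simp
      ring
    rw [this]
    have := mul_pos hq (neg_pos.2 hS')
    linarith

/-- Turns the derivative at a repelling fixed point into linear growth, the only form in which
repulsion is used later. -/
lemma exists_mul_le_of_one_lt_derivWithin {g : ℝ → ℝ} {s : Set ℝ} {L : ℝ} (h0 : g 0 = 0)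
    (hs : s ∈ 𝓝[>] (0 : ℝ)) (hd : HasDerivWithinAt g L s 0) (hL : 1 < L) :
    ∃ ε > 0, ∃ r > 1, ∀ x ∈ Ioo 0 ε, r * x ≤ g x := by
  have h1 : HasDerivWithinAt g L (Ioi 0 ∩ s) 0 := hd.mono inter_subset_right
  have h2 : HasDerivWithinAt g L (Ioi 0) 0 := (hasDerivWithinAt_inter' hs).1 h1
  rw [hasDerivWithinAt_iff_tendsto_slope' (by simp)] at h2
  have h3 := h2.eventually (eventually_ge_nhds (show (1 + L) / 2 < L by linarith))
  obtain ⟨ε, hε, h4⟩ := mem_nhdsGT_iff_exists_Ioo_subset.1 h3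
  refine ⟨ε, hε, (1 + L) / 2, by linarith, fun x hx => ?_⟩
  have h5 : (1 + L) / 2 ≤ slope g 0 x := h4 hx
  rw [slope_def_field, h0, sub_zero, sub_zero, le_div_iff₀ hx.1] at h5
  exact h5

lemma IsContractingLorenz.expander {f : ℝ → ℝ} {c : ℝ} (h : IsContractingLorenz f c) :
    Expander f c := by
  have hl := h.lorenz
  have hdom : ∀ x, x ∈ Icc (0 : ℝ) 1 → x ≠ c → x ∈ dom 0 1 c := fun x h1 h2 => ⟨h1, h2⟩
  have hcont := hl.contDiffOn.continuousOn
  have hIcc : ∀ a b : ℝ, 0 ≤ a → b ≤ 1 → c ∉ Icc a b → Icc a b ⊆ dom 0 1 c :=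
    fun a b ha hb hc z hz => ⟨⟨ha.trans hz.1, hz.2.trans hb⟩, fun e => hc (e ▸ hz)⟩
  have hder : ∀ a b : ℝ, 0 ≤ a → b ≤ 1 → c ∉ Icc a b → ∀ z ∈ Ioo a b,
      HasDerivAt f (derivWithin f (dom 0 1 c) z) z := fun a b ha hb hc z hz =>
    hasDerivAt_derivWithin_dom hl.contDiffOn (by norm_num)
      ⟨lt_of_le_of_lt ha hz.1, lt_of_lt_of_le hz.2 hb⟩
      (fun e => hc (e ▸ Ioo_subset_Icc_self hz))
  have hc := hl.singular_mem
  refine ⟨hc.1, hc.2, hl.map_left, hl.map_right, fun x hx hxc => hl.mapsTo (hdom x hx hxc), ?_,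
    ?_, ?_, ?_, ?_⟩
  · intro x hx hxc
    have h1 := hcont x (hdom x hx hxc)
    rw [dom, sdiff_eq, inter_comm] at h1
    exact (continuousWithinAt_inter' (mem_nhdsWithin_of_mem_nhds
      (isOpen_compl_singleton.mem_nhds hxc))).1 (by rwa [inter_comm])
  · intro x y hx hy hcn hxy
    have : StrictMonoOn f (Icc x y) := by
      apply strictMonoOn_of_deriv_pos (convex_Icc x y) (hcont.mono (hIcc x y hx hy hcn))
      intro z hz
      rw [interior_Icc] at hz
      rw [(hder x y hx hy hcn z hz).deriv]
      exact hl.deriv_pos z (hIcc x y hx hy hcn (Ioo_subset_Icc_self hz))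
    exact this ⟨le_rfl, hxy.le⟩ ⟨hxy.le, le_rfl⟩ hxy
  · intro a x y b ha hb hcn hax hxy hyb
    have hp : ∀ z ∈ Ioo a b, 0 < derivWithin f (dom 0 1 c) z := fun z hz =>
      hl.deriv_pos z (hIcc a b ha hb hcn (Ioo_subset_Icc_self hz))
    refine crossRatio_lt_of_strictConvexOn hax hxy hyb
      (strictConvexOn_rpow_derivWithin hl.contDiffOn hl.deriv_pos h.schwarzian_neg ha hb
        (fun hh => hcn (Ioo_subset_Icc_self hh))) subset_rfl (hcont.mono (hIcc a b ha hb hcn))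
      ?_ (fun z hz => Real.rpow_pos_of_pos (hp z hz) _)
    intro z hz
    convert hder a b ha hb hcn z hz using 1
    rw [← Real.rpow_natCast, ← Real.rpow_mul (hp z hz).le]
    norm_num [Real.rpow_neg_one]
  · refine exists_mul_le_of_one_lt_derivWithin hl.map_left ?_
      ((hl.contDiffOn.differentiableOn (by norm_num)) 0 ⟨by simp, hc.1.ne⟩).hasDerivWithinAt
      h.repelling_zero
    filter_upwards [Ioo_mem_nhdsGT hc.1] with z hz
    exact ⟨⟨hz.1.le, (hz.2.trans hc.2).le⟩, hz.2.ne⟩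
  · have hd := ((hl.contDiffOn.differentiableOn (by norm_num)) 1
      ⟨by simp, hc.2.ne'⟩).hasDerivWithinAt
    have hg : HasDerivWithinAt (fun x => 1 - f (1 - x)) (derivWithin f (dom 0 1 c) 1)
        ((fun x => 1 - x) ⁻¹' dom 0 1 c) 0 := by
      have h1 : HasDerivWithinAt (fun x : ℝ => 1 - x) (-1) ((fun x => 1 - x) ⁻¹' dom 0 1 c) 0 :=
        ((hasDerivAt_id (0 : ℝ)).const_sub 1).hasDerivWithinAt
      have h2 : HasDerivWithinAt f (derivWithin f (dom 0 1 c) 1) (dom 0 1 c) (1 - 0) := by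
        rwa [sub_zero]
      have := (h2.comp (0 : ℝ) h1 (fun _ hx => hx)).const_sub 1
      simp only [mul_neg, mul_one, neg_neg] at this
      exact this
    have hs : (fun x => 1 - x) ⁻¹' dom 0 1 c ∈ 𝓝[>] (0 : ℝ) := by
      filter_upwards [Ioo_mem_nhdsGT (show (0 : ℝ) < 1 - c by linarith [hc.2])] with z hz
      exact ⟨⟨by linarith [hz.2, hc.1], by linarith [hz.1]⟩,
        fun e => by simp only [mem_singleton_iff] at e; linarith [hz.2]⟩
    obtain ⟨ε, hε, r, hr, H⟩ := exists_mul_le_of_one_lt_derivWithin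
      (by simp [hl.map_right]) hs hg h.repelling_one
    exact ⟨ε, hε, r, hr, fun x hx => by linarith [H x hx]⟩

/-! ### Monotone branches of iterates and the reflection symmetry -/

/-- The first `m` points of the orbits of points in `[a, b]` are different from `c`. -/
def Avoids (f : ℝ → ℝ) (c : ℝ) (m : ℕ) (a b : ℝ) : Prop := ∀ j < m, ∀ z ∈ Icc a b, f^[j] z ≠ c

lemma Avoids.mono {f : ℝ → ℝ} {c : ℝ} {m m' : ℕ} {a b a' b' : ℝ} (h : Avoids f c m a b)
    (hm : m' ≤ m) (ha : a ≤ a') (hb : b' ≤ b) : Avoids f c m' a' b' :=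
  fun j hj z hz => h j (hj.trans_le hm) z ⟨ha.trans hz.1, hz.2.trans hb⟩

lemma Avoids.union {f : ℝ → ℝ} {c : ℝ} {m : ℕ} {x y z : ℝ} (h : Avoids f c m x y)
    (h' : Avoids f c m y z) : Avoids f c m x z := fun j hj w hw =>
  (le_total w y).elim (fun e => h j hj w ⟨hw.1, e⟩) (fun e => h' j hj w ⟨e, hw.2⟩)

/-- The map `f` in the coordinate `1 - x`. -/
def reflect (f : ℝ → ℝ) (x : ℝ) : ℝ := 1 - f (1 - x)

lemma reflect_iterate (f : ℝ → ℝ) (n : ℕ) (x : ℝ) : (reflect f)^[n] x = 1 - f^[n] (1 - x) := by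
  induction n with
  | zero => simp
  | succ n ih => rw [Function.iterate_succ_apply', Function.iterate_succ_apply', ih, reflect]; simp

lemma Avoids.reflect {f : ℝ → ℝ} {c : ℝ} {m : ℕ} {a b : ℝ} (h : Avoids f c m a b) :
    Avoids (reflect f) (1 - c) m (1 - b) (1 - a) := by
  intro j hj z hz e
  rw [reflect_iterate] at e
  exact h j hj (1 - z) ⟨by linarith [hz.2], by linarith [hz.1]⟩ (by linarith)

lemma Avoids.of_reflect {f : ℝ → ℝ} {c : ℝ} {m : ℕ} {a b : ℝ}
    (h : Avoids (Lorenz.reflect f) (1 - c) m a b) : Avoids f c m (1 - b) (1 - a) := by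
  intro j hj z hz e
  refine h j hj (1 - z) ⟨by linarith [hz.2], by linarith [hz.1]⟩ ?_
  rw [reflect_iterate, sub_sub_cancel, e]

namespace Expander

variable {f : ℝ → ℝ} {c : ℝ}

/-- The class is symmetric under x ↦ 1 - x, so each statement about the left side of c yields its
counterpart on the right. -/
lemma reflect (h : Expander f c) : Expander (reflect f) (1 - c) := by
  have hI : ∀ x ∈ Icc (0 : ℝ) 1, 1 - x ∈ Icc (0 : ℝ) 1 := fun x hx =>
    ⟨by linarith [hx.2], by linarith [hx.1]⟩
  have hne : ∀ x : ℝ, x ≠ 1 - c → 1 - x ≠ c := fun x hx e => hx (by linarith)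
  refine ⟨by linarith [h.lt_one], by linarith [h.pos], by simp [Lorenz.reflect, h.map_one],
    by simp [Lorenz.reflect, h.map_zero], fun x hx hxc => hI _ (h.mapsTo _ (hI x hx) (hne x hxc)),
    ?_, ?_, ?_, ?_, ?_⟩
  · intro x hx hxc
    have h1 : ContinuousWithinAt (fun x : ℝ => 1 - x) (Icc 0 1) x := by fun_prop
    exact continuousWithinAt_const.sub
      ((h.cont (1 - x) (hI x hx) (hne x hxc)).comp h1 (fun y hy => hI y hy))
  · intro x y hx hy hc hxy
    have := h.mono (1 - y) (1 - x) (by linarith) (by linarith)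
      (fun hm => hc ⟨by linarith [hm.2], by linarith [hm.1]⟩) (by linarith)
    simp only [Lorenz.reflect]; linarith
  · intro a x y b ha hb hc hax hxy hyb
    have := h.crossRatio (1 - b) (1 - y) (1 - x) (1 - a) (by linarith) (by linarith)
      (fun hm => hc ⟨by linarith [hm.2], by linarith [hm.1]⟩) (by linarith) (by linarith)
      (by linarith)
    simp only [Lorenz.reflect]; linarith
  · obtain ⟨ε, hε, r, hr, H⟩ := h.repelling_one
    exact ⟨ε, hε, r, hr, fun x hx => by simp only [Lorenz.reflect]; linarith [H x hx]⟩
  · obtain ⟨ε, hε, r, hr, H⟩ := h.repelling_zero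
    refine ⟨ε, hε, r, hr, fun x hx => ?_⟩
    simp only [Lorenz.reflect, sub_sub_cancel]; linarith [H x hx]

lemma iterate_mem (h : Expander f c) {x : ℝ} (hx : x ∈ Icc (0 : ℝ) 1) :
    ∀ {m : ℕ}, (∀ j < m, f^[j] x ≠ c) → f^[m] x ∈ Icc (0 : ℝ) 1
  | 0, _ => hx
  | m + 1, hm => by
    rw [Function.iterate_succ_apply']
    exact h.mapsTo _ (h.iterate_mem hx fun j hj => hm j (hj.trans (Nat.lt_succ_self m)))
      (hm m (Nat.lt_succ_self m))

lemma iterate_tendsto (h : Expander f c) {x : ℝ} (hx : x ∈ Icc (0 : ℝ) 1) {m : ℕ}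
    (hm : ∀ j < m, f^[j] x ≠ c) :
    Tendsto f^[m] (𝓝[Icc 0 1] x) (𝓝[Icc 0 1] (f^[m] x)) := by
  induction m with
  | zero => simpa using tendsto_id
  | succ m ih =>
    have h1 := ih fun j hj => hm j (hj.trans (Nat.lt_succ_self m))
    have h2 := h.iterate_mem hx fun j hj => hm j (hj.trans (Nat.lt_succ_self m))
    have hc := hm m (Nat.lt_succ_self m)
    rw [Function.iterate_succ']
    refine Tendsto.comp ?_ h1
    refine tendsto_nhdsWithin_of_tendsto_nhds_of_eventually_within _ (h.cont _ h2 hc) ?_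
    filter_upwards [self_mem_nhdsWithin,
      mem_nhdsWithin_of_mem_nhds (isOpen_compl_singleton.mem_nhds hc)] with z hz hzc
    exact h.mapsTo z hz hzc

lemma iterate_continuousWithinAt (h : Expander f c) {x : ℝ} (hx : x ∈ Icc (0 : ℝ) 1) {m : ℕ}
    (hm : ∀ j < m, f^[j] x ≠ c) : ContinuousWithinAt f^[m] (Icc 0 1) x :=
  (h.iterate_tendsto hx hm).mono_right nhdsWithin_le_nhds

lemma iterate_continuousOn (h : Expander f c) {m : ℕ} {a b : ℝ} (ha : 0 ≤ a) (hb : b ≤ 1)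
    (hA : Avoids f c m a b) : ContinuousOn f^[m] (Icc a b) := fun x hx =>
  (h.iterate_continuousWithinAt ⟨ha.trans hx.1, hx.2.trans hb⟩ fun j hj => hA j hj x hx).mono
    (Icc_subset_Icc ha hb)

/-- Preimages under iterates, by the intermediate value theorem. -/
lemma exists_iterate_eq (h : Expander f c) {m : ℕ} {a b y : ℝ} (ha : 0 ≤ a) (hab : a ≤ b)
    (hb : b ≤ 1) (hA : Avoids f c m a b) (hy : y ∈ Icc (f^[m] a) (f^[m] b)) :
    ∃ z ∈ Icc a b, f^[m] z = y :=
  intermediate_value_Icc hab (h.iterate_continuousOn ha hb hA) hy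

/-- By the intermediate value theorem a value c between the two images would be attained. -/
lemma not_mem_of_avoids (h : Expander f c) {m j : ℕ} {a b : ℝ} (ha : 0 ≤ a)
    (hb : b ≤ 1) (hA : Avoids f c m a b) (hj : j < m) {x y : ℝ} (hx : a ≤ x) (hxy : x ≤ y)
    (hy : y ≤ b) : c ∉ Icc (f^[j] x) (f^[j] y) := by
  intro hc
  obtain ⟨z, hz, e⟩ := h.exists_iterate_eq (ha.trans hx) hxy (hy.trans hb)
    (hA.mono hj.le hx hy) hc
  exact hA j hj z ⟨hx.trans hz.1, hz.2.trans hy⟩ e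

lemma iterate_strictMonoOn (h : Expander f c) {m : ℕ} {a b : ℝ} (ha : 0 ≤ a) (hb : b ≤ 1)
    (hA : Avoids f c m a b) : StrictMonoOn f^[m] (Icc a b) := by
  induction m with
  | zero => simpa using strictMonoOn_id
  | succ m ih =>
    intro x hx y hy hxy
    have h1 := ih (hA.mono (Nat.le_succ m) le_rfl le_rfl) hx hy hxy
    rw [Function.iterate_succ_apply', Function.iterate_succ_apply']
    refine h.mono _ _ ?_ ?_
      (h.not_mem_of_avoids ha hb hA (Nat.lt_succ_self m) hx.1 hxy.le hy.2) h1
    · exact (h.iterate_mem ⟨ha.trans hx.1, hx.2.trans hb⟩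
        fun j hj => hA j (hj.trans (Nat.lt_succ_self m)) x hx).1
    · exact (h.iterate_mem ⟨ha.trans hy.1, hy.2.trans hb⟩
        fun j hj => hA j (hj.trans (Nat.lt_succ_self m)) y hy).2

lemma iterate_lt (h : Expander f c) {m : ℕ} {a b : ℝ} (ha : 0 ≤ a) (hab : a < b) (hb : b ≤ 1)
    (hA : Avoids f c m a b) : f^[m] a < f^[m] b :=
  h.iterate_strictMonoOn ha hb hA ⟨le_rfl, hab.le⟩ ⟨hab.le, le_rfl⟩ hab

/-- Cross ratio inequalities multiply under composition. At least one iterate is needed for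
strictness. -/
lemma iterate_crossRatio_succ (h : Expander f c) {m : ℕ} {a x y b : ℝ} (ha : 0 ≤ a) (hb : b ≤ 1)
    (hA : Avoids f c (m + 1) a b) (hax : a < x) (hxy : x < y) (hyb : y < b) :
    (b - x) * (y - a) * ((f^[m + 1] b - f^[m + 1] y) * (f^[m + 1] x - f^[m + 1] a)) <
      (f^[m + 1] b - f^[m + 1] x) * (f^[m + 1] y - f^[m + 1] a) * ((b - y) * (x - a)) := by
  induction m with
  | zero =>
    simpa using h.crossRatio a x y b ha hb (fun hc => hA 0 one_pos c hc rfl) hax hxy hyb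
  | succ m ih =>
    have hA' := hA.mono (Nat.le_succ _) le_rfl le_rfl
    have h1 := ih hA'
    have g1 : f^[m + 1] a < f^[m + 1] x := h.iterate_lt ha hax (by linarith)
      (hA'.mono le_rfl le_rfl (by linarith))
    have g2 : f^[m + 1] x < f^[m + 1] y := h.iterate_lt (by linarith) hxy (by linarith)
      (hA'.mono le_rfl (by linarith) (by linarith))
    have g3 : f^[m + 1] y < f^[m + 1] b := h.iterate_lt (by linarith) hyb hb
      (hA'.mono le_rfl (by linarith) (by linarith))
    have g4 : f^[m + 2] a < f^[m + 2] x := h.iterate_lt ha hax (by linarith)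
      (hA.mono le_rfl le_rfl (by linarith))
    have g6 : f^[m + 2] y < f^[m + 2] b := h.iterate_lt (by linarith) hyb hb
      (hA.mono le_rfl (by linarith) (by linarith))
    have h2 := h.crossRatio (f^[m + 1] a) (f^[m + 1] x) (f^[m + 1] y) (f^[m + 1] b)
      (h.iterate_mem ⟨ha, by linarith⟩ fun j hj => hA' j hj a ⟨le_rfl, by linarith⟩).1
      (h.iterate_mem ⟨by linarith, hb⟩ fun j hj => hA' j hj b ⟨by linarith, le_rfl⟩).2
      (h.not_mem_of_avoids ha hb hA (Nat.lt_succ_self _) le_rfl (by linarith) le_rfl) g1 g2 g3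
    simp only [← Function.iterate_succ_apply' f] at h2
    set A := (b - x) * (y - a)
    set B := (b - y) * (x - a) with hB
    set N := (f^[m + 1] b - f^[m + 1] x) * (f^[m + 1] y - f^[m + 1] a)
    set D := (f^[m + 1] b - f^[m + 1] y) * (f^[m + 1] x - f^[m + 1] a) with hD
    set N' := (f^[m + 2] b - f^[m + 2] x) * (f^[m + 2] y - f^[m + 2] a)
    set D' := (f^[m + 2] b - f^[m + 2] y) * (f^[m + 2] x - f^[m + 2] a) with hD'
    have hD0 : 0 < D := mul_pos (by linarith) (by linarith)
    have hD0' : 0 < D' := mul_pos (by linarith) (by linarith)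
    have hB0 : 0 < B := mul_pos (by linarith) (by linarith)
    change A * D < N * B at h1
    change N * D' < N' * D at h2
    change A * D' < N' * B
    have e1 : A * D * D' < N * B * D' := by gcongr
    have e2 : N * D' * B < N' * D * B := by gcongr
    refine lt_of_mul_lt_mul_right (a := D) ?_ hD0.le
    linarith

lemma iterate_crossRatio (h : Expander f c) {m : ℕ} {a x y b : ℝ} (ha : 0 ≤ a) (hb : b ≤ 1)
    (hA : Avoids f c m a b) (hax : a < x) (hxy : x < y) (hyb : y < b) :
    (b - x) * (y - a) * ((f^[m] b - f^[m] y) * (f^[m] x - f^[m] a)) ≤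
      (f^[m] b - f^[m] x) * (f^[m] y - f^[m] a) * ((b - y) * (x - a)) := by
  cases m with
  | zero => simp
  | succ m => exact (h.iterate_crossRatio_succ ha hb hA hax hxy hyb).le

/-- The graph of an iterate cannot cross the diagonal three times on an interval of monotonicity
in the pattern below, up, down, up. -/
lemma not_sign_pattern (h : Expander f c) {m : ℕ} (hm : 0 < m) {a x y b : ℝ} (ha : 0 ≤ a)
    (hb : b ≤ 1) (hA : Avoids f c m a b) (hax : a < x) (hxy : x < y) (hyb : y < b)
    (h1 : f^[m] a ≤ a) (h2 : x ≤ f^[m] x) (h3 : f^[m] y ≤ y) (h4 : b ≤ f^[m] b) : False := by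
  obtain ⟨m, rfl⟩ := Nat.exists_eq_succ_of_ne_zero hm.ne'
  have key := h.iterate_crossRatio_succ ha hb hA hax hxy hyb
  simp only [Nat.succ_eq_add_one] at *
  have g2 : f^[m + 1] x < f^[m + 1] y := h.iterate_lt (by linarith) hxy (by linarith)
    (hA.mono le_rfl (by linarith) (by linarith))
  generalize f^[m + 1] a = A at *
  generalize f^[m + 1] x = X at *
  generalize f^[m + 1] y = Y at *
  generalize f^[m + 1] b = B at *
  -- In this pattern the middle gap does not grow and the outer gaps do not shrink. So neither (B -
  -- X)/(B - Y) nor (Y - A)/(X - A) exceeds its value before iteration, against strict expansion of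
  -- their product.
  have e1 : (B - X) * (b - y) ≤ (b - x) * (B - Y) := by
    nlinarith [mul_nonneg (show 0 ≤ (y - x) - (Y - X) by linarith) (show 0 ≤ b - y by linarith),
      mul_nonneg (show 0 ≤ y - x by linarith) (show 0 ≤ (B - Y) - (b - y) by linarith)]
  have e2 : (Y - A) * (x - a) ≤ (y - a) * (X - A) := by
    nlinarith [mul_nonneg (show 0 ≤ (y - x) - (Y - X) by linarith) (show 0 ≤ x - a by linarith),
      mul_nonneg (show 0 ≤ y - x by linarith) (show 0 ≤ (X - A) - (x - a) by linarith)]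
  have := mul_le_mul e1 e2 (mul_nonneg (by linarith) (by linarith))
    (mul_nonneg (by linarith) (by linarith))
  linarith

lemma eventually_avoids (h : Expander f c) {x : ℝ} (hx : x ∈ Icc (0 : ℝ) 1) {m : ℕ}
    (hm : ∀ j < m, f^[j] x ≠ c) : ∀ᶠ z in 𝓝[Icc 0 1] x, ∀ j < m, f^[j] z ≠ c := by
  have : ∀ j ∈ Finset.range m, ∀ᶠ z in 𝓝[Icc 0 1] x, f^[j] z ≠ c := fun j hj => by
    rw [Finset.mem_range] at hj
    exact (h.iterate_continuousWithinAt hx fun i hi => hm i (hi.trans hj)).eventually_ne (hm j hj)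
  have := (Finset.eventually_all _).2 this
  simpa using this

/-- Iterates near the repelling fixed point `0`. -/
lemma eventually_le_iterate (h : Expander f c) (m : ℕ) :
    ∀ᶠ x in 𝓝[>] (0 : ℝ), x ≤ f^[m] x := by
  have hz : ∀ j, f^[j] 0 = 0 := fun j => Function.iterate_fixed h.map_zero j
  have hle : 𝓝[>] (0 : ℝ) ≤ 𝓝[Icc 0 1] 0 := by
    rw [← nhdsWithin_Ioo_eq_nhdsGT one_pos]
    exact nhdsWithin_mono _ Ioo_subset_Icc_self
  induction m with
  | zero => simp
  | succ m ih =>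
    have h1 : Tendsto f^[m] (𝓝[>] 0) (𝓝 0) := by
      have := h.iterate_continuousWithinAt (x := 0) (by simp) (m := m)
        (fun j _ => by rw [hz]; exact h.pos.ne)
      rw [ContinuousWithinAt, hz] at this
      exact this.mono_left hle
    obtain ⟨ε, hε, r, hr, H⟩ := h.repelling_zero
    filter_upwards [ih, h1.eventually (gt_mem_nhds hε), self_mem_nhdsWithin] with x hx hx' hx0
    rw [Function.iterate_succ_apply']
    have hx0 : 0 < x := hx0
    have hp : 0 < f^[m] x := lt_of_lt_of_le hx0 hx
    have := H _ ⟨hp, hx'⟩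
    nlinarith

/-- The maximal interval of monotonicity of `f^m` to the left of `x`. -/
lemma avoids_or_exists_preimage (h : Expander f c) {x : ℝ} (hx : x ∈ Icc (0 : ℝ) 1) (m : ℕ)
    (hm : ∀ j < m, f^[j] x ≠ c) :
    Avoids f c m 0 x ∨ ∃ t, 0 ≤ t ∧ t < x ∧ ∃ i < m, f^[i] t = c ∧ Avoids f c i t x ∧
      ∀ z, t < z → Avoids f c m z x := by
  induction m with
  | zero => exact Or.inl fun j hj => absurd hj (Nat.not_lt_zero j)
  | succ m ih =>
    have hlt : ∀ j, j < m + 1 ↔ j < m ∨ j = m := fun j => Nat.lt_succ_iff_lt_or_eq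
    have step : ∀ t', 0 ≤ t' → t' ≤ x → Avoids f c m t' x → f^[m] t' = c →
        ∃ t, 0 ≤ t ∧ t < x ∧ ∃ i < m + 1, f^[i] t = c ∧ Avoids f c i t x ∧
      ∀ z, t < z → Avoids f c (m + 1) z x := by
      -- A preimage t' of c under f^m inside the current branch becomes the new left end: to its
      -- right f^m is strictly larger than c.
      intro t' h0 htx hA e
      have hne : t' ≠ x := fun e' => hm m (Nat.lt_succ_self m) (e' ▸ e)
      refine ⟨t', h0, lt_of_le_of_ne htx hne, m, Nat.lt_succ_self m, e, hA, ?_⟩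
      intro z hz j hj w hw
      rcases (hlt j).1 hj with hj | rfl
      · exact hA j hj w ⟨hz.le.trans hw.1, hw.2⟩
      · intro e'
        have := h.iterate_strictMonoOn h0 hx.2 hA ⟨le_rfl, htx⟩ ⟨hz.le.trans hw.1, hw.2⟩
          (hz.trans_le hw.1)
        rw [e, e'] at this
        exact lt_irrefl _ this
    rcases ih fun j hj => hm j (hj.trans (Nat.lt_succ_self m)) with hA | ⟨t, h0, htx, i, hi, e, hA, hz⟩
    · by_cases hc : ∃ t' ∈ Icc 0 x, f^[m] t' = c
      · obtain ⟨t', ht', e⟩ := hc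
        exact Or.inr (step t' ht'.1 ht'.2 (hA.mono le_rfl ht'.1 le_rfl) e)
      · push Not at hc
        refine Or.inl fun j hj z hz => ?_
        rcases (hlt j).1 hj with hj | rfl
        · exact hA j hj z hz
        · exact hc z hz
    · right
      by_cases hc : ∃ t' ∈ Ioc t x, f^[m] t' = c
      · obtain ⟨t', ht', e⟩ := hc
        exact step t' (h0.trans ht'.1.le) ht'.2 (hz t' ht'.1) e
      · push Not at hc
        refine ⟨t, h0, htx, i, hi.trans (Nat.lt_succ_self m), e, hA, fun z htz j hj w hw => ?_⟩
        rcases (hlt j).1 hj with hj | rfl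
        · exact hz z htz j hj w hw
        · exact hc w ⟨htz.trans_le hw.1, hw.2⟩

end Expander

/-! ### Return intervals and their nesting -/

/-- `[p, q]` is a return interval around `c` with constant return times `k` on `[p, c)` and `l`
on `(c, q]`. -/
structure Level (f : ℝ → ℝ) (c p q : ℝ) (k l : ℕ) : Prop where
  kpos : 0 < k
  lpos : 0 < l
  zero_le : 0 ≤ p
  left_lt : p < c
  lt_right : c < q
  le_one : q ≤ 1
  fix_left : f^[k] p = p
  fix_right : f^[l] q = q
  left_mem : ∀ x ∈ Ico p c, f^[k] x ∈ Icc p q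
  right_mem : ∀ x ∈ Ioc c q, f^[l] x ∈ Icc p q
  left_not_mem : ∀ x ∈ Ico p c, ∀ j, 0 < j → j < k → f^[j] x ∉ Icc p q
  right_not_mem : ∀ x ∈ Ioc c q, ∀ j, 0 < j → j < l → f^[j] x ∉ Icc p q
  left_cross : ∃ x ∈ Ioo p c, c < f^[k] x
  right_cross : ∃ x ∈ Ioo c q, f^[l] x < c

namespace Level

variable {f : ℝ → ℝ} {c p q : ℝ} {k l : ℕ}

lemma reflect (L : Level f c p q k l) : Level (reflect f) (1 - c) (1 - q) (1 - p) l k := by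
  have hI : ∀ a b x : ℝ, x ∈ Icc (1 - b) (1 - a) ↔ 1 - x ∈ Icc a b := fun a b x => by
    simp only [mem_Icc]; constructor <;> rintro ⟨h1, h2⟩ <;> constructor <;> linarith
  have hL : ∀ x ∈ Ico (1 - q) (1 - c), 1 - x ∈ Ioc c q := fun x hx =>
    ⟨by linarith [hx.2], by linarith [hx.1]⟩
  have hR : ∀ x ∈ Ioc (1 - c) (1 - p), 1 - x ∈ Ico p c := fun x hx =>
    ⟨by linarith [hx.2], by linarith [hx.1]⟩
  obtain ⟨x, hx, hxc⟩ := L.left_cross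
  obtain ⟨y, hy, hyc⟩ := L.right_cross
  refine ⟨L.lpos, L.kpos, by linarith [L.le_one], by linarith [L.lt_right],
    by linarith [L.left_lt], by linarith [L.zero_le], ?_, ?_, ?_, ?_, ?_, ?_,
    ⟨1 - y, ⟨by linarith [hy.2], by linarith [hy.1]⟩, ?_⟩,
    ⟨1 - x, ⟨by linarith [hx.2], by linarith [hx.1]⟩, ?_⟩⟩ <;>
    simp only [reflect_iterate, sub_sub_cancel, hI]
  · rw [L.fix_right]
  · rw [L.fix_left]
  · exact fun x hx => L.right_mem _ (hL x hx)
  · exact fun x hx => L.left_mem _ (hR x hx)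
  · exact fun x hx => L.right_not_mem _ (hL x hx)
  · exact fun x hx => L.left_not_mem _ (hR x hx)
  · linarith
  · linarith

lemma avoids_left (L : Level f c p q k l) {y : ℝ} (hy : y < c) : Avoids f c k p y := by
  intro j hj z hz e
  rcases Nat.eq_zero_or_pos j with rfl | h0
  · exact absurd e (hz.2.trans_lt hy).ne
  · exact L.left_not_mem z ⟨hz.1, hz.2.trans_lt hy⟩ j h0 hj
      (e ▸ ⟨L.left_lt.le, L.lt_right.le⟩)

lemma avoids_right (L : Level f c p q k l) {y : ℝ} (hy : c < y) : Avoids f c l y q := by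
  intro j hj z hz e
  rcases Nat.eq_zero_or_pos j with rfl | h0
  · exact absurd e (hy.trans_le hz.1).ne'
  · exact L.right_not_mem z ⟨hy.trans_le hz.1, hz.2⟩ j h0 hj
      (e ▸ ⟨L.left_lt.le, L.lt_right.le⟩)

/-- A crossing below c persists for all points closer to c, by monotonicity; the strict inequality
at p comes from comparison with a point closer still. -/
lemma exists_iterate_lt (h : Expander f c) (L : Level f c p q k l) {b : ℝ} (hb : c < b) :
    ∃ y ∈ Ioo c q, y < b ∧ p < f^[l] y ∧ f^[l] y < c := by
  obtain ⟨y, hy, hyc⟩ := L.right_cross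
  have key : ∀ z, c < z → z < y → f^[l] z < f^[l] y := fun z hz hzy =>
    h.iterate_lt (h.pos.trans hz).le hzy (hy.2.le.trans L.le_one)
      ((L.avoids_right hz).mono le_rfl le_rfl hy.2.le)
  obtain ⟨z, hz1, hz2⟩ := exists_between (lt_min hy.1 hb)
  obtain ⟨w, hw1, hw2⟩ := exists_between hz1
  have hzy := hz2.trans_le (min_le_left _ _)
  have hzb := hz2.trans_le (min_le_right _ _)
  refine ⟨z, ⟨hz1, hzy.trans hy.2⟩, hzb, ?_, (key z hz1 hzy).trans hyc⟩
  have h1 := L.right_mem w ⟨hw1, (hw2.trans (hzy.trans hy.2)).le⟩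
  have h2 : f^[l] w < f^[l] z :=
    h.iterate_lt (h.pos.trans hw1).le hw2 ((hzy.trans hy.2).le.trans L.le_one)
      ((L.avoids_right hw1).mono le_rfl le_rfl (hzy.trans hy.2).le)
  exact h1.1.trans_lt h2

/-- The return map has no fixed point in the interior of the left branch. -/
lemma left_ne (h : Expander f c) (L : Level f c p q k l) : ∀ y ∈ Ioo p c, f^[k] y ≠ y := by
  intro x hx hfix
  obtain ⟨b, hb, hbc⟩ := L.left_cross
  have hpb := L.avoids_left hb.2
  have hc1 := h.lt_one
  have hxb : x < b := by
    by_contra hcon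
    have : f^[k] b ≤ f^[k] x := (h.iterate_strictMonoOn L.zero_le (hx.2.le.trans hc1.le)
      (L.avoids_left hx.2)).monotoneOn ⟨hb.1.le, not_lt.1 hcon⟩ ⟨hx.1.le, le_rfl⟩ (not_lt.1 hcon)
    linarith [hx.2]
  have hb1 : b ≤ 1 := hb.2.le.trans hc1.le
  have hfb : b ≤ f^[k] b := (hb.2.trans hbc).le
  -- A point of (p, x) on or above the diagonal, together with p, x and b, would complete the
  -- forbidden pattern.
  have hlow : ∀ y ∈ Ioo p x, f^[k] y < y := fun y hy => by
    by_contra hcon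
    exact h.not_sign_pattern L.kpos L.zero_le hb1 hpb hy.1 hy.2 hxb L.fix_left.le
      (not_lt.1 hcon) hfix.le hfb
  -- So p attracts from the right, and the pattern z < p < y < b makes it attract from the left as
  -- well, as far as the branch of f^k extends.
  have hhigh : ∀ z, 0 ≤ z → z < p → Avoids f c k z p → z < f^[k] z := fun z hz hzp hA => by
    by_contra hcon
    obtain ⟨y, hy⟩ := exists_between hx.1
    exact h.not_sign_pattern L.kpos hz hb1 (hA.union hpb) hzp hy.1 (hy.2.trans hxb)
      (not_lt.1 hcon) L.fix_left.ge (hlow y hy).le hfb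
  rcases eq_or_lt_of_le L.zero_le with h0 | h0
  · subst h0
    have h1 := (h.eventually_le_iterate k).and (Ioo_mem_nhdsGT hx.1)
    obtain ⟨y, hy1, hy2⟩ := h1.exists
    exact (hlow y hy2).not_ge hy1
  · have hp1 : p ≤ 1 := L.left_lt.le.trans hc1.le
    rcases h.avoids_or_exists_preimage ⟨L.zero_le, hp1⟩ k
      (fun j hj => hpb j hj p ⟨le_rfl, hb.1.le⟩) with hA | ⟨t, ht0, htp, i, hi, e, hA, hz⟩
    · have := hhigh 0 le_rfl h0 hA
      rw [Function.iterate_fixed h.map_zero] at this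
      exact lt_irrefl _ this
    · have hi0 : 0 < i := by
        rcases Nat.eq_zero_or_pos i with rfl | h
        · exact absurd e (htp.trans L.left_lt).ne
        · exact h
      have hcp : c < f^[i] p := e ▸ h.iterate_lt ht0 htp hp1 hA
      have hqp : q < f^[i] p := by
        by_contra hcon
        exact L.left_not_mem p ⟨le_rfl, L.left_lt⟩ i hi0 hi
          ⟨(L.left_lt.trans hcp).le, not_lt.1 hcon⟩
      -- The branch ends on the left at a preimage t of c under f^i, while f^i p lies beyond q. Thus
      -- some z in (t, p) passes through y in (c, q) and then through f^l y in (p, c), although (t,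
      -- p) is invariant under f^k.
      obtain ⟨y, hy, -, hy1, hy2⟩ := L.exists_iterate_lt h L.lt_right
      obtain ⟨z, hz1, hz2⟩ := h.exists_iterate_eq ht0 htp.le hp1 hA
        ⟨e ▸ hy.1.le, (hy.2.trans hqp).le⟩
      have hzt : t < z := lt_of_le_of_ne hz1.1 (by rintro rfl; exact hy.1.ne (e.symm.trans hz2))
      have hzp : z < p := lt_of_le_of_ne hz1.2 (by rintro rfl; exact (hy.2.trans hqp).ne hz2.symm)
      have trap : ∀ n, f^[k * n] z ∈ Ioo t p := by
        intro n
        induction n with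
        | zero => exact ⟨hzt, hzp⟩
        | succ n ih =>
          rw [Nat.mul_succ, add_comm, Function.iterate_add_apply]
          have hA' := hz _ ih.1
          refine ⟨ih.1.trans (hhigh _ (ht0.trans ih.1.le) ih.2 hA'), ?_⟩
          have := h.iterate_lt (ht0.trans ih.1.le) ih.2 hp1 hA'
          rwa [L.fix_left] at this
      -- Division of l + i by k replaces z by a point w of (t, p) that reaches (p, c) after r < k
      -- steps. For r = 0 this contradicts w < p; otherwise f^r p is caught in (p, c) before the
      -- return time k of p.
      have hr : (l + i) % k < k := Nat.mod_lt _ L.kpos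
      set r := (l + i) % k
      set w := f^[k * ((l + i) / k)] z with hw
      have hwm := trap ((l + i) / k)
      have e1 : f^[r] w = f^[l] y := by
        rw [hw, ← Function.iterate_add_apply, Nat.mod_add_div, Function.iterate_add_apply, hz2]
      have hA' := hz w hwm.1
      have hlt : f^[r] w < f^[r] p := h.iterate_lt (ht0.trans hwm.1.le) hwm.2 hp1
        (hA'.mono hr.le le_rfl le_rfl)
      have hnc := h.not_mem_of_avoids (ht0.trans hwm.1.le) hp1 hA' hr le_rfl hwm.2.le le_rfl
      have hrc : f^[r] p < c := by
        by_contra hcon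
        exact hnc ⟨by rw [e1]; exact hy2.le, not_lt.1 hcon⟩
      rcases Nat.eq_zero_or_pos r with h0 | h0
      · rw [h0] at hlt e1
        simp only [Function.iterate_zero, id] at hlt e1
        linarith
      · exact L.left_not_mem p ⟨le_rfl, L.left_lt⟩ r h0 hr
          ⟨by linarith, hrc.le.trans L.lt_right.le⟩

/-- Without interior fixed points the graph stays on one side of the diagonal, and at a crossing
point it is above. -/
lemma lt_iterate (h : Expander f c) (L : Level f c p q k l) {y : ℝ} (hy : y ∈ Ioo p c) :
    y < f^[k] y := by
  by_contra hcon
  obtain ⟨b, hb, hbc⟩ := L.left_cross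
  have hc1 := h.lt_one
  rcases le_total b y with hby | hby
  · have : f^[k] b ≤ f^[k] y := (h.iterate_strictMonoOn L.zero_le (hy.2.le.trans hc1.le)
      (L.avoids_left hy.2)).monotoneOn ⟨hb.1.le, hby⟩ ⟨hy.1.le, le_rfl⟩ hby
    linarith [hy.2]
  · have hcont := h.iterate_continuousOn L.zero_le (hb.2.le.trans hc1.le) (L.avoids_left hb.2)
    have h1 : ContinuousOn (fun x => f^[k] x - x) (Icc y b) :=
      (hcont.mono (Icc_subset_Icc_left hy.1.le)).sub continuousOn_id
    obtain ⟨z, hz, hz0⟩ := intermediate_value_Icc hby h1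
      (show (0 : ℝ) ∈ Icc _ _ from ⟨by linarith, by linarith [hb.2]⟩)
    exact L.left_ne h z ⟨hy.1.trans_le hz.1, hz.2.trans_lt hb.2⟩ (by simpa [sub_eq_zero] using hz0)

lemma iterate_lt (h : Expander f c) (L : Level f c p q k l) {y : ℝ} (hy : y ∈ Ioo c q) :
    f^[l] y < y := by
  have := L.reflect.lt_iterate h.reflect (y := 1 - y) ⟨by linarith [hy.2], by linarith [hy.1]⟩
  rw [reflect_iterate, sub_sub_cancel] at this
  linarith

variable {p' q' : ℝ} {k' l' : ℕ}

lemma left_le_left (L : Level f c p q k l) (L' : Level f c p' q' k' l')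
    (hsub : Icc p' q' ⊆ Icc p q) : k ≤ k' := by
  by_contra hcon
  have hp : p' ∈ Icc p q := hsub ⟨le_rfl, (L'.left_lt.trans L'.lt_right).le⟩
  refine L.left_not_mem p' ⟨hp.1, L'.left_lt⟩ k' L'.kpos (not_le.1 hcon) ?_
  rwa [L'.fix_left]

/-- Equal return times would make p' a fixed point inside the outer left branch. -/
lemma left_lt_left (h : Expander f c) (L : Level f c p q k l) (L' : Level f c p' q' k' l')
    (hsub : Icc p' q' ⊆ Icc p q) (hp : p < p') : k < k' := by
  refine lt_of_le_of_ne (L.left_le_left L' hsub) ?_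
  rintro rfl
  exact L.left_ne h p' ⟨hp, L'.left_lt⟩ L'.fix_left

lemma right_lt_right (h : Expander f c) (L : Level f c p q k l) (L' : Level f c p' q' k' l')
    (hsub : Icc p' q' ⊆ Icc p q) (hq : q' < q) : l < l' := by
  refine L.reflect.left_lt_left h.reflect L'.reflect ?_ (by linarith)
  intro x hx
  have := @hsub (1 - x) ⟨by linarith [hx.2], by linarith [hx.1]⟩
  exact ⟨by linarith [this.2], by linarith [this.1]⟩

/-- If the left ends agreed, then q' < q and hence l < l'. But points just to the right of c are
sent by f^l into (p, c), which would be part of the inner interval, too early. -/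
lemma left_end_lt (h : Expander f c) (L : Level f c p q k l) (L' : Level f c p' q' k' l')
    (hsub : Icc p' q' ⊂ Icc p q) : p < p' := by
  have hpq' := L'.left_lt.trans L'.lt_right
  have hp : p' ∈ Icc p q := hsub.1 ⟨le_rfl, hpq'.le⟩
  have hq : q' ∈ Icc p q := hsub.1 ⟨hpq'.le, le_rfl⟩
  by_contra hcon
  have hpp : p = p' := le_antisymm hp.1 (not_lt.1 hcon)
  subst hpp
  have hqq : q' < q := lt_of_le_of_ne hq.2 (by rintro rfl; exact hsub.2 subset_rfl)
  have hl := L.right_lt_right h L' hsub.1 hqq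
  obtain ⟨y, hy, hyq, hy1, hy2⟩ := L.exists_iterate_lt h L'.lt_right
  refine L'.right_not_mem y ⟨hy.1, hyq.le⟩ l L.lpos hl ⟨hy1.le, (hy2.trans L'.lt_right).le⟩

lemma right_end_lt (h : Expander f c) (L : Level f c p q k l) (L' : Level f c p' q' k' l')
    (hsub : Icc p' q' ⊂ Icc p q) : q' < q := by
  have : 1 - q < 1 - q' := by
    refine L.reflect.left_end_lt h.reflect L'.reflect ⟨?_, fun hs => hsub.2 ?_⟩
    · intro x hx
      have := @hsub.1 (1 - x) ⟨by linarith [hx.2], by linarith [hx.1]⟩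
      exact ⟨by linarith [this.2], by linarith [this.1]⟩
    · intro x hx
      have := @hs (1 - x) ⟨by linarith [hx.2], by linarith [hx.1]⟩
      exact ⟨by linarith [this.2], by linarith [this.1]⟩
  linarith

/-- An orbit that starts in the left half of the inner return interval passes through the right
half of the outer one before it returns. -/
lemma left_visits (h : Expander f c) (L : Level f c p q k l) (L' : Level f c p' q' k' l')
    (hsub : Icc p' q' ⊂ Icc p q) {x : ℝ} (hx : x ∈ Ico p' c) : k < k' ∧ f^[k] x ∈ Ioc c q := by
  have hp := L.left_end_lt h L' hsub
  have hk := L.left_lt_left h L' hsub.1 hp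
  have h1 := L.left_mem x ⟨hp.le.trans hx.1, hx.2⟩
  have h2 := L'.left_not_mem x hx k L.kpos hk
  -- The point moves to the right without landing in the inner interval, so it jumps over it and
  -- over c.
  have h3 := L.lt_iterate h (y := x) ⟨hp.trans_le hx.1, hx.2⟩
  refine ⟨hk, ?_, h1.2⟩
  by_contra hcon
  exact h2 ⟨hx.1.trans h3.le, (not_lt.1 hcon).trans L'.lt_right.le⟩

lemma right_visits (h : Expander f c) (L : Level f c p q k l) (L' : Level f c p' q' k' l')
    (hsub : Icc p' q' ⊂ Icc p q) {x : ℝ} (hx : x ∈ Ioc c q') : l < l' ∧ f^[l] x ∈ Ico p c := by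
  have hp := L.right_end_lt h L' hsub
  have hk := L.right_lt_right h L' hsub.1 hp
  have h1 := L.right_mem x ⟨hx.1, hx.2.trans hp.le⟩
  have h2 := L'.right_not_mem x hx l L.lpos hk
  have h3 := L.iterate_lt h (y := x) ⟨hx.1, hx.2.trans_lt hp⟩
  refine ⟨hk, h1.1, ?_⟩
  by_contra hcon
  exact h2 ⟨L'.left_lt.le.trans (not_lt.1 hcon), h3.le.trans hx.2⟩

end Level

/-! ### Intervals whose orbits never meet c -/

/-- No orbit of a point in `[a, b]` meets `c`. -/
def AvoidsAll (f : ℝ → ℝ) (c a b : ℝ) : Prop := ∀ m, Avoids f c m a b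

/-- There are return intervals in every neighbourhood of `c`. -/
def ArbitrarilySmallLevels (f : ℝ → ℝ) (c : ℝ) : Prop :=
  ∀ ε > 0, ∃ p q : ℝ, ∃ k l : ℕ, Level f c p q k l ∧ c - ε < p ∧ q < c + ε

lemma ArbitrarilySmallLevels.reflect {f : ℝ → ℝ} {c : ℝ} (h : ArbitrarilySmallLevels f c) :
    ArbitrarilySmallLevels (reflect f) (1 - c) := fun ε hε => by
  obtain ⟨p, q, k, l, L, h1, h2⟩ := h ε hε
  exact ⟨1 - q, 1 - p, l, k, L.reflect, by linarith, by linarith⟩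

/-- The right branch rises from below c to q. With arbitrarily small return intervals, preimages of
c accumulate at c from the right. -/
lemma Level.exists_iterate_eq_singular {f : ℝ → ℝ} {c p q : ℝ} {k l : ℕ} (h : Expander f c)
    (L : Level f c p q k l) : ∃ z ∈ Ioo c q, f^[l] z = c := by
  obtain ⟨y, hy, hyc⟩ := L.right_cross
  obtain ⟨z, hz, e⟩ := h.exists_iterate_eq (h.pos.trans hy.1).le hy.2.le L.le_one
    (L.avoids_right hy.1) ⟨hyc.le, by rw [L.fix_right]; exact L.lt_right.le⟩
  refine ⟨z, ⟨hy.1.trans_le hz.1, lt_of_le_of_ne hz.2 ?_⟩, e⟩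
  rintro rfl
  rw [L.fix_right] at e
  exact L.lt_right.ne' e

lemma AvoidsAll.reflect {f : ℝ → ℝ} {c a b : ℝ} (h : AvoidsAll f c a b) :
    AvoidsAll (reflect f) (1 - c) (1 - b) (1 - a) := fun m => (h m).reflect

lemma AvoidsAll.of_reflect {f : ℝ → ℝ} {c a b : ℝ}
    (h : AvoidsAll (Lorenz.reflect f) (1 - c) a b) : AvoidsAll f c (1 - b) (1 - a) :=
  fun m => (h m).of_reflect

lemma exists_Icc_of_eventually {P : ℝ → Prop} {x : ℝ} (h0 : 0 < x) (h1 : x ≤ 1)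
    (hP : ∀ᶠ z in 𝓝[Icc 0 1] x, P z) : ∃ a, 0 ≤ a ∧ a < x ∧ ∀ z ∈ Icc a x, P z := by
  have h2 : ∀ᶠ z in 𝓝[Icc 0 x] x, P z := hP.filter_mono (nhdsWithin_mono _ (Icc_subset_Icc_right h1))
  rw [nhdsWithin_Icc_eq_nhdsLE h0] at h2
  obtain ⟨l, hl, H⟩ := (mem_nhdsLE_iff_exists_Icc_subset).1 h2
  exact ⟨max l 0, le_max_right _ _, max_lt hl h0, fun z hz => H ⟨(le_max_left _ _).trans hz.1, hz.2⟩⟩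

namespace Expander

variable {f : ℝ → ℝ} {c : ℝ}

/-- The left end of the maximal interval around `[u, v]` on which all iterates are monotone, when
this interval is periodic. -/
lemma exists_left_end (h : Expander f c) (hs : ArbitrarilySmallLevels f c) {u v w : ℝ} {m : ℕ}
    (hu : 0 ≤ u) (huv : u ≤ v) (hv : v ≤ 1) (hA : AvoidsAll f c u v) (hm : 0 < m)
    (hw : w ∈ Icc u v) (hfw : f^[m] w ∈ Icc u v) :
    ∃ A, 0 ≤ A ∧ A ≤ u ∧ AvoidsAll f c A v ∧ f^[m] A = A ∧
      (A = 0 ∨ ∃ z, 0 ≤ z ∧ z < A ∧ Avoids f c m z A ∧ f^[m] z < z) := by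
  set S := {x | x ∈ Icc 0 u ∧ AvoidsAll f c x v} with hS
  have hSb : BddBelow S := ⟨0, fun x hx => hx.1.1⟩
  have huS : u ∈ S := ⟨⟨hu, le_rfl⟩, hA⟩
  set A := sInf S with hAdef
  have hA0 : 0 ≤ A := le_csInf ⟨u, huS⟩ fun x hx => hx.1.1
  have hAu : A ≤ u := csInf_le hSb huS
  have hgt : ∀ x, A < x → AvoidsAll f c x v := fun x hx => by
    obtain ⟨y, hy, hyx⟩ := exists_lt_of_csInf_lt ⟨u, huS⟩ hx
    exact fun j => (hy.2 j).mono le_rfl hyx.le le_rfl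
  -- If A met c, first at time j, then points to the right of A would cover a right neighbourhood of
  -- c under f^j, and this contains further preimages of c.
  have hAS : AvoidsAll f c A v := by
    rcases eq_or_lt_of_le hAu with e | hlt
    · rw [e]; exact hA
    by_contra hcon
    have hex : ∃ j, f^[j] A = c := by
      simp only [AvoidsAll, Avoids] at hcon
      push Not at hcon
      obtain ⟨m, j, hj, z, hz, e⟩ := hcon
      rcases eq_or_lt_of_le hz.1 with rfl | hAz
      · exact ⟨j, e⟩
      · exact absurd e (hgt z hAz m j hj z ⟨le_rfl, hz.2⟩)
    classical
    set j := Nat.find hex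
    have hj : f^[j] A = c := Nat.find_spec hex
    have hav : Avoids f c j A v := fun i hi z hz => by
      rcases eq_or_lt_of_le hz.1 with rfl | hAz
      · exact Nat.find_min hex hi
      · exact hgt z hAz j i hi z ⟨le_rfl, hz.2⟩
    have hcu : c < f^[j] u := hj ▸ h.iterate_lt hA0 hlt (huv.trans hv) (hav.mono le_rfl le_rfl huv)
    obtain ⟨p, q, k, l, L, -, hq⟩ := hs (f^[j] u - c) (by linarith)
    obtain ⟨ζ, hζ, e⟩ := L.exists_iterate_eq_singular h
    obtain ⟨ξ, hξ, e'⟩ := h.exists_iterate_eq hA0 hAu (huv.trans hv) (hav.mono le_rfl le_rfl huv)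
      (y := ζ) ⟨by rw [hj]; exact hζ.1.le, by linarith [hζ.2]⟩
    have hAξ : A < ξ := lt_of_le_of_ne hξ.1 (by rintro rfl; exact hζ.1.ne (hj.symm.trans e'))
    refine hgt ξ hAξ (l + j + 1) (l + j) (Nat.lt_succ_self _) ξ ⟨le_rfl, hξ.2.trans huv⟩ ?_
    rw [Function.iterate_add_apply, e', e]
  have hnot : ∀ a, 0 ≤ a → a < A → ¬ AvoidsAll f c a v := fun a ha haA hcon =>
    absurd (csInf_le hSb (show a ∈ S from ⟨⟨ha, haA.le.trans hAu⟩, hcon⟩)) (not_le.2 haA)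
  have hmono := h.iterate_strictMonoOn hA0 hv (hAS m)
  have hAI : A ∈ Icc (0 : ℝ) 1 := ⟨hA0, hAu.trans (huv.trans hv)⟩
  have hAw : f^[m] A ≤ f^[m] w :=
    hmono.monotoneOn ⟨le_rfl, hAu.trans huv⟩ ⟨hAu.trans hw.1, hw.2⟩ (hAu.trans hw.1)
  have hAc : ∀ j, f^[j] A ≠ c := fun j => hAS (j + 1) j (Nat.lt_succ_self j) A ⟨le_rfl, hAu.trans huv⟩
  -- If f^m A < A, the image of [A, w] under f^m would cover [f^m A, u], and the avoiding interval
  -- could be enlarged.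
  have hge : A ≤ f^[m] A := by
    by_contra hcon
    refine hnot _ (h.iterate_mem hAI fun j _ => hAc j).1 (not_le.1 hcon) fun n j hj y hy => ?_
    rcases le_total u y with huy | hyu
    · exact hA n j hj y ⟨huy, hy.2⟩
    · obtain ⟨x, hx, e⟩ := h.exists_iterate_eq hA0 (hAu.trans hw.1) (hw.2.trans hv)
        ((hAS m).mono le_rfl le_rfl hw.2) ⟨hy.1, hyu.trans hfw.1⟩
      rw [← e, ← Function.iterate_add_apply]
      exact hAS (j + m + 1) (j + m) (Nat.lt_succ_self _) x ⟨hx.1, hx.2.trans hw.2⟩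
  -- Induction in steps of m: an orbit that keeps coming back to [a, v] never meets c, which
  -- contradicts the minimality of A.
  have hext : ∀ a, 0 ≤ a → a < A → (∀ j < m, ∀ z ∈ Icc a A, f^[j] z ≠ c) →
      (∀ z ∈ Icc a A, f^[m] z ∈ Icc a v) → False := by
    intro a ha haA h1 h2
    have key : ∀ j, ∀ z ∈ Icc a v, f^[j] z ≠ c := by
      intro j
      induction j using Nat.strong_induction_on with
      | _ j ih =>
        intro z hz
        rcases le_total A z with hAz | hzA
        · exact hAS (j + 1) j (Nat.lt_succ_self j) z ⟨hAz, hz.2⟩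
        · rcases lt_or_ge j m with hj | hj
          · exact h1 j hj z ⟨hz.1, hzA⟩
          · have := ih (j - m) (by omega) _ (h2 z ⟨hz.1, hzA⟩)
            rwa [← Function.iterate_add_apply, Nat.sub_add_cancel hj] at this
    exact hnot a ha haA fun n j _ z hz => key j z hz
  have hfix : f^[m] A = A := by
    refine le_antisymm ?_ hge
    by_contra hcon
    have hA0' : 0 < A := lt_of_le_of_ne hA0 fun e => by
      rw [← e, Function.iterate_fixed h.map_zero] at hcon; exact hcon le_rfl
    have hev := ((h.iterate_continuousWithinAt hAI (m := m) fun j _ => hAc j).eventually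
      (lt_mem_nhds (not_le.1 hcon))).and (h.eventually_avoids hAI (m := m) fun j _ => hAc j)
    obtain ⟨a, ha, haA, H⟩ := exists_Icc_of_eventually hA0' hAI.2 hev
    refine hext a ha haA (fun j hj z hz => (H z hz).2 j hj) fun z hz => ?_
    refine ⟨(haA.trans (H z hz).1).le, le_trans ?_ (hAw.trans hfw.2)⟩
    exact (h.iterate_strictMonoOn ha hAI.2 fun j hj z hz => (H z hz).2 j hj).monotoneOn hz
      ⟨haA.le, le_rfl⟩ hz.2
  refine ⟨A, hA0, hAu, hAS, hfix, ?_⟩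
  rcases eq_or_lt_of_le hA0 with e | hA0'
  · exact Or.inl e.symm
  right
  obtain ⟨a, ha, haA, H⟩ := exists_Icc_of_eventually hA0' hAI.2
    (h.eventually_avoids hAI (m := m) fun j _ => hAc j)
  by_contra hcon
  push Not at hcon
  have hav : Avoids f c m a A := fun j hj z hz => H z hz j hj
  refine hext a ha haA hav fun z hz => ?_
  have h1 : f^[m] z ≤ A := by
    have := (h.iterate_strictMonoOn ha hAI.2 hav).monotoneOn hz ⟨haA.le, le_rfl⟩ hz.2
    rwa [hfix] at this
  refine ⟨?_, h1.trans (hAu.trans huv)⟩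
  rcases eq_or_lt_of_le hz.2 with rfl | hzA
  · rw [hfix]; exact haA.le
  · exact hz.1.trans (hcon z (ha.trans hz.1) hzA (hav.mono le_rfl hz.1 le_rfl))

/-- There are no periodic intervals of monotonicity. -/
lemma false_of_periodic (h : Expander f c) (hs : ArbitrarilySmallLevels f c) {u v w : ℝ} {m : ℕ}
    (hu : 0 ≤ u) (huv : u < v) (hv : v ≤ 1) (hA : AvoidsAll f c u v) (hm : 0 < m)
    (hw : w ∈ Icc u v) (hfw : f^[m] w ∈ Icc u v) : False := by
  obtain ⟨A, hA0, hAu, hAv, hAf, hAz⟩ := h.exists_left_end hs hu huv.le hv hA hm hw hfw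
  obtain ⟨B', hB0, hBv, hBu, hBf, hBz⟩ := h.reflect.exists_left_end hs.reflect (u := 1 - v)
    (v := 1 - u) (w := 1 - w) (m := m) (by linarith) (by linarith) (by linarith) hA.reflect hm
    ⟨by linarith [hw.2], by linarith [hw.1]⟩
    (by rw [reflect_iterate, sub_sub_cancel]; exact ⟨by linarith [hfw.2], by linarith [hfw.1]⟩)
  obtain ⟨B, rfl⟩ : ∃ B, B' = 1 - B := ⟨1 - B', by ring⟩
  replace hBu := hBu.of_reflect
  rw [sub_sub_cancel, sub_sub_cancel] at hBu
  rw [reflect_iterate, sub_sub_cancel] at hBf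
  have hBf : f^[m] B = B := by linarith
  have hvB : v ≤ B := by linarith
  have hB1 : B ≤ 1 := by linarith
  have hAB : AvoidsAll f c A B := fun j =>
    (hAv j).union ((hBu j).mono le_rfl huv.le le_rfl)
  have hlt : A < B := by linarith
  have hBz' : B = 1 ∨ ∃ b, B < b ∧ b ≤ 1 ∧ Avoids f c m B b ∧ b < f^[m] b := by
    rcases hBz with e | ⟨z, hz0, hzB, hz, hfz⟩
    · left; linarith
    · right
      refine ⟨1 - z, by linarith, by linarith, ?_, ?_⟩
      · have := hz.of_reflect
        rwa [sub_sub_cancel] at this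
      · rw [reflect_iterate] at hfz; linarith
  -- In the general case z < A < B < b is the forbidden pattern. An end at 0 or 1 has no outer
  -- point, and repulsion there supplies the missing point on the inside; if both ends occur, [A, B]
  -- contains c.
  rcases hAz with rfl | ⟨z, hz0, hzA, hz, hfz⟩ <;> rcases hBz' with rfl | ⟨b, hBb, hb1, hb, hfb⟩
  · exact hAB 1 0 one_pos c ⟨h.pos.le, h.lt_one.le⟩ rfl
  · obtain ⟨x, hx1, hx2⟩ := ((h.eventually_le_iterate m).and (Ioo_mem_nhdsGT hlt)).exists
    exact h.not_sign_pattern hm le_rfl hb1 ((hAB m).union hb) hx2.1 hx2.2 hBb hAf.le hx1 hBf.le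
      hfb.le
  · obtain ⟨x, hx1, hx2⟩ := ((h.reflect.eventually_le_iterate m).and
      (Ioo_mem_nhdsGT (show (0 : ℝ) < 1 - A by linarith))).exists
    rw [reflect_iterate] at hx1
    exact h.not_sign_pattern hm hz0 le_rfl (hz.union (hAB m)) hzA (y := 1 - x) (by linarith [hx2.2])
      (by linarith [hx2.1]) hfz.le hAf.ge (by linarith) hBf.ge
  · exact h.not_sign_pattern hm hz0 hb1 ((hz.union (hAB m)).union hb) hzA hlt hBb hfz.le
      hAf.ge hBf.le hfb.le

/-- Two overlapping images would make the earlier one a periodic interval of monotonicity. -/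
lemma disjoint_iterates (h : Expander f c) (hs : ArbitrarilySmallLevels f c) {u v : ℝ}
    (hu : 0 ≤ u) (huv : u < v) (hv : v ≤ 1) (hA : AvoidsAll f c u v) {i j : ℕ} (hij : i < j) :
    Disjoint (Icc (f^[i] u) (f^[i] v)) (Icc (f^[j] u) (f^[j] v)) := by
  rw [Set.disjoint_left]
  intro y hyi hyj
  obtain ⟨w, hw, rfl⟩ := h.exists_iterate_eq hu huv.le hv (hA j) hyj
  have hmono := h.iterate_strictMonoOn hu hv (hA i)
  have hI : ∀ x ∈ Icc u v, f^[i] x ∈ Icc (0 : ℝ) 1 := fun x hx =>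
    h.iterate_mem ⟨hu.trans hx.1, hx.2.trans hv⟩ fun n hn => hA i n hn x hx
  refine h.false_of_periodic hs (u := f^[i] u) (v := f^[i] v) (w := f^[i] w) (m := j - i)
    (hI u ⟨le_rfl, huv.le⟩).1 (hmono ⟨le_rfl, huv.le⟩ ⟨huv.le, le_rfl⟩ huv)
    (hI v ⟨huv.le, le_rfl⟩).2 ?_ (by omega)
    ⟨hmono.monotoneOn ⟨le_rfl, huv.le⟩ hw hw.1, hmono.monotoneOn hw ⟨huv.le, le_rfl⟩ hw.2⟩
    (by rwa [← Function.iterate_add_apply, Nat.sub_add_cancel hij.le])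
  intro n k hk z hz
  obtain ⟨x, hx, rfl⟩ := h.exists_iterate_eq hu huv.le hv (hA i) hz
  rw [← Function.iterate_add_apply]
  exact hA (k + i + 1) (k + i) (Nat.lt_succ_self _) x hx

end Expander

lemma sum_measureReal_le_of_pairwiseDisjoint {ι : Type*} (s : Finset ι) (I : ι → Set ℝ) {p q : ℝ}
    (hpq : p ≤ q) (hm : ∀ i ∈ s, MeasurableSet (I i)) (hd : (s : Set ι).PairwiseDisjoint I)
    (hsub : ∀ i ∈ s, I i ⊆ Icc p q) : ∑ i ∈ s, volume.real (I i) ≤ q - p := by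
  have hfin : ∀ i ∈ s, volume (I i) ≠ ⊤ := fun i hi =>
    ((measure_mono (hsub i hi)).trans_lt (by simp)).ne
  rw [← measureReal_biUnion_finset hd hm hfin]
  calc volume.real (⋃ i ∈ s, I i) ≤ volume.real (Icc p q) :=
        measureReal_mono (iUnion₂_subset hsub) (by simp)
    _ = q - p := by rw [Real.volume_real_Icc_of_le hpq]

/-- The images of an interval whose orbits avoid `c` get small. -/
lemma Expander.eventually_length_lt {f : ℝ → ℝ} {c : ℝ} (h : Expander f c)
    (hs : ArbitrarilySmallLevels f c) {u v : ℝ} (hu : 0 ≤ u) (huv : u < v) (hv : v ≤ 1)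
    (hA : AvoidsAll f c u v) {δ : ℝ} (hδ : 0 < δ) : ∀ᶠ n in atTop, f^[n] v - f^[n] u < δ := by
  by_contra hcon
  rw [Filter.not_eventually] at hcon
  have hinf := Nat.frequently_atTop_iff_infinite.1 hcon
  -- More than 1 / δ disjoint intervals of length at least δ do not fit into [0, 1].
  obtain ⟨N, hN⟩ := exists_nat_gt (1 / δ)
  obtain ⟨s, hsub, hcard⟩ := hinf.exists_subset_card_eq N
  have h1 := sum_measureReal_le_of_pairwiseDisjoint s (fun n => Icc (f^[n] u) (f^[n] v))
    zero_le_one (fun _ _ => measurableSet_Icc) ?_ ?_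
  · have h2 : ∀ n ∈ s, δ ≤ volume.real (Icc (f^[n] u) (f^[n] v)) := fun n hn => by
      rw [Real.volume_real_Icc_of_le (h.iterate_lt hu huv hv (hA n)).le]
      exact not_lt.1 (hsub hn)
    have h3 := Finset.card_nsmul_le_sum s _ δ h2
    rw [hcard, nsmul_eq_mul] at h3
    rw [div_lt_iff₀ hδ] at hN
    linarith
  · intro i _ j _ hij
    rcases lt_or_gt_of_ne hij with hlt | hlt
    · exact h.disjoint_iterates hs hu huv hv hA hlt
    · exact (h.disjoint_iterates hs hu huv hv hA hlt).symm
  · intro n _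
    exact Icc_subset_Icc
      (h.iterate_mem ⟨hu, huv.le.trans hv⟩ fun j hj => hA n j hj u ⟨le_rfl, huv.le⟩).1
      (h.iterate_mem ⟨hu.trans huv.le, hv⟩ fun j hj => hA n j hj v ⟨huv.le, le_rfl⟩).2

/-! ### Branches of definite size; almost every orbit enters every return interval -/

lemma exists_pos_forall_le_of_finite (n : ℕ) (g : ℕ → ℝ) (hg : ∀ m ≤ n, 0 < g m) :
    ∃ δ > 0, ∀ m ≤ n, δ ≤ g m := by
  obtain ⟨m, hm, H⟩ := Finset.exists_min_image (Finset.range (n + 1)) g ⟨0, by simp⟩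
  rw [Finset.mem_range] at hm
  exact ⟨g m, hg m (by omega), fun i hi => H i (by rw [Finset.mem_range]; omega)⟩

namespace Expander

variable {f : ℝ → ℝ} {c p q : ℝ} {k l : ℕ}

/-- An orbit that avoids a return interval has branches of definite size to its left. -/
lemma exists_left_extension (h : Expander f c) (L : Level f c p q k l) {ε : ℝ} (hε : 0 < ε) :
    ∃ δ > 0, ∀ x ∈ Icc (0 : ℝ) 1, (∀ j, f^[j] x ∉ Ioo p q) → ∀ n, ε ≤ f^[n] x →
      ∃ z, 0 ≤ z ∧ z < x ∧ Avoids f c n z x ∧ δ ≤ f^[n] x - f^[n] z := by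
  have hmid : c < (c + q) / 2 := by linarith [L.lt_right]
  have hmid' : (c + q) / 2 < q := by linarith [L.lt_right]
  have hmid0 : 0 ≤ (c + q) / 2 := by linarith [h.pos]
  -- A branch that ends at a preimage t of c covers (c, q] at that time, because the orbit of x
  -- avoids (p, q). The images of [(c + q)/2, q] under at most l further iterates bound its final
  -- size from below.
  obtain ⟨δ, hδ, H⟩ := exists_pos_forall_le_of_finite l
    (fun m => f^[m] q - f^[m] ((c + q) / 2)) (fun m hm => sub_pos.2 (h.iterate_lt hmid0 hmid'
      L.le_one ((L.avoids_right hmid).mono hm le_rfl le_rfl)))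
  refine ⟨min ε δ, lt_min hε hδ, fun x hx hxE n hn => ?_⟩
  have hxc : ∀ j, f^[j] x ≠ c := fun j e => hxE j (e ▸ ⟨L.left_lt, L.lt_right⟩)
  rcases h.avoids_or_exists_preimage hx n (fun j _ => hxc j) with hA |
    ⟨t, ht0, htx, i, hi, e, hA, hz⟩
  · have h0 : f^[n] 0 = 0 := Function.iterate_fixed h.map_zero n
    refine ⟨0, le_rfl, lt_of_le_of_ne hx.1 ?_, hA, ?_⟩
    · rintro rfl; linarith
    · rw [h0, sub_zero]; exact (min_le_left _ _).trans hn
  · have hmono := h.iterate_strictMonoOn ht0 hx.2 hA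
    have hcx : c < f^[i] x := e ▸ hmono ⟨le_rfl, htx.le⟩ ⟨htx.le, le_rfl⟩ htx
    have hqx : q ≤ f^[i] x := by
      by_contra hcon
      exact hxE i ⟨L.left_lt.trans hcx, not_le.1 hcon⟩
    have hpre : ∀ y, c < y → y ≤ f^[i] x → ∃ z, t < z ∧ z ≤ x ∧ f^[i] z = y := fun y h1 h2 => by
      obtain ⟨z, hz, e'⟩ := h.exists_iterate_eq ht0 htx.le hx.2 hA ⟨e ▸ h1.le, h2⟩
      exact ⟨z, lt_of_le_of_ne hz.1 (by rintro rfl; exact h1.ne (e.symm.trans e')), hz.2, e'⟩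
    obtain ⟨z, hz1, hz2, hz3⟩ := hpre _ hmid (by linarith)
    obtain ⟨y, hy1, hy2, hy3⟩ := hpre _ L.lt_right hqx
    -- With more than l iterates left, the branch would contain a preimage of the point of (c, q)
    -- that f^l maps to c.
    have hm : n - i ≤ l := by
      by_contra hcon
      obtain ⟨z0, hz0, e0⟩ := L.exists_iterate_eq_singular h
      obtain ⟨ξ, h1, h2, h3⟩ := hpre z0 hz0.1 (hz0.2.le.trans hqx)
      refine hz ξ h1 (l + i) (by omega) ξ ⟨le_rfl, h2⟩ ?_
      rw [Function.iterate_add_apply, h3, e0]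
    have hsplit : ∀ w, f^[n] w = f^[n - i] (f^[i] w) := fun w => by
      rw [← Function.iterate_add_apply, Nat.sub_add_cancel hi.le]
    have hzy : z < y := by
      by_contra hcon
      have := hmono.monotoneOn ⟨hy1.le, hy2⟩ ⟨hz1.le, hz2⟩ (not_lt.1 hcon)
      rw [hy3, hz3] at this
      linarith
    refine ⟨z, ht0.trans hz1.le, hzy.trans_le hy2, hz z hz1, ?_⟩
    have h1 : f^[n] y ≤ f^[n] x := (h.iterate_strictMonoOn (ht0.trans hz1.le) hx.2
      (hz z hz1)).monotoneOn ⟨hzy.le, hy2⟩ ⟨hz2, le_rfl⟩ hy2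
    have h2 := H (n - i) hm
    rw [hsplit y, hy3] at h1
    rw [hsplit z, hz3]
    have := min_le_right ε δ
    linarith

lemma exists_right_extension (h : Expander f c) (L : Level f c p q k l) {ε : ℝ} (hε : 0 < ε) :
    ∃ δ > 0, ∀ x ∈ Icc (0 : ℝ) 1, (∀ j, f^[j] x ∉ Ioo p q) → ∀ n, f^[n] x ≤ 1 - ε →
      ∃ z, x < z ∧ z ≤ 1 ∧ Avoids f c n x z ∧ δ ≤ f^[n] z - f^[n] x := by
  obtain ⟨δ, hδ, H⟩ := h.reflect.exists_left_extension L.reflect hε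
  refine ⟨δ, hδ, fun x hx hxE n hn => ?_⟩
  obtain ⟨z, hz0, hzx, hA, hd⟩ := H (1 - x) ⟨by linarith [hx.2], by linarith [hx.1]⟩
    (fun j hj => hxE j (by
      rw [reflect_iterate, sub_sub_cancel] at hj
      exact ⟨by linarith [hj.2], by linarith [hj.1]⟩)) n
    (by rw [reflect_iterate, sub_sub_cancel]; linarith)
  refine ⟨1 - z, by linarith, by linarith, ?_, ?_⟩
  · have := hA.of_reflect
    rwa [sub_sub_cancel] at this
  · rw [reflect_iterate, reflect_iterate, sub_sub_cancel] at hd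
    linarith

lemma map_mem_Ioo (h : Expander f c) {x : ℝ} (hx : x ∈ Ioo (0 : ℝ) 1) (hc : x ≠ c) :
    f x ∈ Ioo (0 : ℝ) 1 := by
  rcases lt_or_gt_of_ne hc with hlt | hgt
  · refine ⟨?_, ?_⟩
    · have := h.mono 0 x le_rfl hx.2.le (fun hm => hlt.not_ge hm.2) hx.1
      rwa [h.map_zero] at this
    · obtain ⟨y, hy⟩ := exists_between hlt
      refine (h.mono x y hx.1.le (hy.2.trans h.lt_one).le (fun hm => hy.2.not_ge hm.2) hy.1).trans_le
        (h.mapsTo y ⟨(hx.1.trans hy.1).le, (hy.2.trans h.lt_one).le⟩ hy.2.ne).2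
  · refine ⟨?_, ?_⟩
    · obtain ⟨y, hy⟩ := exists_between hgt
      refine (h.mapsTo y ⟨(h.pos.trans hy.1).le, (hy.2.trans hx.2).le⟩ hy.1.ne').1.trans_lt
        (h.mono y x (h.pos.trans hy.1).le hx.2.le (fun hm => hy.1.not_ge hm.1) hy.2)
    · have := h.mono x 1 hx.1.le le_rfl (fun hm => hgt.not_ge hm.1) hx.2
      rwa [h.map_one] at this

lemma iterate_mem_Ioo (h : Expander f c) {x : ℝ} (hx : x ∈ Ioo (0 : ℝ) 1)
    (hc : ∀ j, f^[j] x ≠ c) (n : ℕ) : f^[n] x ∈ Ioo (0 : ℝ) 1 := by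
  induction n with
  | zero => exact hx
  | succ n ih => rw [Function.iterate_succ_apply']; exact h.map_mem_Ioo ih (hc n)

/-- Orbits leave neighbourhoods of the repelling fixed point `0`. -/
lemma exists_escape_zero (h : Expander f c) : ∃ ε > 0, ∀ δ ≤ ε, ∀ x ∈ Ioo (0 : ℝ) 1,
    (∀ j, f^[j] x ≠ c) → (∀ n, f^[n] x < δ ∨ 1 - δ < f^[n] x) → 1 - δ < x := by
  obtain ⟨ε₁, hε₁, r, hr, H⟩ := h.repelling_zero
  have hcont := h.cont 0 (by simp) h.pos.ne
  rw [ContinuousWithinAt, h.map_zero, nhdsWithin_Icc_eq_nhdsGE one_pos] at hcont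
  -- Near 0 the values stay below 1/2, so an orbit confined to the two end neighbourhoods cannot
  -- jump from the one at 0 to the one at 1. It would have to grow geometrically while staying near
  -- 0.
  obtain ⟨ε₂, hε₂, H₂⟩ := mem_nhdsGE_iff_exists_Ico_subset.1
    (hcont.eventually (gt_mem_nhds (show (0 : ℝ) < 1 / 2 by norm_num)))
  refine ⟨min (min ε₁ ε₂) (1 / 2), lt_min (lt_min hε₁ hε₂) (by norm_num),
    fun δ hδ x hx hc hn => ?_⟩
  have hδ1 : δ ≤ ε₁ := hδ.trans ((min_le_left _ _).trans (min_le_left _ _))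
  have hδ2 : δ ≤ ε₂ := hδ.trans ((min_le_left _ _).trans (min_le_right _ _))
  have hδ3 : δ ≤ 1 / 2 := hδ.trans (min_le_right _ _)
  by_contra hcon
  have hx0 : x < δ := (hn 0).resolve_right hcon
  have key : ∀ n, f^[n] x < δ ∧ r ^ n * x ≤ f^[n] x := by
    intro n
    induction n with
    | zero => simpa using hx0
    | succ n ih =>
      have hp := (h.iterate_mem_Ioo hx hc n).1
      have h1 := H _ ⟨hp, ih.1.trans_le hδ1⟩
      have h2 : f (f^[n] x) < 1 / 2 := H₂ ⟨hp.le, ih.1.trans_le hδ2⟩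
      have h3 := hn (n + 1)
      rw [Function.iterate_succ_apply'] at h3 ⊢
      refine ⟨h3.resolve_right (by linarith), ?_⟩
      calc r ^ (n + 1) * x = r * (r ^ n * x) := by ring
        _ ≤ r * f^[n] x := by gcongr; exact ih.2
        _ ≤ _ := h1
  have ht := (tendsto_pow_atTop_atTop_of_one_lt hr).atTop_mul_const hx.1
  obtain ⟨n, hn'⟩ := (ht.eventually (eventually_ge_atTop δ)).exists
  linarith [(key n).1, (key n).2]

/-- An orbit that stayed near the two ends from some time on would be near 1 by `exists_escape_zero`
and near 0 by the reflected statement. -/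
lemma exists_frequently_mem (h : Expander f c) : ∃ ε > 0, ∀ x ∈ Ioo (0 : ℝ) 1,
    (∀ j, f^[j] x ≠ c) → ∃ᶠ n in atTop, ε ≤ f^[n] x ∧ f^[n] x ≤ 1 - ε := by
  obtain ⟨ε₁, hε₁, H₁⟩ := h.exists_escape_zero
  obtain ⟨ε₂, hε₂, H₂⟩ := h.reflect.exists_escape_zero
  refine ⟨min (min ε₁ ε₂) (1 / 2), lt_min (lt_min hε₁ hε₂) (by norm_num), fun x hx hc => ?_⟩
  set ε := min (min ε₁ ε₂) (1 / 2)
  have hε1 : ε ≤ ε₁ := (min_le_left _ _).trans (min_le_left _ _)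
  have hε2 : ε ≤ ε₂ := (min_le_left _ _).trans (min_le_right _ _)
  have hε3 : ε ≤ 1 / 2 := min_le_right _ _
  rw [frequently_atTop]
  intro N
  by_contra hcon
  push Not at hcon
  set y := f^[N] x
  have hy := h.iterate_mem_Ioo hx hc N
  have hyn : ∀ n, f^[n] y = f^[n + N] x := fun n => by rw [Function.iterate_add_apply]
  have hyc : ∀ n, f^[n] y ≠ c := fun n => by rw [hyn]; exact hc _
  have hor : ∀ n, f^[n] y < ε ∨ 1 - ε < f^[n] y := fun n => by
    rw [hyn]
    rcases lt_or_ge (f^[n + N] x) ε with h1 | h1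
    · exact Or.inl h1
    · exact Or.inr (hcon (n + N) (by omega) h1)
  have h1 := H₁ ε hε1 y hy hyc hor
  have h2 := H₂ ε hε2 (1 - y) ⟨by linarith [hy.2], by linarith [hy.1]⟩
    (fun j => by rw [reflect_iterate, sub_sub_cancel]; intro e; exact hyc j (by linarith))
    (fun n => by
      rw [reflect_iterate, sub_sub_cancel]
      rcases hor n with h | h
      · right; linarith
      · left; linarith)
  linarith

end Expander

/-- `[l', r']` and `[l, r]` are mapped by a monotone branch of `f^k` onto the intervals of radius
`d` and `2 * d` around `f^k(x)`. -/
structure IsBranch (f : ℝ → ℝ) (c d : ℝ) (k : ℕ) (x l l' r' r : ℝ) : Prop where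
  zero_le : 0 ≤ l
  le_one : r ≤ 1
  lt₁ : l < l'
  lt₂ : l' < x
  lt₃ : x < r'
  lt₄ : r' < r
  avoids : Avoids f c k l r
  eq₁ : f^[k] l = f^[k] x - 2 * d
  eq₂ : f^[k] l' = f^[k] x - d
  eq₃ : f^[k] r' = f^[k] x + d
  eq₄ : f^[k] r = f^[k] x + 2 * d

namespace Expander

variable {f : ℝ → ℝ} {c p q : ℝ} {k l : ℕ}

/-- Supplies, at infinitely many times, a branch whose image has room 2 * d on both sides of the
orbit point. The outer halves serve as collars in the cross ratio estimates. -/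
lemma exists_isBranch (h : Expander f c) (L : Level f c p q k l) : ∃ ε > 0, ∃ d > 0, 2 * d ≤ ε ∧
    ∀ x ∈ Ioo (0 : ℝ) 1, (∀ j, f^[j] x ∉ Ioo p q) →
      ∃ᶠ n in atTop, (ε ≤ f^[n] x ∧ f^[n] x ≤ 1 - ε) ∧
        ∃ a a' b' b, IsBranch f c d n x a a' b' b := by
  obtain ⟨ε, hε, H⟩ := h.exists_frequently_mem
  obtain ⟨δ₁, hδ₁, H₁⟩ := h.exists_left_extension L hε
  obtain ⟨δ₂, hδ₂, H₂⟩ := h.exists_right_extension L hε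
  have hd : 0 < min ε (min δ₁ δ₂) / 2 := half_pos (lt_min hε (lt_min hδ₁ hδ₂))
  set d := min ε (min δ₁ δ₂) / 2 with hdd
  have e0 : 2 * d ≤ ε := by rw [hdd]; linarith [min_le_left ε (min δ₁ δ₂)]
  have e1 : 2 * d ≤ δ₁ := by
    rw [hdd]; linarith [min_le_right ε (min δ₁ δ₂), min_le_left δ₁ δ₂]
  have e2 : 2 * d ≤ δ₂ := by
    rw [hdd]; linarith [min_le_right ε (min δ₁ δ₂), min_le_right δ₁ δ₂]
  refine ⟨ε, hε, d, hd, e0, fun x hx hxE => ?_⟩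
  have hxc : ∀ j, f^[j] x ≠ c := fun j e => hxE j (e ▸ ⟨L.left_lt, L.lt_right⟩)
  have hxI := Ioo_subset_Icc_self hx
  refine (H x hx hxc).mono fun n hn => ⟨hn, ?_⟩
  obtain ⟨z, hz0, hzx, hzA, hzd⟩ := H₁ x hxI hxE n hn.1
  obtain ⟨w, hxw, hw1, hwA, hwd⟩ := H₂ x hxI hxE n hn.2
  have hA := hzA.union hwA
  have hmono := h.iterate_strictMonoOn hz0 hw1 hA
  have hpre : ∀ s, -(2 * d) ≤ s → s ≤ 2 * d → ∃ y ∈ Icc z w, f^[n] y = f^[n] x + s :=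
    fun s h1 h2 => h.exists_iterate_eq hz0 (hzx.trans hxw).le hw1 hA
      ⟨by linarith, by linarith⟩
  have hlt : ∀ u ∈ Icc z w, ∀ v ∈ Icc z w, f^[n] u < f^[n] v → u < v := fun u hu v hv huv =>
    (hmono.lt_iff_lt hu hv).1 huv
  obtain ⟨a, ha, ea⟩ := hpre (-(2 * d)) le_rfl (by linarith)
  obtain ⟨a', ha', ea'⟩ := hpre (-d) (by linarith) (by linarith)
  obtain ⟨b', hb', eb'⟩ := hpre d (by linarith) (by linarith)
  obtain ⟨b, hb, eb⟩ := hpre (2 * d) (by linarith) le_rfl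
  have hx' : x ∈ Icc z w := ⟨hzx.le, hxw.le⟩
  exact ⟨a, a', b', b, hz0.trans ha.1, hb.2.trans hw1, hlt _ ha _ ha' (by linarith),
    hlt _ ha' _ hx' (by linarith), hlt _ hx' _ hb' (by linarith), hlt _ hb' _ hb (by linarith),
    hA.mono le_rfl ha.1 hb.2, by linarith, by linarith, by linarith, by linarith⟩

/-- The middle form of the cross ratio inequality, with the trivial bounds on lengths. -/
lemma mul_le_of_avoids (h : Expander f c) {m : ℕ} {a x y b s t : ℝ} (ha : 0 ≤ a) (hb : b ≤ 1)
    (hA : Avoids f c m a b) (hax : a < x) (hxy : x < y) (hyb : y < b) (ht : 0 ≤ t) (hs0 : 0 ≤ s)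
    (hs : s ≤ f^[m] x - f^[m] a) (ht' : t ≤ f^[m] b - f^[m] y) :
    (y - x) * (s * t) ≤ (f^[m] y - f^[m] x) * ((b - y) / (b - a) * (x - a)) := by
  have key := h.iterate_crossRatio ha hb hA hax hxy hyb
  have hI : ∀ z ∈ Icc a b, f^[m] z ∈ Icc (0 : ℝ) 1 := fun z hz =>
    h.iterate_mem ⟨ha.trans hz.1, hz.2.trans hb⟩ fun n hn => hA n hn z hz
  have ia := hI a ⟨le_rfl, by linarith⟩
  have ib := hI b ⟨by linarith, le_rfl⟩
  have g2 : f^[m] x < f^[m] y := h.iterate_lt (by linarith) hxy (by linarith)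
    (hA.mono le_rfl (by linarith) (by linarith))
  have hab : 0 < b - a := by linarith
  generalize f^[m] a = A at *
  generalize f^[m] x = X at *
  generalize f^[m] y = Y at *
  generalize f^[m] b = B at *
  have h1 : (y - x) * (b - a) * ((B - Y) * (X - A)) ≤ (Y - X) * (B - A) * ((b - y) * (x - a)) := by
    linarith
  have h2 : s * t ≤ (B - Y) * (X - A) := by
    calc s * t ≤ (X - A) * (B - Y) := by gcongr; linarith
      _ = _ := by ring
  have h3 : (y - x) * (b - a) * (s * t) ≤ (Y - X) * ((b - y) * (x - a)) := by
    calc (y - x) * (b - a) * (s * t) ≤ (y - x) * (b - a) * ((B - Y) * (X - A)) := by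
          have : 0 < y - x := by linarith
          gcongr
      _ ≤ _ := h1
      _ ≤ (Y - X) * 1 * ((b - y) * (x - a)) := by
          have e1 : 0 < Y - X := by linarith
          have e2 : 0 < b - y := by linarith
          have e3 : 0 < x - a := by linarith
          gcongr
          linarith [ia.1, ib.2]
      _ = _ := by ring
  rw [show (Y - X) * ((b - y) / (b - a) * (x - a)) = (Y - X) * ((b - y) * (x - a)) / (b - a) by
    field_simp, le_div_iff₀ hab]
  linarith

/-- Monotone branches onto intervals of a fixed size get short. -/
lemma eventually_isBranch_short (h : Expander f c) (hs : ArbitrarilySmallLevels f c) {d x η : ℝ}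
    (hd : 0 < d) (hη : 0 < η) : ∀ᶠ n in atTop, ∀ a a' b' b, IsBranch f c d n x a a' b' b →
      b' - a' < η := by
  -- A fixed [u, v] contained in infinitely many branches never meets c, so its images shrink to
  -- zero length. The collars of size d, however, bound these images below by (v - u) * d ^ 2.
  have main : ∀ u v : ℝ, 0 ≤ u → u < v → v ≤ 1 → ∀ᶠ n in atTop, ∀ a a' b' b,
      IsBranch f c d n x a a' b' b → ¬ (a' ≤ u ∧ v ≤ b') := by
    intro u v hu huv hv
    by_contra hcon
    have hfreq : ∃ᶠ n in atTop, ∃ a a' b' b, IsBranch f c d n x a a' b' b ∧ a' ≤ u ∧ v ≤ b' := by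
      rw [Filter.not_eventually] at hcon
      refine hcon.mono fun n hn => ?_
      push Not at hn
      exact hn
    have hall : AvoidsAll f c u v := fun m => by
      obtain ⟨n, hn, a, a', b', b, hB, h1, h2⟩ := (hfreq.and_eventually (eventually_ge_atTop m)).exists.imp
        fun n hn => (⟨hn.2, hn.1⟩ : m ≤ n ∧ _)
      exact hB.avoids.mono hn (hB.lt₁.le.trans h1) (h2.trans hB.lt₄.le)
    have hev := h.eventually_length_lt hs hu huv hv hall
      (show 0 < (v - u) * (d * d) by have : 0 < v - u := by linarith
                                     positivity)
    obtain ⟨n, ⟨a, a', b', b, hB, h1, h2⟩, hlt⟩ := (hfreq.and_eventually hev).exists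
    have hmono := h.iterate_strictMonoOn hB.zero_le hB.le_one hB.avoids
    have := hB.lt₁; have := hB.lt₂; have := hB.lt₃; have := hB.lt₄
    have m1 := hmono.monotoneOn (show a' ∈ Icc a b by constructor <;> linarith)
      (show u ∈ Icc a b by constructor <;> linarith) h1
    have m2 := hmono.monotoneOn (show v ∈ Icc a b by constructor <;> linarith)
      (show b' ∈ Icc a b by constructor <;> linarith) h2
    have key := h.mul_le_of_avoids hB.zero_le hB.le_one hB.avoids (x := u) (y := v) (s := d)
      (t := d) (by linarith) huv (by linarith) hd.le hd.le
      (by linarith [hB.eq₁, hB.eq₂]) (by linarith [hB.eq₃, hB.eq₄])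
    have m3 := hmono (show u ∈ Icc a b by constructor <;> linarith)
      (show v ∈ Icc a b by constructor <;> linarith) huv
    have e1 : (b - v) / (b - a) * (u - a) ≤ 1 := by
      have : (b - v) / (b - a) ≤ 1 := (div_le_one (by linarith)).2 (by linarith)
      nlinarith [hB.zero_le]
    nlinarith
  have hleft := main (x - η / 2) x
  have hright := main x (x + η / 2)
  by_cases hx : x ∈ Icc (0 : ℝ) 1
  · have l1 : ∀ᶠ n in atTop, ∀ a a' b' b, IsBranch f c d n x a a' b' b → x - η / 2 < a' := by
      by_cases h0 : 0 ≤ x - η / 2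
      · filter_upwards [hleft h0 (by linarith) hx.2] with n hn a a' b' b hB
        by_contra hcon
        exact hn a a' b' b hB ⟨not_lt.1 hcon, hB.lt₃.le⟩
      · refine Eventually.of_forall fun n a a' b' b hB => ?_
        linarith [hB.zero_le, hB.lt₁]
    have l2 : ∀ᶠ n in atTop, ∀ a a' b' b, IsBranch f c d n x a a' b' b → b' < x + η / 2 := by
      by_cases h0 : x + η / 2 ≤ 1
      · filter_upwards [hright hx.1 (by linarith) h0] with n hn a a' b' b hB
        by_contra hcon
        exact hn a a' b' b hB ⟨hB.lt₂.le, not_lt.1 hcon⟩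
      · refine Eventually.of_forall fun n a a' b' b hB => ?_
        linarith [hB.le_one, hB.lt₄]
    filter_upwards [l1, l2] with n h1 h2 a a' b' b hB
    linarith [h1 a a' b' b hB, h2 a a' b' b hB]
  · refine Eventually.of_forall fun n a a' b' b hB => absurd ⟨?_, ?_⟩ hx
    · linarith [hB.zero_le, hB.lt₁, hB.lt₂]
    · linarith [hB.le_one, hB.lt₃, hB.lt₄]

end Expander

namespace Expander

variable {f : ℝ → ℝ} {c p q : ℝ} {k l : ℕ}

/-- Points that enter the interior of a return interval are dense. -/
lemma exists_enters (h : Expander f c) (hs : ArbitrarilySmallLevels f c) (L : Level f c p q k l)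
    {u v : ℝ} (hu : 0 < u) (huv : u < v) (hv : v < 1) :
    ∃ z ∈ Icc u v, ∃ j, f^[j] z ∈ Ioo p q := by
  by_contra hcon
  push Not at hcon
  have hall : AvoidsAll f c u v := fun m j _ z hz e => hcon z hz j (e ▸ ⟨L.left_lt, L.lt_right⟩)
  obtain ⟨ε, hε, d, hd, -, H⟩ := h.exists_isBranch L
  set x := (u + v) / 2 with hx
  have hxuv : x ∈ Icc u v := ⟨by linarith, by linarith⟩
  have hfreq := H x ⟨by linarith, by linarith⟩ (hcon x hxuv)
  -- A branch around the midpoint is short enough to lie in [u, v], yet its image has length 2 * d,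
  -- while the image of [u, v] at the same time is shorter than d.
  obtain ⟨n, ⟨⟨-, a, a', b', b, hB⟩, hshort⟩, hlen⟩ := ((hfreq.and_eventually
    (h.eventually_isBranch_short hs (x := x) hd (show 0 < (v - u) / 2 by linarith))).and_eventually
    (h.eventually_length_lt hs hu.le huv hv.le hall hd)).exists
  have h1 := hshort a a' b' b hB
  have := hB.lt₂; have := hB.lt₃
  have hmono := h.iterate_strictMonoOn hu.le hv.le (hall n)
  have m1 := hmono.monotoneOn (show u ∈ Icc u v by constructor <;> linarith)
      (show a' ∈ Icc u v by constructor <;> linarith) (by linarith)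
  have m2 := hmono.monotoneOn (show b' ∈ Icc u v by constructor <;> linarith)
      (show v ∈ Icc u v by constructor <;> linarith) (by linarith)
  linarith [hB.eq₂, hB.eq₃]

/-- At the first entrance time the orbit has not met c before, so entering is an open condition. -/
lemma exists_Icc_enters (h : Expander f c) (hs : ArbitrarilySmallLevels f c)
    (L : Level f c p q k l) {u v : ℝ} (hu : 0 < u) (huv : u < v) (hv : v < 1) :
    ∃ u' v', u ≤ u' ∧ u' < v' ∧ v' ≤ v ∧ ∀ z ∈ Icc u' v', ∃ j, f^[j] z ∈ Ioo p q := by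
  obtain ⟨w, hw⟩ := exists_between huv
  obtain ⟨z, hz, hex⟩ := h.exists_enters hs L (hu.trans hw.1) hw.2 hv
  classical
  have hj := Nat.find_spec hex
  have hzI : z ∈ Icc (0 : ℝ) 1 := ⟨(hu.trans (hw.1.trans_le hz.1)).le, hz.2.trans hv.le⟩
  have hc : ∀ i < Nat.find hex, f^[i] z ≠ c := fun i hi e =>
    Nat.find_min hex hi (e ▸ ⟨L.left_lt, L.lt_right⟩)
  have hev := (h.iterate_continuousWithinAt hzI hc).eventually (Ioo_mem_nhds hj.1 hj.2)
  have huz : u < z := hw.1.trans_le hz.1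
  obtain ⟨a, ha, haz, H⟩ := exists_Icc_of_eventually (hu.trans huz) hzI.2 hev
  exact ⟨max a u, z, le_max_right _ _, max_lt haz huz, hz.2,
    fun y hy => ⟨_, H y ⟨(le_max_left _ _).trans hy.1, hy.2⟩⟩⟩

/-- Holes of definite size near every point. -/
lemma exists_uniform_holes (h : Expander f c) (hs : ArbitrarilySmallLevels f c)
    (L : Level f c p q k l) {ε d : ℝ} (hd : 0 < d) (hdε : 2 * d ≤ ε) :
    ∃ κ > 0, ∀ y ∈ Icc ε (1 - ε), ∃ u v, y - d ≤ u ∧ v ≤ y + d ∧ κ ≤ v - u ∧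
      ∀ z ∈ Icc u v, ∃ j, f^[j] z ∈ Ioo p q := by
  refine isCompact_Icc.induction_on (p := fun s => ∃ κ > 0, ∀ y ∈ s, ∃ u v, y - d ≤ u ∧
    v ≤ y + d ∧ κ ≤ v - u ∧ ∀ z ∈ Icc u v, ∃ j, f^[j] z ∈ Ioo p q) ?_ ?_ ?_ ?_
  · exact ⟨1, one_pos, fun y hy => absurd hy (by simp)⟩
  · rintro s t hst ⟨κ, hκ, H⟩
    exact ⟨κ, hκ, fun y hy => H y (hst hy)⟩
  · rintro s t ⟨κ, hκ, H⟩ ⟨κ', hκ', H'⟩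
    refine ⟨min κ κ', lt_min hκ hκ', fun y hy => ?_⟩
    rcases hy with hy | hy
    · obtain ⟨u, v, h1, h2, h3, h4⟩ := H y hy
      exact ⟨u, v, h1, h2, (min_le_left _ _).trans h3, h4⟩
    · obtain ⟨u, v, h1, h2, h3, h4⟩ := H' y hy
      exact ⟨u, v, h1, h2, (min_le_right _ _).trans h3, h4⟩
  · intro y hy
    -- A hole within distance d / 2 of y serves every y' within d / 2 of y.
    obtain ⟨u, v, h1, h2, h3, h4⟩ := h.exists_Icc_enters hs L (u := y - d / 2) (v := y + d / 2)
      (by linarith [hy.1]) (by linarith) (by linarith [hy.2])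
    refine ⟨Ioo (y - d / 2) (y + d / 2), mem_nhdsWithin_of_mem_nhds
      (Ioo_mem_nhds (by linarith) (by linarith)), v - u, by linarith, fun y' hy' => ?_⟩
    exact ⟨u, v, by linarith [hy'.2], by linarith [hy'.1], le_rfl, h4⟩

/-- Almost every point enters a given return interval. -/
lemma volume_not_enters_eq_zero (h : Expander f c) (hs : ArbitrarilySmallLevels f c)
    (L : Level f c p q k l) :
    volume {x | x ∈ Ioo (0 : ℝ) 1 ∧ ∀ j, f^[j] x ∉ Ioo p q} = 0 := by
  set E := {x | x ∈ Ioo (0 : ℝ) 1 ∧ ∀ j, f^[j] x ∉ Ioo p q} with hE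
  obtain ⟨ε, hε, d, hd, hdε, H⟩ := h.exists_isBranch L
  obtain ⟨κ, hκ, Hκ⟩ := h.exists_uniform_holes hs L hd hdε
  -- the hole in a branch occupies a definite proportion
  have hole : ∀ n x a a' b' b, IsBranch f c d n x a a' b' b → ε ≤ f^[n] x → f^[n] x ≤ 1 - ε →
      ∃ u v, a' ≤ u ∧ u < v ∧ v ≤ b' ∧ (b' - a') * (d * κ) ≤ 3 * (v - u) ∧
        ∀ z ∈ Icc u v, z ∉ E := by
    intro n x a a' b' b hB h1 h2
    have := hB.lt₁; have := hB.lt₂; have := hB.lt₃; have := hB.lt₄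
    have := hB.zero_le; have := hB.le_one
    have hmono := h.iterate_strictMonoOn hB.zero_le hB.le_one hB.avoids
    obtain ⟨U, V, hU, hV, hUV, hz⟩ := Hκ _ ⟨h1, h2⟩
    have hA' := hB.avoids.mono le_rfl (by linarith : a ≤ a') (by linarith : b' ≤ b)
    obtain ⟨u, hu, eu⟩ := h.exists_iterate_eq (by linarith) (by linarith) (by linarith) hA'
      (show U ∈ Icc _ _ by rw [hB.eq₂, hB.eq₃]; constructor <;> linarith)
    obtain ⟨v, hv, ev⟩ := h.exists_iterate_eq (by linarith) (by linarith) (by linarith) hA'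
      (show V ∈ Icc _ _ by rw [hB.eq₂, hB.eq₃]; constructor <;> linarith)
    have hu' : u ∈ Icc a b := ⟨by linarith [hu.1], by linarith [hu.2]⟩
    have hv' : v ∈ Icc a b := ⟨by linarith [hv.1], by linarith [hv.2]⟩
    have huv : u < v := (hmono.lt_iff_lt hu' hv').1 (by rw [eu, ev]; linarith)
    have hI : ∀ z ∈ Icc a b, f^[n] z ∈ Icc (0 : ℝ) 1 := fun z hz =>
      h.iterate_mem ⟨by linarith [hz.1], by linarith [hz.2]⟩ fun j hj => hB.avoids j hj z hz
    have hdκ : d * κ ≤ 1 := by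
      have := (hI a ⟨le_rfl, by linarith⟩).1
      have := (hI b ⟨by linarith, le_rfl⟩).2
      have : κ ≤ 1 := by linarith [hB.eq₁, hB.eq₄]
      have : d ≤ 1 := by linarith [hB.eq₁, hB.eq₄]
      nlinarith
    -- Both remaining parts of [a', b'] are compared with the hole [u, v]. One collar is the image
    -- of the hole, of length at least κ, the other the stretch of length d beyond the branch end.
    -- Adding the hole itself gives the factor 3.
    have hR : (b' - v) * (d * κ) ≤ v - u := by
      rcases eq_or_lt_of_le hv.2 with e | hvb
      · rw [e, sub_self, zero_mul]; linarith
      have key := h.mul_le_of_avoids (a := u) (x := v) (y := b') (b := b) (s := κ) (t := d)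
        (by linarith [hu.1]) hB.le_one (hB.avoids.mono le_rfl hu'.1 le_rfl) huv hvb (by linarith)
        hd.le hκ.le (by rw [eu, ev]; exact hUV) (by rw [hB.eq₃, hB.eq₄]; linarith)
      have e1 : f^[n] b' - f^[n] v ≤ 1 := by
        linarith [(hI v hv').1, (hI b' ⟨by linarith, by linarith⟩).2]
      have e2 : (b - b') / (b - u) ≤ 1 := (div_le_one (by linarith)).2 (by linarith)
      have e3 : 0 ≤ (b - b') / (b - u) := div_nonneg (by linarith) (by linarith)
      have e4 : (b - b') / (b - u) * (v - u) ≤ v - u := by nlinarith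
      have e5 : 0 ≤ (b - b') / (b - u) * (v - u) := mul_nonneg e3 (by linarith)
      nlinarith
    have hL : (u - a') * (d * κ) ≤ v - u := by
      rcases eq_or_lt_of_le hu.1 with e | hau
      · rw [e, sub_self, zero_mul]; linarith
      have key := h.mul_le_of_avoids (a := a) (x := a') (y := u) (b := v) (s := d) (t := κ)
        hB.zero_le (by linarith [hv.2]) (hB.avoids.mono le_rfl le_rfl hv'.2) (by linarith) hau huv
        hκ.le hd.le (by rw [hB.eq₁, hB.eq₂]; linarith) (by rw [eu, ev]; exact hUV)
      have e1 : f^[n] u - f^[n] a' ≤ 1 := by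
        linarith [(hI u hu').2, (hI a' ⟨by linarith, by linarith⟩).1]
      have e0 : 0 ≤ f^[n] u - f^[n] a' := by
        rw [sub_nonneg]; exact hmono.monotoneOn ⟨by linarith, by linarith⟩ hu' hau.le
      have e2 : (a' - a) / (v - a) ≤ 1 := (div_le_one (by linarith)).2 (by linarith)
      have e6 : (v - u) / (v - a) * (a' - a) = (v - u) * ((a' - a) / (v - a)) := by ring
      have e3 : 0 ≤ (a' - a) / (v - a) := div_nonneg (by linarith) (by linarith)
      have e4 : (v - u) * ((a' - a) / (v - a)) ≤ v - u := by nlinarith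
      have e5 : 0 ≤ (v - u) * ((a' - a) / (v - a)) := mul_nonneg (by linarith) e3
      rw [e6] at key
      nlinarith
    refine ⟨u, v, hu.1, huv, hv.2, by nlinarith, fun z hzuv hzE => ?_⟩
    have hz' : z ∈ Icc a b := ⟨hu'.1.trans hzuv.1, hzuv.2.trans hv'.2⟩
    obtain ⟨j, hj⟩ := hz (f^[n] z)
      ⟨eu ▸ hmono.monotoneOn hu' hz' hzuv.1, ev ▸ hmono.monotoneOn hz' hv' hzuv.2⟩
    rw [← Function.iterate_add_apply] at hj
    exact hzE.2 _ hj
  -- density points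
  have hdens := IsUnifLocDoublingMeasure.ae_tendsto_measure_inter_div (volume : Measure ℝ) E 1
  have hEm : ∀ᵐ x ∂(volume.restrict E), x ∈ E := by
    have hmeas : MeasurableSet E := by
      have hclosed : E = Ioo 0 1 ∩ (Ioo 0 1 ∩ {x | ∃ j, f^[j] x ∈ Ioo p q})ᶜ := by
        ext x
        simp only [hE, mem_ofPred_eq, mem_inter_iff, mem_compl_iff, not_and, not_exists]
        exact ⟨fun hx => ⟨hx.1, fun _ => hx.2⟩, fun hx => ⟨hx.1, hx.2 hx.1⟩⟩
      rw [hclosed]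
      refine measurableSet_Ioo.inter (IsOpen.measurableSet ?_).compl
      rw [isOpen_iff_mem_nhds]
      rintro x ⟨hx, hex⟩
      classical
      have hj := Nat.find_spec hex
      have hc : ∀ i < Nat.find hex, f^[i] x ≠ c := fun i hi e =>
        Nat.find_min hex hi (e ▸ ⟨L.left_lt, L.lt_right⟩)
      have hev := (h.iterate_continuousWithinAt (Ioo_subset_Icc_self hx) hc).eventually
        (Ioo_mem_nhds hj.1 hj.2)
      rw [nhdsWithin_eq_nhds.2 (Icc_mem_nhds hx.1 hx.2)] at hev
      filter_upwards [hev, Ioo_mem_nhds hx.1 hx.2] with z hz hz'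
      exact ⟨hz', _, hz⟩
    exact ae_restrict_mem hmeas
  have hfalse : ∀ᵐ x ∂(volume.restrict E), False := by
    filter_upwards [hdens, hEm] with x hx hxE
    have hfreq := H x hxE.1 hxE.2
    have hch : ∀ i : ℕ, ∃ n a a' b' b, IsBranch f c d n x a a' b' b ∧ (ε ≤ f^[n] x ∧
        f^[n] x ≤ 1 - ε) ∧ b' - a' < 1 / ((i : ℝ) + 1) := fun i => by
      obtain ⟨n, ⟨h1, a, a', b', b, hB⟩, h2⟩ := (hfreq.and_eventually
        (h.eventually_isBranch_short hs (x := x) hd (Nat.one_div_pos_of_nat (n := i)))).exists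
      exact ⟨n, a, a', b', b, hB, h1, h2 a a' b' b hB⟩
    choose n a a' b' b hB hε' hlt using hch
    have hpos : ∀ i, 0 < (b' i - a' i) / 2 := fun i => by linarith [(hB i).lt₂, (hB i).lt₃]
    have hball : ∀ i, Metric.closedBall ((a' i + b' i) / 2) ((b' i - a' i) / 2) =
        Icc (a' i) (b' i) := fun i => by
      rw [Real.closedBall_eq_Icc]; congr 1 <;> ring
    have ht := hx (l := atTop) (fun i => (a' i + b' i) / 2) (fun i => (b' i - a' i) / 2)
      (by
        refine tendsto_nhdsWithin_of_tendsto_nhds_of_eventually_within _ ?_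
          (Eventually.of_forall hpos)
        refine squeeze_zero (fun i => (hpos i).le) (fun i => ?_)
          tendsto_one_div_add_atTop_nhds_zero_nat
        linarith [hlt i, hpos i])
      (Eventually.of_forall fun i => by
        rw [one_mul, hball]; exact ⟨(hB i).lt₂.le, (hB i).lt₃.le⟩)
    simp only [hball] at ht
    -- The complement of E fills at least the proportion θ of each interval of a sequence shrinking
    -- to x, so x is not a density point of E.
    set θ : ℝ := d * κ / 3 with hθ
    have hθ0 : 0 < θ := by positivity
    have hle : ∀ i, volume (E ∩ Icc (a' i) (b' i)) / volume (Icc (a' i) (b' i)) ≤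
        ENNReal.ofReal (1 - θ) := fun i => by
      obtain ⟨u, v, h1, h2, h3, h4, h5⟩ := hole (n i) x _ _ _ _ (hB i) (hε' i).1 (hε' i).2
      have hl : 0 < b' i - a' i := by linarith [hpos i]
      have h6 : volume (E ∩ Icc (a' i) (b' i)) ≤ ENNReal.ofReal ((b' i - a' i) * (1 - θ)) := by
        calc volume (E ∩ Icc (a' i) (b' i)) ≤ volume (Icc (a' i) u ∪ Icc v (b' i)) := by
              refine measure_mono fun z hz => ?_
              by_contra hcon
              simp only [mem_union, mem_Icc, not_or, not_and, not_le] at hcon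
              refine h5 z ⟨(hcon.1 hz.2.1).le, ?_⟩ hz.1
              by_contra hzv
              exact absurd hz.2.2 (not_le.2 (hcon.2 (not_le.1 hzv).le))
          _ ≤ volume (Icc (a' i) u) + volume (Icc v (b' i)) := measure_union_le _ _
          _ = ENNReal.ofReal (u - a' i + (b' i - v)) := by
              rw [Real.volume_Icc, Real.volume_Icc, ENNReal.ofReal_add (by linarith) (by linarith)]
          _ ≤ _ := by
              apply ENNReal.ofReal_le_ofReal
              rw [hθ]; linarith
      rw [Real.volume_Icc]
      refine ENNReal.div_le_of_le_mul ?_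
      rwa [← ENNReal.ofReal_mul' hl.le, mul_comm (1 - θ)]
    have := le_of_tendsto' ht hle
    have h1 : ENNReal.ofReal (1 - θ) < 1 := by
      rw [← ENNReal.ofReal_one]
      exact (ENNReal.ofReal_lt_ofReal_iff one_pos).2 (by linarith)
    exact absurd this (not_le.2 h1)
  rw [ae_iff] at hfalse
  simpa using hfalse

end Expander

/-! ### First return times and renormalization intervals -/

lemma returnTime_eq {f : ℝ → ℝ} {J : Set ℝ} {x : ℝ} {r : ℕ} (hr : 0 < r) (hJ : f^[r] x ∈ J)
    (hn : ∀ j, 0 < j → j < r → f^[j] x ∉ J) : returnTime f J x = r := by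
  apply le_antisymm
  · exact Nat.sInf_le ⟨hr, hJ⟩
  · by_contra hcon
    have h := Nat.sInf_mem (s := {k | 0 < k ∧ f^[k] x ∈ J}) ⟨r, hr, hJ⟩
    exact hn _ h.1 (not_le.1 hcon) h.2

lemma returnTime_spec {f : ℝ → ℝ} {J : Set ℝ} {x : ℝ} (h : ∃ k, 0 < k ∧ f^[k] x ∈ J) :
    0 < returnTime f J x ∧ f^[returnTime f J x] x ∈ J ∧
      ∀ j, 0 < j → j < returnTime f J x → f^[j] x ∉ J := by
  have h1 := Nat.sInf_mem (s := {k | 0 < k ∧ f^[k] x ∈ J}) h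
  exact ⟨h1.1, h1.2, fun j h0 hj hJ => Nat.notMem_of_lt_sInf hj ⟨h0, hJ⟩⟩

lemma returnTime_reflect (f : ℝ → ℝ) (p q x : ℝ) :
    returnTime (reflect f) (Icc (1 - q) (1 - p)) x = returnTime f (Icc p q) (1 - x) := by
  unfold returnTime
  congr 1
  ext k
  simp only [mem_ofPred_eq, reflect_iterate, mem_Icc]
  constructor <;> rintro ⟨h0, h1, h2⟩ <;> refine ⟨h0, ?_, ?_⟩ <;> linarith

/-- If the first return map is increasing to the left of `c` and fixes the end point, then the
return time is constant. -/
lemma Expander.exists_returnTime_eq {f : ℝ → ℝ} {c p q : ℝ} (h : Expander f c) (hp0 : 0 ≤ p)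
    (hpc : p < c) (hcq : c < q) (hret : ∀ x ∈ Ico p c, ∃ k, 0 < k ∧ f^[k] x ∈ Icc p q)
    (hfix : firstReturn f (Icc p q) p = p) (hmono : StrictMonoOn (firstReturn f (Icc p q)) (Ico p c)) :
    ∃ k, ∀ x ∈ Ico p c, returnTime f (Icc p q) x = k := by
  set J := Icc p q with hJ
  have hcJ : c ∈ J := ⟨hpc.le, hcq.le⟩
  have hc1 := h.lt_one
  have hne : ∀ x ∈ Ico p c, ∀ j < returnTime f J x, f^[j] x ≠ c := by
    intro x hx j hj e
    rcases Nat.eq_zero_or_pos j with rfl | h0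
    · exact hx.2.ne e
    · exact (returnTime_spec (hret x hx)).2.2 j h0 hj (e ▸ hcJ)
  have hI : ∀ x ∈ Ico p c, x ∈ Icc (0 : ℝ) 1 := fun x hx => ⟨hp0.trans hx.1, hx.2.le.trans hc1.le⟩
  have hout : ∀ x ∈ Ico p c, ∀ᶠ z in 𝓝[Icc 0 1] x, ∀ j, 0 < j → j < returnTime f J x →
      f^[j] z ∉ J := by
    intro x hx
    have : ∀ j ∈ Finset.range (returnTime f J x), ∀ᶠ z in 𝓝[Icc 0 1] x, 0 < j → f^[j] z ∉ J := by
      intro j hj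
      rw [Finset.mem_range] at hj
      by_cases h0 : 0 < j
      · have hJc : Jᶜ ∈ 𝓝 (f^[j] x) :=
          isClosed_Icc.isOpen_compl.mem_nhds ((returnTime_spec (hret x hx)).2.2 j h0 hj)
        filter_upwards [(h.iterate_continuousWithinAt (hI x hx)
          fun i hi => hne x hx i (hi.trans hj)).eventually hJc] with z hz _ using hz
      · exact Eventually.of_forall fun z h0' => absurd h0' h0
    filter_upwards [(Finset.eventually_all _).2 this] with z hz j h0 hj
    exact hz j (Finset.mem_range.2 hj) h0
  -- Strict monotonicity sends (p, c) into the open interval (p, q), so a return persists for nearby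
  -- points and the integer-valued return time is locally constant.
  have hloc : ContinuousOn (returnTime f J) (Ioo p c) := by
    intro x hx
    have hx' : x ∈ Ico p c := ⟨hx.1.le, hx.2⟩
    have hmem : firstReturn f J x ∈ Ioo p q := by
      refine ⟨?_, ?_⟩
      · have := hmono ⟨le_rfl, hpc⟩ hx' hx.1
        rwa [hfix] at this
      · obtain ⟨y, hy⟩ := exists_between hx.2
        have hy' : y ∈ Ico p c := ⟨(hx.1.trans hy.1).le, hy.2⟩
        exact (hmono hx' hy' hy.1).trans_le (returnTime_spec (hret y hy')).2.1.2
    have hev : ∀ᶠ z in 𝓝[Icc 0 1] x, returnTime f J z = returnTime f J x := by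
      filter_upwards [hout x hx', (h.iterate_continuousWithinAt (hI x hx') (hne x hx')).eventually
        (Ioo_mem_nhds hmem.1 hmem.2)] with z h1 h2
      exact returnTime_eq (returnTime_spec (hret x hx')).1 (Ioo_subset_Icc_self h2) h1
    have hev' : ∀ᶠ z in 𝓝[Ioo p c] x, returnTime f J z = returnTime f J x :=
      hev.filter_mono (nhdsWithin_mono _ fun z hz => hI z ⟨hz.1.le, hz.2⟩)
    exact (continuousWithinAt_const (b := returnTime f J x)).congr_of_eventuallyEq hev' rfl
  have hconst : ∀ x ∈ Ioo p c, ∀ y ∈ Ioo p c, returnTime f J x = returnTime f J y :=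
    fun x hx y hy => isPreconnected_Ioo.constant hloc hx hy
  have hpI : p ∈ Ico p c := ⟨le_rfl, hpc⟩
  have hfix' : f^[returnTime f J p] p = p := hfix
  -- The return of p lands on the boundary of J, but p is fixed by it, so points just to the right
  -- of p return at the same time.
  obtain ⟨z, hz, e⟩ : ∃ z ∈ Ioo p c, returnTime f J z = returnTime f J p := by
    have hev := ((hout p hpI).and (h.eventually_avoids (hI p hpI) (hne p hpI))).and
      ((h.iterate_continuousWithinAt (hI p hpI) (hne p hpI)).eventually
        (gt_mem_nhds (show f^[returnTime f J p] p < q by rw [hfix']; exact hpc.trans hcq)))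
    have hp1 : p < 1 := hpc.trans hc1
    have hle : 𝓝[≥] p ≤ 𝓝[Icc 0 1] p := by
      rw [← nhdsWithin_Icc_eq_nhdsGE hp1]
      exact nhdsWithin_mono _ (Icc_subset_Icc_left hp0)
    have hev' := hev.filter_mono hle
    obtain ⟨u, hu, H⟩ := mem_nhdsGE_iff_exists_Icc_subset.1 hev'
    obtain ⟨z, hz1, hz2⟩ := exists_between (lt_min hu hpc)
    have hzu : z ≤ u := (hz2.trans_le (min_le_left _ _)).le
    have hzc : z < c := hz2.trans_le (min_le_right _ _)
    refine ⟨z, ⟨hz1, hzc⟩, ?_⟩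
    have hA : Avoids f c (returnTime f J p) p z := fun j hj w hw =>
      (H ⟨hw.1, hw.2.trans hzu⟩).1.2 j hj
    have h1 := h.iterate_lt hp0 hz1 (hzc.trans hc1).le hA
    have h2 := H ⟨hz1.le, hzu⟩
    rw [hfix'] at h1
    exact returnTime_eq (returnTime_spec (hret p hpI)).1 ⟨h1.le, h2.2.le⟩ h2.1.1
  refine ⟨returnTime f J p, fun x hx => ?_⟩
  rcases eq_or_lt_of_le hx.1 with rfl | hlt
  · rfl
  · rw [hconst x ⟨hlt, hx.2⟩ z hz, e]

namespace IsNontrivialLorenz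

variable {a b c : ℝ} {g : ℝ → ℝ}

lemma strictMonoOn_Icc (h : IsNontrivialLorenz a b c g) {x y : ℝ} (hx : a ≤ x) (hy : y ≤ b)
    (hc : c ∉ Icc x y) : StrictMonoOn g (Icc x y) := by
  have hsub : Icc x y ⊆ dom a b c := fun z hz =>
    ⟨⟨hx.trans hz.1, hz.2.trans hy⟩, fun e => hc (e ▸ hz)⟩
  apply strictMonoOn_of_deriv_pos (convex_Icc x y) (h.contDiffOn.continuousOn.mono hsub)
  intro z hz
  rw [interior_Icc] at hz
  have hz' := hsub (Ioo_subset_Icc_self hz)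
  rw [(hasDerivAt_derivWithin_dom h.contDiffOn (by norm_num)
    ⟨hx.trans_lt hz.1, hz.2.trans_le hy⟩ hz'.2).deriv]
  exact h.deriv_pos z hz'

lemma strictMonoOn_left (h : IsNontrivialLorenz a b c g) : StrictMonoOn g (Ico a c) :=
  fun _ hx _ hy hxy => h.strictMonoOn_Icc hx.1 (hy.2.le.trans h.singular_mem.2.le)
    (fun hc => hy.2.not_ge hc.2) ⟨le_rfl, hxy.le⟩ ⟨hxy.le, le_rfl⟩ hxy

lemma strictMonoOn_right (h : IsNontrivialLorenz a b c g) : StrictMonoOn g (Ioc c b) :=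
  fun _ hx _ hy hxy => h.strictMonoOn_Icc (h.singular_mem.1.le.trans hx.1.le) hy.2
    (fun hc => hx.1.not_ge hc.1) ⟨le_rfl, hxy.le⟩ ⟨hxy.le, le_rfl⟩ hxy

/-- `Function.leftLim` defaults to the value at c if there is no limit; a bounded monotone branch
excludes this. -/
lemma tendsto_leftLim (h : IsNontrivialLorenz a b c g) :
    Tendsto g (𝓝[<] c) (𝓝 (Function.leftLim g c)) := by
  have hsub : Ioo a c ⊆ Ico a c := Ioo_subset_Ico_self
  have ht := (h.strictMonoOn_left.monotoneOn.mono hsub).tendsto_nhdsWithin_Ioo_left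
    (nonempty_Ioo.2 h.singular_mem.1) ⟨b, by
      rintro _ ⟨x, hx, rfl⟩
      exact (h.mapsTo ⟨⟨hx.1.le, hx.2.le.trans h.singular_mem.2.le⟩, hx.2.ne⟩).2⟩
  rw [leftLim_eq_of_tendsto ht]
  exact ht

lemma tendsto_rightLim (h : IsNontrivialLorenz a b c g) :
    Tendsto g (𝓝[>] c) (𝓝 (Function.rightLim g c)) := by
  have hsub : Ioo c b ⊆ Ioc c b := Ioo_subset_Ioc_self
  have ht := (h.strictMonoOn_right.monotoneOn.mono hsub).tendsto_nhdsWithin_Ioo_right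
    (nonempty_Ioo.2 h.singular_mem.2) ⟨a, by
      rintro _ ⟨x, hx, rfl⟩
      exact (h.mapsTo ⟨⟨h.singular_mem.1.le.trans hx.1.le, hx.2.le⟩, hx.1.ne'⟩).1⟩
  rw [rightLim_eq_of_tendsto ht]
  exact ht

end IsNontrivialLorenz

lemma Expander.exists_level {f : ℝ → ℝ} {c : ℝ} {J : Set ℝ} (h : Expander f c)
    (hJ : IsReturnInterval f c J) : ∃ p q k l, J = Icc p q ∧ Level f c p q k l ∧
      (∀ x ∈ Ico p c, returnTime f J x = k) ∧ ∀ x ∈ Ioc c q, returnTime f J x = l := by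
  obtain ⟨p, q, rfl, hc, hsub, hret, hl⟩ := hJ
  have hpq : p ≤ q := (hc.1.trans hc.2).le
  have hp0 : 0 ≤ p := (hsub ⟨le_rfl, hpq⟩).1
  have hq1 : q ≤ 1 := (hsub ⟨hpq, le_rfl⟩).2
  have hdl : ∀ x ∈ Ico p c, x ∈ dom p q c := fun x hx => ⟨⟨hx.1, hx.2.le.trans hc.2.le⟩, hx.2.ne⟩
  have hdr : ∀ x ∈ Ioc c q, x ∈ dom p q c := fun x hx => ⟨⟨hc.1.le.trans hx.1.le, hx.2⟩, hx.1.ne'⟩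
  obtain ⟨k, hk⟩ := h.exists_returnTime_eq hp0 hc.1 hc.2 (fun x hx => hret x (hdl x hx)) hl.map_left
    hl.strictMonoOn_left
  have hfr : ∀ x, firstReturn (Lorenz.reflect f) (Icc (1 - q) (1 - p)) x =
      1 - firstReturn f (Icc p q) (1 - x) := fun x => by
    rw [firstReturn, firstReturn, returnTime_reflect, reflect_iterate]
  obtain ⟨l, hl'⟩ := h.reflect.exists_returnTime_eq (p := 1 - q) (q := 1 - p) (by linarith)
    (by linarith [hc.2]) (by linarith [hc.1])
    (fun x hx => by
      obtain ⟨k, hk0, hk⟩ := hret (1 - x) (hdr _ ⟨by linarith [hx.2], by linarith [hx.1]⟩)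
      exact ⟨k, hk0, by rw [reflect_iterate]; exact ⟨by linarith [hk.2], by linarith [hk.1]⟩⟩)
    (by rw [hfr, sub_sub_cancel, hl.map_right])
    (fun x hx y hy hxy => by
      rw [hfr, hfr]
      exact sub_lt_sub_left (hl.strictMonoOn_right
        (show 1 - y ∈ Ioc c q from ⟨by linarith [hy.2], by linarith [hy.1]⟩)
        (show 1 - x ∈ Ioc c q from ⟨by linarith [hx.2], by linarith [hx.1]⟩) (by linarith)) 1)
  have hl' : ∀ x ∈ Ioc c q, returnTime f (Icc p q) x = l := fun x hx => by
    have := hl' (1 - x) ⟨by linarith [hx.2], by linarith [hx.1]⟩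
    rwa [returnTime_reflect, sub_sub_cancel] at this
  have hpI : p ∈ Ico p c := ⟨le_rfl, hc.1⟩
  have hqI : q ∈ Ioc c q := ⟨hc.2, le_rfl⟩
  have hsl : ∀ x ∈ Ico p c, 0 < k ∧ f^[k] x ∈ Icc p q ∧ ∀ j, 0 < j → j < k → f^[j] x ∉ Icc p q :=
    fun x hx => hk x hx ▸ returnTime_spec (hret x (hdl x hx))
  have hsr : ∀ x ∈ Ioc c q, 0 < l ∧ f^[l] x ∈ Icc p q ∧ ∀ j, 0 < j → j < l → f^[j] x ∉ Icc p q :=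
    fun x hx => hl' x hx ▸ returnTime_spec (hret x (hdr x hx))
  refine ⟨p, q, k, l, rfl, ⟨(hsl p hpI).1, (hsr q hqI).1, hp0, hc.1, hc.2, hq1, ?_, ?_,
    fun x hx => (hsl x hx).2.1, fun x hx => (hsr x hx).2.1, fun x hx => (hsl x hx).2.2,
    fun x hx => (hsr x hx).2.2, ?_, ?_⟩, hk, hl'⟩
  · have := hl.map_left
    rwa [firstReturn, hk p hpI] at this
  · have := hl.map_right
    rwa [firstReturn, hl' q hqI] at this
  · have hev := (hl.tendsto_leftLim.eventually (lt_mem_nhds hl.nontrivial.2)).and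
      (Ioo_mem_nhdsLT hc.1)
    obtain ⟨x, hx, hxI⟩ := hev.exists
    rw [firstReturn, hk x ⟨hxI.1.le, hxI.2⟩] at hx
    exact ⟨x, hxI, hx⟩
  · have hev := (hl.tendsto_rightLim.eventually (gt_mem_nhds hl.nontrivial.1)).and
      (Ioo_mem_nhdsGT hc.2)
    obtain ⟨x, hx, hxI⟩ := hev.exists
    rw [firstReturn, hl' x ⟨hxI.1, hxI.2.le⟩] at hx
    exact ⟨x, hxI, hx⟩

/-! ### Hitting times and components of the level sets -/

/-- The points that hit `J` for the first time after `m` steps. -/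
def hitSet (f : ℝ → ℝ) (J : Set ℝ) (m : ℕ) : Set ℝ :=
  {y | f^[m] y ∈ J ∧ ∀ i < m, f^[i] y ∉ J}

lemma disjoint_hitSet {f : ℝ → ℝ} {J : Set ℝ} {m n : ℕ} (h : m ≠ n) :
    Disjoint (hitSet f J m) (hitSet f J n) := by
  rw [Set.disjoint_left]
  intro y hm hn
  rcases lt_or_gt_of_ne h with hlt | hlt
  · exact hn.2 m hlt hm.1
  · exact hm.2 n hlt hn.1

/-- A connected subset of a finite union of closed sets, each of which has a constant label, has a
constant label. -/
lemma subset_of_isPreconnected_of_finite_closed {ι X : Type*} [TopologicalSpace X] [Finite ι]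
    {P : ι → Set X} {H : ℕ → Set X} (label : ι → ℕ) (hP : ∀ i, IsClosed (P i))
    (hPH : ∀ i, P i ⊆ H (label i)) (hH : ∀ m n, m ≠ n → Disjoint (H m) (H n)) {T : Set X}
    (hT : IsPreconnected T) (hTP : T ⊆ ⋃ i, P i) {x : X} (hx : x ∈ T) {m : ℕ} (hxm : x ∈ H m) :
    T ⊆ H m := by
  set U := ⋃ i : {i // label i = m}, P i
  set V := ⋃ i : {i // label i ≠ m}, P i
  have hU : U ⊆ H m := iUnion_subset fun i => by
    have := hPH i
    rwa [i.2] at this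
  have hV : ∀ y ∈ V, y ∉ H m := fun y hy hym => by
    obtain ⟨i, hi⟩ := mem_iUnion.1 hy
    exact Set.disjoint_left.1 (hH _ _ i.2) (hPH i hi) hym
  have h1 := isPreconnected_iff_subset_of_disjoint_closed.1 hT U V
    (isClosed_iUnion_of_finite fun i => hP i) (isClosed_iUnion_of_finite fun i => hP i) ?_ ?_
  · rcases h1 with h1 | h1
    · exact h1.trans hU
    · exact absurd hxm (hV x (h1 hx))
  · intro y hy
    obtain ⟨i, hi⟩ := mem_iUnion.1 (hTP hy)
    by_cases h : label i = m
    · exact Or.inl (mem_iUnion.2 ⟨⟨i, h⟩, hi⟩)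
    · exact Or.inr (mem_iUnion.2 ⟨⟨i, h⟩, hi⟩)
  · rw [Set.eq_empty_iff_forall_notMem]
    rintro y ⟨-, hyU, hyV⟩
    exact hV y hyV (hU hyU)

namespace Level

variable {f : ℝ → ℝ} {c p q : ℝ} {k l : ℕ}

lemma left_avoids (L : Level f c p q k l) {x : ℝ} (hx : x ∈ Ico p c) : ∀ j < k, f^[j] x ≠ c :=
  fun j hj => L.avoids_left hx.2 j hj x ⟨hx.1, le_rfl⟩

lemma right_avoids (L : Level f c p q k l) {x : ℝ} (hx : x ∈ Ioc c q) : ∀ j < l, f^[j] x ≠ c :=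
  fun j hj => L.avoids_right hx.1 j hj x ⟨le_rfl, hx.2⟩

lemma Icc_subset (L : Level f c p q k l) : Icc p q ⊆ Icc 0 1 := Icc_subset_Icc L.zero_le L.le_one

lemma left_mem_unit (L : Level f c p q k l) {x : ℝ} (hx : x ∈ Ico p c) : x ∈ Icc (0 : ℝ) 1 :=
  L.Icc_subset ⟨hx.1, hx.2.le.trans L.lt_right.le⟩

lemma left_iterate_mem_unit (h : Expander f c) (L : Level f c p q k l) {x : ℝ} (hx : x ∈ Ico p c)
    {j : ℕ} (hj : j ≤ k) : f^[j] x ∈ Icc (0 : ℝ) 1 :=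
  h.iterate_mem (L.left_mem_unit hx) fun i hi => L.left_avoids hx i (hi.trans_le hj)

lemma left_monotoneOn (h : Expander f c) (L : Level f c p q k l) {j : ℕ} (hj : j ≤ k) :
    StrictMonoOn f^[j] (Ico p c) := fun _ hx _ hy hxy =>
  h.iterate_strictMonoOn L.zero_le (hy.2.le.trans h.lt_one.le)
    ((L.avoids_left hy.2).mono hj le_rfl le_rfl) ⟨hx.1, hxy.le⟩ ⟨hy.1, le_rfl⟩ hxy

lemma left_continuousOn (h : Expander f c) (L : Level f c p q k l) {j : ℕ} (hj : j ≤ k) :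
    ContinuousOn f^[j] (Ico p c) := fun _ hx =>
  (h.iterate_continuousWithinAt (L.left_mem_unit hx)
    fun i hi => L.left_avoids hx i (hi.trans_le hj)).mono fun _ hz => L.left_mem_unit hz

/-- The closures of the intervals of a level cycle do not meet the return interval. -/
lemma closure_left_not_mem (h : Expander f c) (L : Level f c p q k l) {j : ℕ} (hj0 : 0 < j)
    (hj : j < k) {y : ℝ} (hy : y ∈ closure (f^[j] '' Ico p c)) : y ∉ Icc p q := by
  intro hyJ
  set S := f^[j] '' Ico p c with hS
  have hSJ : ∀ s ∈ S, s ∉ Icc p q := by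
    rintro _ ⟨x, hx, rfl⟩
    exact L.left_not_mem x hx j hj0 hj
  have hSc : S.OrdConnected :=
    (isPreconnected_Ico.image _ (L.left_continuousOn h hj.le)).ordConnected
  have hp : p ∈ Ico p c := ⟨le_rfl, L.left_lt⟩
  have hmin : ∀ s ∈ S, f^[j] p ≤ s := by
    rintro _ ⟨x, hx, rfl⟩
    exact (L.left_monotoneOn h hj.le).monotoneOn hp hx hx.1
  have hpS : f^[j] p ∈ S := ⟨p, hp, rfl⟩
  have hcl : f^[j] p ≤ y :=
    closure_minimal (fun s hs => hmin s hs) (isClosed_Ici (a := f^[j] p)) hy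
  have hpq := L.left_lt.trans L.lt_right
  -- The image avoids [p, q] but its closure would touch it from the left, so y = p. By continuity p
  -- would then be back in [p, q] after k - j < k steps.
  have hlow : f^[j] p < p := by
    by_contra hcon
    exact hSJ _ hpS ⟨not_lt.1 hcon, hcl.trans hyJ.2⟩
  have hup : ∀ s ∈ S, s < p := fun s hs => by
    by_contra hcon
    exact hSJ p (hSc.out hpS hs ⟨hlow.le, not_lt.1 hcon⟩) ⟨le_rfl, hpq.le⟩
  have hyp : y ≤ p := closure_minimal (fun s hs => (hup s hs).le) (isClosed_Iic (a := p)) hy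
  obtain rfl : y = p := le_antisymm hyp hyJ.1
  have hSI : S ⊆ Icc 0 1 := by
    rintro _ ⟨x, hx, rfl⟩
    exact L.left_iterate_mem_unit h hx hj.le
  have h1 : f^[k - j] y ∈ closure (Icc y q) := by
    have hct := (h.iterate_continuousWithinAt (L.left_mem_unit hp) (m := k - j)
      fun i hi => L.left_avoids hp i (hi.trans_le (Nat.sub_le _ _))).mono hSI
    refine hct.mem_closure hy ?_
    rintro _ ⟨x, hx, rfl⟩
    rw [← Function.iterate_add_apply, Nat.sub_add_cancel hj.le]
    exact L.left_mem x hx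
  rw [isClosed_Icc.closure_eq] at h1
  exact L.left_not_mem y hp (k - j) (by omega) (by omega) h1

/-- Continuity carries limit points along: the intermediate closures miss [p, q] and hence c, so
every iterate up to the hit is continuous at y. -/
lemma closure_left_subset_hitSet (h : Expander f c) (L : Level f c p q k l) {j : ℕ} (hj0 : 0 < j)
    (hj : j < k) : closure (f^[j] '' Ico p c) ⊆ hitSet f (Icc p q) (k - j) := by
  intro y hy
  have hcJ : c ∈ Icc p q := ⟨L.left_lt.le, L.lt_right.le⟩
  have hSI : f^[j] '' Ico p c ⊆ Icc 0 1 := by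
    rintro _ ⟨x, hx, rfl⟩
    exact L.left_iterate_mem_unit h hx hj.le
  have hyI : y ∈ Icc (0 : ℝ) 1 := closure_minimal hSI isClosed_Icc hy
  have key : ∀ i ≤ k - j, (∀ i' < i, f^[i'] y ∉ Icc p q) ∧
      f^[i] y ∈ closure (f^[i + j] '' Ico p c) := by
    intro i
    induction i with
    | zero => intro _; exact ⟨fun i' hi' => absurd hi' (Nat.not_lt_zero _), by simpa using hy⟩
    | succ i ih =>
      intro hi
      obtain ⟨h1, h2⟩ := ih (by omega)
      have h3 := L.closure_left_not_mem h (by omega) (by omega) h2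
      have h4 : ∀ i' < i + 1, f^[i'] y ∉ Icc p q := fun i' hi' => by
        rcases Nat.lt_succ_iff_lt_or_eq.1 hi' with hlt | rfl
        · exact h1 i' hlt
        · exact h3
      refine ⟨h4, ?_⟩
      have hct := (h.iterate_continuousWithinAt hyI (m := i + 1)
        fun i' hi' e => h4 i' hi' (e ▸ hcJ)).mono hSI
      refine hct.mem_closure hy ?_
      rintro _ ⟨x, hx, rfl⟩
      rw [← Function.iterate_add_apply]
      exact ⟨x, hx, rfl⟩
  obtain ⟨h1, h2⟩ := key (k - j) le_rfl
  refine ⟨?_, h1⟩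
  rw [Nat.sub_add_cancel hj.le] at h2
  refine closure_minimal ?_ isClosed_Icc h2
  rintro _ ⟨x, hx, rfl⟩
  exact L.left_mem x hx

lemma closure_right_subset_hitSet (h : Expander f c) (L : Level f c p q k l) {j : ℕ} (hj0 : 0 < j)
    (hj : j < l) : closure (f^[j] '' Ioc c q) ⊆ hitSet f (Icc p q) (l - j) := by
  intro y hy
  have hy' : 1 - y ∈ closure ((Lorenz.reflect f)^[j] '' Ico (1 - q) (1 - c)) := by
    refine map_mem_closure (f := fun x : ℝ => 1 - x) (by fun_prop) hy ?_
    rintro _ ⟨x, hx, rfl⟩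
    exact ⟨1 - x, ⟨by linarith [hx.2], by linarith [hx.1]⟩,
      by rw [reflect_iterate, sub_sub_cancel]⟩
  have := L.reflect.closure_left_subset_hitSet h.reflect hj0 hj hy'
  simp only [hitSet, mem_ofPred_eq, reflect_iterate, sub_sub_cancel] at this
  have hI : ∀ x : ℝ, 1 - x ∈ Icc (1 - q) (1 - p) ↔ x ∈ Icc p q := fun x => by
    simp only [mem_Icc]; constructor <;> rintro ⟨h1, h2⟩ <;> constructor <;> linarith
  simp only [hI] at this
  exact this

/-- The pieces of the level set. -/
def piece (f : ℝ → ℝ) (c p q : ℝ) (k l : ℕ) : Fin k ⊕ Fin l → Set ℝ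
  | .inl j => closure (f^[j] '' Ico p c)
  | .inr j => closure (f^[j] '' Ioc c q)

/-- The hitting time of a piece of the level set. -/
def pieceLabel (k l : ℕ) : Fin k ⊕ Fin l → ℕ
  | .inl j => if (j : ℕ) = 0 then 0 else k - j
  | .inr j => if (j : ℕ) = 0 then 0 else l - j

lemma piece_subset_hitSet (h : Expander f c) (L : Level f c p q k l) (i : Fin k ⊕ Fin l) :
    piece f c p q k l i ⊆ hitSet f (Icc p q) (pieceLabel k l i) := by
  have h0 : ∀ y ∈ Icc p q, y ∈ hitSet f (Icc p q) 0 := fun y hy => ⟨hy, fun i hi => absurd hi (Nat.not_lt_zero i)⟩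
  rcases i with j | j <;> simp only [piece, pieceLabel]
  · split_ifs with hj
    · rw [hj, Function.iterate_zero, image_id]
      refine fun y hy => h0 y (closure_minimal ?_ isClosed_Icc hy)
      exact fun x hx => ⟨hx.1, hx.2.le.trans L.lt_right.le⟩
    · exact L.closure_left_subset_hitSet h (by omega) j.2
  · split_ifs with hj
    · rw [hj, Function.iterate_zero, image_id]
      refine fun y hy => h0 y (closure_minimal ?_ isClosed_Icc hy)
      exact fun x hx => ⟨L.left_lt.le.trans hx.1.le, hx.2⟩
    · exact L.closure_right_subset_hitSet h (by omega) j.2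

lemma level_eq (L : Level f c p q k l) (hk : ∀ x ∈ Ico p c, returnTime f (Icc p q) x = k)
    (hl : ∀ x ∈ Ioc c q, returnTime f (Icc p q) x = l) :
    level f c (Icc p q) = ⋃ i, piece f c p q k l i := by
  have e1 : Icc p q ∩ Iio c = Ico p c := by
    ext x; simp only [mem_inter_iff, mem_Icc, mem_Iio, mem_Ico]
    exact ⟨fun h => ⟨h.1.1, h.2⟩, fun h => ⟨⟨h.1, h.2.le.trans L.lt_right.le⟩, h.2⟩⟩
  have e2 : Icc p q ∩ Ioi c = Ioc c q := by
    ext x; simp only [mem_inter_iff, mem_Icc, mem_Ioi, mem_Ioc]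
    exact ⟨fun h => ⟨h.2, h.1.2⟩, fun h => ⟨⟨L.left_lt.le.trans h.1.le, h.2⟩, h.1⟩⟩
  have key : ∀ (s : Set ℝ) (r : ℕ), (∀ x ∈ s, returnTime f (Icc p q) x = r) → ∀ y,
      y ∈ cycle f (Icc p q) s ↔ ∃ j : Fin r, y ∈ closure (f^[j] '' s) := by
    intro s r hr y
    simp only [cycle, mem_iUnion]
    constructor
    · rintro ⟨j, hj⟩
      by_cases hjr : j < r
      · refine ⟨⟨j, hjr⟩, ?_⟩
        have : {x ∈ s | j < returnTime f (Icc p q) x} ⊆ s := sep_subset _ _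
        exact closure_mono (image_mono this) hj
      · have : {x ∈ s | j < returnTime f (Icc p q) x} = ∅ := by
          rw [Set.eq_empty_iff_forall_notMem]
          rintro x ⟨hx, hjx⟩
          exact hjr (hr x hx ▸ hjx)
        rw [this, image_empty, closure_empty] at hj
        exact absurd hj (notMem_empty _)
    · rintro ⟨j, hj⟩
      refine ⟨j, closure_mono (image_mono ?_) hj⟩
      exact fun x hx => ⟨hx, by rw [hr x hx]; exact j.2⟩
  ext y
  rw [level, e1, e2, mem_union, key _ k hk, key _ l hl, mem_iUnion, Sum.exists]
  rfl

end Level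

/-- The return time to an interval with return times `k` and `l` on the two sides of `c`. -/
noncomputable def ret (c : ℝ) (k l : ℕ) (x : ℝ) : ℕ := if x < c then k else l

/-- A `Level` whose return times are the first return times. -/
structure ReturnLevel (f : ℝ → ℝ) (c p q : ℝ) (k l : ℕ) : Prop extends Level f c p q k l where
  left_time : ∀ x ∈ Ico p c, returnTime f (Icc p q) x = k
  right_time : ∀ x ∈ Ioc c q, returnTime f (Icc p q) x = l

namespace Level

variable {f : ℝ → ℝ} {c p q : ℝ} {k l : ℕ}

lemma mem_cases (_L : Level f c p q k l) {x : ℝ} (hx : x ∈ Icc p q) (hc : x ≠ c) :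
    (x ∈ Ico p c ∧ ret c k l x = k) ∨ (x ∈ Ioc c q ∧ ret c k l x = l) := by
  rcases lt_or_gt_of_ne hc with h | h
  · exact Or.inl ⟨⟨hx.1, h⟩, if_pos h⟩
  · exact Or.inr ⟨⟨h, hx.2⟩, if_neg h.le.not_gt⟩

lemma ret_pos (L : Level f c p q k l) (x : ℝ) : 0 < ret c k l x := by
  unfold ret; split_ifs; exacts [L.kpos, L.lpos]

lemma iterate_ret_mem (L : Level f c p q k l) {x : ℝ} (hx : x ∈ Icc p q) (hc : x ≠ c) :
    f^[ret c k l x] x ∈ Icc p q := by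
  rcases L.mem_cases hx hc with ⟨h1, h2⟩ | ⟨h1, h2⟩ <;> rw [h2]
  exacts [L.left_mem x h1, L.right_mem x h1]

lemma not_mem_of_lt_ret (L : Level f c p q k l) {x : ℝ} (hx : x ∈ Icc p q) (hc : x ≠ c) {j : ℕ}
    (h0 : 0 < j) (hj : j < ret c k l x) : f^[j] x ∉ Icc p q := by
  rcases L.mem_cases hx hc with ⟨h1, h2⟩ | ⟨h1, h2⟩ <;> rw [h2] at hj
  exacts [L.left_not_mem x h1 j h0 hj, L.right_not_mem x h1 j h0 hj]

lemma iterate_ne_of_lt_ret (L : Level f c p q k l) {x : ℝ} (hx : x ∈ Icc p q) (hc : x ≠ c) {j : ℕ}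
    (hj : j < ret c k l x) : f^[j] x ≠ c := by
  rcases L.mem_cases hx hc with ⟨h1, h2⟩ | ⟨h1, h2⟩ <;> rw [h2] at hj
  exacts [L.left_avoids h1 j hj, L.right_avoids h1 j hj]

lemma center_mem (L : Level f c p q k l) : c ∈ Icc p q := ⟨L.left_lt.le, L.lt_right.le⟩

end Level

namespace ReturnLevel

variable {f : ℝ → ℝ} {c p q : ℝ} {k l : ℕ}

lemma level_eq' (R : ReturnLevel f c p q k l) :
    level f c (Icc p q) = ⋃ i, Level.piece f c p q k l i :=
  R.level_eq R.left_time R.right_time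

lemma isClosed_piece (f : ℝ → ℝ) (c p q : ℝ) (k l : ℕ) (i : Fin k ⊕ Fin l) :
    IsClosed (Level.piece f c p q k l i) := by
  rcases i with j | j <;> exact isClosed_closure

lemma isClosed_level (R : ReturnLevel f c p q k l) : IsClosed (level f c (Icc p q)) := by
  rw [R.level_eq']
  exact isClosed_iUnion_of_finite (isClosed_piece f c p q k l)

lemma iterate_mem_level (R : ReturnLevel f c p q k l) {x : ℝ} (hx : x ∈ Icc p q) (hc : x ≠ c)
    {j : ℕ} (hj : j < ret c k l x) : f^[j] x ∈ level f c (Icc p q) := by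
  rw [R.level_eq', mem_iUnion]
  rcases R.mem_cases hx hc with ⟨h1, h2⟩ | ⟨h1, h2⟩ <;> rw [h2] at hj
  · exact ⟨.inl ⟨j, hj⟩, subset_closure ⟨x, h1, rfl⟩⟩
  · exact ⟨.inr ⟨j, hj⟩, subset_closure ⟨x, h1, rfl⟩⟩

lemma Icc_subset_level (R : ReturnLevel f c p q k l) : Icc p q ⊆ level f c (Icc p q) := by
  have h1 : Icc p c ⊆ level f c (Icc p q) := by
    rw [← closure_Ico R.left_lt.ne]
    refine closure_minimal (fun x hx => ?_) R.isClosed_level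
    have : ret c k l x = k := if_pos hx.2
    simpa using R.iterate_mem_level (j := 0) ⟨hx.1, hx.2.le.trans R.lt_right.le⟩ hx.2.ne
      (R.ret_pos x)
  have h2 : Icc c q ⊆ level f c (Icc p q) := by
    rw [← closure_Ioc R.lt_right.ne]
    refine closure_minimal (fun x hx => ?_) R.isClosed_level
    simpa using R.iterate_mem_level (j := 0) ⟨R.left_lt.le.trans hx.1.le, hx.2⟩ hx.1.ne'
      (R.ret_pos x)
  intro x hx
  rcases le_total x c with h | h
  · exact h1 ⟨hx.1, h⟩
  · exact h2 ⟨h, hx.2⟩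

/-- `level` is contained in every closed set that contains the orbits up to the return time. -/
lemma level_subset (R : ReturnLevel f c p q k l) {X : Set ℝ} (hX : IsClosed X)
    (h : ∀ x ∈ Icc p q, x ≠ c → ∀ j < ret c k l x, f^[j] x ∈ X) : level f c (Icc p q) ⊆ X := by
  rw [R.level_eq']
  refine iUnion_subset fun i => ?_
  rcases i with j | j
  · refine closure_minimal ?_ hX
    rintro _ ⟨x, hx, rfl⟩
    have hr : ret c k l x = k := if_pos hx.2
    exact h x ⟨hx.1, hx.2.le.trans R.lt_right.le⟩ hx.2.ne j (by rw [hr]; exact j.2)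
  · refine closure_minimal ?_ hX
    rintro _ ⟨x, hx, rfl⟩
    have hr : ret c k l x = l := if_neg hx.1.le.not_gt
    exact h x ⟨R.left_lt.le.trans hx.1.le, hx.2⟩ hx.1.ne' j (by rw [hr]; exact j.2)

lemma level_subset_unit (h : Expander f c) (R : ReturnLevel f c p q k l) :
    level f c (Icc p q) ⊆ Icc 0 1 :=
  R.level_subset isClosed_Icc fun _ hx hc _ hj =>
    h.iterate_mem (R.Icc_subset hx) fun _ hi => R.iterate_ne_of_lt_ret hx hc (hi.trans hj)

/-- The level set is a finite union of closed pieces with one hitting time each, so the hitting time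
is constant on connected subsets. -/
lemma subset_hitSet (h : Expander f c) (R : ReturnLevel f c p q k l) {T : Set ℝ}
    (hT : IsPreconnected T) (hTX : T ⊆ level f c (Icc p q)) {x : ℝ} (hx : x ∈ T) {m : ℕ}
    (hm : x ∈ hitSet f (Icc p q) m) : T ⊆ hitSet f (Icc p q) m :=
  subset_of_isPreconnected_of_finite_closed (Level.pieceLabel k l) (isClosed_piece f c p q k l)
    (R.piece_subset_hitSet h) (fun _ _ => disjoint_hitSet) hT (R.level_eq' ▸ hTX) hx hm

/-- The return interval is the part of the level set with hitting time 0. -/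
lemma connectedComponentIn_level (h : Expander f c) (R : ReturnLevel f c p q k l) {z : ℝ}
    (hz : z ∈ Icc p q) : connectedComponentIn (level f c (Icc p q)) z = Icc p q := by
  apply Subset.antisymm
  · intro y hy
    have := R.subset_hitSet h isPreconnected_connectedComponentIn
      (connectedComponentIn_subset _ _) (mem_connectedComponentIn (R.Icc_subset_level hz)) (m := 0)
      ⟨hz, fun i hi => absurd hi (Nat.not_lt_zero i)⟩ hy
    exact this.1
  · exact isPreconnected_Icc.subset_connectedComponentIn hz R.Icc_subset_level

lemma isComponent_Icc (h : Expander f c) (R : ReturnLevel f c p q k l) :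
    IsComponent (Icc p q) (level f c (Icc p q)) :=
  ⟨c, R.Icc_subset_level R.center_mem, (R.connectedComponentIn_level h R.center_mem).symm⟩

variable {p' q' : ℝ} {k' l' : ℕ}

/-- After its last visit to the outer interval an orbit segment is within one outer return time. -/
lemma level_subset_level (R : ReturnLevel f c p q k l)
    (R' : ReturnLevel f c p' q' k' l') (hsub : Icc p' q' ⊆ Icc p q) :
    level f c (Icc p' q') ⊆ level f c (Icc p q) := by
  refine R'.level_subset R.isClosed_level fun x hx hc j hj => ?_
  classical
  set P : ℕ → Prop := fun i => f^[i] x ∈ Icc p q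
  have hP0 : P 0 := hsub hx
  set i := Nat.findGreatest P j with hi
  have hij : i ≤ j := Nat.findGreatest_le j
  have hPi : P i := Nat.findGreatest_spec (Nat.zero_le j) hP0
  have hic : f^[i] x ≠ c := R'.iterate_ne_of_lt_ret hx hc (hij.trans_lt hj)
  have hlt : j - i < ret c k l (f^[i] x) := by
    by_contra hcon
    have h1 := R.iterate_ret_mem hPi hic
    rw [← Function.iterate_add_apply] at h1
    have h2 := R.ret_pos (f^[i] x)
    have h3 := Nat.le_findGreatest (P := P) (n := j) (by omega) h1
    omega
  have := R.iterate_mem_level hPi hic hlt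
  rwa [← Function.iterate_add_apply, Nat.sub_add_cancel hij] at this

lemma isComponent_subset (h : Expander f c) (R : ReturnLevel f c p q k l) {T : Set ℝ}
    (hT : IsComponent T (level f c (Icc p q))) : T ⊆ Icc 0 1 ∧ T.OrdConnected := by
  obtain ⟨x, -, rfl⟩ := hT
  exact ⟨(connectedComponentIn_subset _ _).trans (R.level_subset_unit h),
    isPreconnected_connectedComponentIn.ordConnected⟩

lemma abs_sub_le_of_isPreconnected (h : Expander f c) (R : ReturnLevel f c p q k l) {B : ℝ}
    (hB : ∀ T, IsComponent T (level f c (Icc p q)) → volume.real T ≤ B) {S : Set ℝ}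
    (hS : IsPreconnected S) (hSX : S ⊆ level f c (Icc p q)) {x y : ℝ} (hx : x ∈ S) (hy : y ∈ S) :
    |x - y| ≤ B := by
  set T := connectedComponentIn (level f c (Icc p q)) x with hTdef
  have hT : IsComponent T (level f c (Icc p q)) := ⟨x, hSX hx, rfl⟩
  obtain ⟨h1, h2⟩ := R.isComponent_subset h hT
  have hST : S ⊆ T := hS.subset_connectedComponentIn hx hSX
  have hsub : uIcc y x ⊆ T := h2.uIcc_subset (hST hy) (hST hx)
  have hfin : volume T ≠ ⊤ := ((measure_mono h1).trans_lt (by simp)).ne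
  have := measureReal_mono hsub hfin
  rw [uIcc, Real.volume_real_Icc_of_le inf_le_sup, max_sub_min_eq_abs] at this
  exact this.trans (hB T hT)

end ReturnLevel

/-! ### Bounded geometry in numerical form -/

open Classical in
/-- The number of visits of the orbit of `x` to `J` before time `n`. -/
noncomputable def visits (f : ℝ → ℝ) (J : Set ℝ) (n : ℕ) (x : ℝ) : ℕ :=
  ((Finset.range n).filter fun j => f^[j] x ∈ J).card

/-- The nested return intervals of a map with bounded geometry. -/
structure Tower (f : ℝ → ℝ) (c : ℝ) (p q : ℕ → ℝ) (k l : ℕ → ℕ) (N : ℕ) (a b κ : ℝ) : Prop where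
  level : ∀ i, Level f c (p i) (q i) (k i) (l i)
  ssubset : ∀ i, Icc (p (i + 1)) (q (i + 1)) ⊂ Icc (p i) (q i)
  visits_le : ∀ i, ∀ x ∈ Icc (p (i + 1)) (q (i + 1)), x ≠ c →
    visits f (Icc (p i) (q i)) (ret c (k (i + 1)) (l (i + 1)) x) x ≤ N
  b_pos : 0 < b
  b_lt : b < 1
  left_mesh : ∀ i, ∀ x ∈ Ico (p i) c, ∀ y ∈ Ico (p i) c, ∀ j < k i, |f^[j] x - f^[j] y| ≤ b ^ i
  right_mesh : ∀ i, ∀ x ∈ Ioc c (q i), ∀ y ∈ Ioc c (q i), ∀ j < l i, |f^[j] x - f^[j] y| ≤ b ^ i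
  width : ∀ i, q i - p i ≤ b ^ i
  a_pos : 0 < a
  a_le : a ≤ 1
  κ_pos : 0 < κ
  left_scale : ∀ i, κ * a ^ i ≤ c - p i
  right_scale : ∀ i, κ * a ^ i ≤ q i - c

/-- The visits made before the return have different hitting times of the inner interval. They lie
in disjoint components of the inner level set, each of which takes up length at least δ inside [p,
q]. -/
lemma ReturnLevel.visits_mul_le {f : ℝ → ℝ} {c p q : ℝ} {k l : ℕ} {p' q' : ℝ} {k' l' : ℕ}
    (h : Expander f c) (R : ReturnLevel f c p q k l) (R' : ReturnLevel f c p' q' k' l')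
    (hsub : Icc p' q' ⊆ Icc p q) {δ : ℝ}
    (hδ : ∀ T, IsComponent T (Lorenz.level f c (Icc p' q')) → T ⊆ Icc p q → δ ≤ volume.real T)
    {x : ℝ} (hx : x ∈ Icc p' q') (hc : x ≠ c) :
    visits f (Icc p q) (ret c k' l' x) x * δ ≤ q - p := by
  classical
  set r := ret c k' l' x with hr
  set s := (Finset.range r).filter fun j => f^[j] x ∈ Icc p q with hs
  set X' := Lorenz.level f c (Icc p' q') with hX'
  set T : ℕ → Set ℝ := fun j => connectedComponentIn X' (f^[j] x) with hT
  have hmem : ∀ j ∈ s, j < r ∧ f^[j] x ∈ Icc p q := fun j hj => by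
    simpa [hs] using hj
  have hX : ∀ j < r, f^[j] x ∈ X' := fun j hj => R'.iterate_mem_level hx hc hj
  have hcomp : ∀ j ∈ s, IsComponent (T j) X' := fun j hj => ⟨_, hX j (hmem j hj).1, rfl⟩
  have hTJ : ∀ j ∈ s, T j ⊆ Icc p q := fun j hj => by
    rw [← R.connectedComponentIn_level h (hmem j hj).2]
    exact connectedComponentIn_mono _ (R.level_subset_level R' hsub)
  -- The hitting time from the j-th orbit point: 0 for j = 0, where the orbit is already inside, and
  -- r - j > 0 otherwise. It is injective in j < r.
  set m : ℕ → ℕ := fun j => if j = 0 then 0 else r - j with hm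
  have hhit : ∀ j < r, f^[j] x ∈ hitSet f (Icc p' q') (m j) := fun j hj => by
    by_cases h0 : j = 0
    · rw [hm, h0]; simp only [if_true]
      exact ⟨hx, fun i hi => absurd hi (Nat.not_lt_zero i)⟩
    · simp only [hm, if_neg h0]
      refine ⟨?_, fun i hi => ?_⟩
      · rw [← Function.iterate_add_apply, Nat.sub_add_cancel hj.le]
        exact R'.iterate_ret_mem hx hc
      · rw [← Function.iterate_add_apply]
        exact R'.not_mem_of_lt_ret hx hc (by omega) (by omega)
  have hsum := sum_measureReal_le_of_pairwiseDisjoint s T (R.left_lt.trans R.lt_right).le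
    (fun j _ => (isPreconnected_connectedComponentIn.ordConnected).measurableSet) ?_ hTJ
  · have := Finset.card_nsmul_le_sum s (fun j => volume.real (T j)) δ
      (fun j hj => hδ _ (hcomp j hj) (hTJ j hj))
    rw [nsmul_eq_mul] at this
    have e : visits f (Icc p q) r x = s.card := by
      unfold visits
      congr
    rw [e]
    exact this.trans hsum
  · intro i hi j hj hij
    have hi' := (hmem i hi).1
    have hj' := (hmem j hj).1
    have hsubH : ∀ j < r, T j ⊆ hitSet f (Icc p' q') (m j) := fun j hj =>
      R'.subset_hitSet h isPreconnected_connectedComponentIn (connectedComponentIn_subset _ _)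
        (mem_connectedComponentIn (hX j hj)) (hhit j hj)
    refine (disjoint_hitSet ?_).mono (hsubH i hi') (hsubH j hj')
    simp only [hm]
    split_ifs <;> omega

/-- The upper ratio b makes component lengths decay like b ^ i. The lower ratio a keeps the return
intervals above a multiple of a ^ i and limits the visits by 1 / a, since each one takes up a
proportion a of the interval. -/
lemma ClassLB.exists_tower {f : ℝ → ℝ} {c : ℝ} (hf : ClassLB f c) :
    ∃ p q k l N a b κ, Tower f c p q k l N a b κ := by
  obtain ⟨hcl, C, hC, K, a, b, hK, ha, hab, hb, H⟩ := hf
  have h := hcl.expander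
  -- The index i stands for C (i + 1), since the return property and bounded geometry are given from
  -- C 1 onwards.
  have hret : ∀ i, IsReturnInterval f c (C (i + 1)) := fun i => (hC.succ i).prop.1
  choose p q k l hCe hL hk hl using fun i => h.exists_level (hret i)
  have hR : ∀ i, ReturnLevel f c (p i) (q i) (k i) (l i) := fun i =>
    ⟨hL i, by rw [← hCe]; exact hk i, by rw [← hCe]; exact hl i⟩
  have hss : ∀ i, Icc (p (i + 1)) (q (i + 1)) ⊂ Icc (p i) (q i) := fun i => by
    rw [← hCe, ← hCe]; exact (hC.succ (i + 1)).prop.2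
  have H1 : ∀ i I J, IsComponent I (level f c (Icc (p i) (q i))) →
      IsComponent J (level f c (Icc (p (i + 1)) (q (i + 1)))) → J ⊆ I →
      a < volume.real J / volume.real I ∧ volume.real J / volume.real I < b := fun i => by
    rw [← hCe, ← hCe]; exact (H (i + 1) (by omega)).1
  have hpq : ∀ i, 0 < q i - p i := fun i => by linarith [(hR i).left_lt, (hR i).lt_right]
  have hvol : ∀ i, volume.real (Icc (p i) (q i)) = q i - p i := fun i =>
    Real.volume_real_Icc_of_le (by linarith [hpq i])
  have hleft : ∀ i, (q i - p i) / K ≤ c - p i := fun i => by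
    have := (H (i + 1) (by omega)).2.2.1
    have e : Icc (p i) (q i) ∩ Iio c = Ico (p i) c := by
      ext x; simp only [mem_inter_iff, mem_Icc, mem_Iio, mem_Ico]
      exact ⟨fun h => ⟨h.1.1, h.2⟩, fun h => ⟨⟨h.1, h.2.le.trans (hR i).lt_right.le⟩, h.2⟩⟩
    rw [hCe, hvol, e, Real.volume_real_Ico_of_le (hR i).left_lt.le,
      div_le_iff₀ (by linarith [(hR i).left_lt])] at this
    rw [div_le_iff₀ (by linarith)]; linarith
  have hright : ∀ i, (q i - p i) / K ≤ q i - c := fun i => by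
    have := (H (i + 1) (by omega)).2.2.2
    have e : Icc (p i) (q i) ∩ Ioi c = Ioc c (q i) := by
      ext x; simp only [mem_inter_iff, mem_Icc, mem_Ioi, mem_Ioc]
      exact ⟨fun h => ⟨h.2, h.1.2⟩, fun h => ⟨⟨(hR i).left_lt.le.trans h.1.le, h.2⟩, h.1⟩⟩
    rw [hCe, hvol, e, Real.volume_real_Ioc_of_le (hR i).lt_right.le,
      div_le_iff₀ (by linarith [(hR i).lt_right])] at this
    rw [div_le_iff₀ (by linarith)]; linarith
  have hcompsub : ∀ i T, IsComponent T (level f c (Icc (p (i + 1)) (q (i + 1)))) →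
      ∃ I, IsComponent I (level f c (Icc (p i) (q i))) ∧ T ⊆ I := by
    rintro i _ ⟨x, hx, rfl⟩
    have hsub := (hR i).level_subset_level (hR (i + 1)) (hss i).1
    exact ⟨_, ⟨x, hsub hx, rfl⟩, connectedComponentIn_mono _ hsub⟩
  have hb0 : 0 < b := ha.trans hab
  have hmesh : ∀ i T, IsComponent T (level f c (Icc (p i) (q i))) → volume.real T ≤ b ^ i := by
    intro i
    induction i with
    | zero =>
      intro T hT
      have := measureReal_mono ((hR 0).isComponent_subset h hT).1 (μ := volume) (by simp)
      rw [Real.volume_real_Icc_of_le zero_le_one] at this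
      simpa using this
    | succ i ih =>
      intro T hT
      obtain ⟨I, hI, hTI⟩ := hcompsub i T hT
      have h1 := (H1 i I T hI hT hTI).2
      have hIfin : volume I ≠ ⊤ :=
        ((measure_mono ((hR i).isComponent_subset h hI).1).trans_lt (by simp)).ne
      have h2 : volume.real T ≤ b * volume.real I := by
        rcases eq_or_lt_of_le (measureReal_nonneg (μ := volume) (s := I)) with e | hpos
        · rw [← e, mul_zero, e]; exact measureReal_mono hTI hIfin
        · rw [div_lt_iff₀ hpos] at h1; exact h1.le
      calc volume.real T ≤ b * volume.real I := h2
        _ ≤ b * b ^ i := by gcongr; exact ih I hI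
        _ = b ^ (i + 1) := by ring
  have hscale : ∀ i, (q 0 - p 0) * a ^ i ≤ q i - p i := by
    intro i
    induction i with
    | zero => simp
    | succ i ih =>
      have h1 := (H1 i _ _ ((hR i).isComponent_Icc h) ((hR (i + 1)).isComponent_Icc h) (hss i).1).1
      rw [hvol, hvol, lt_div_iff₀ (hpq i)] at h1
      calc (q 0 - p 0) * a ^ (i + 1) = a * ((q 0 - p 0) * a ^ i) := by ring
        _ ≤ a * (q i - p i) := by gcongr
        _ ≤ _ := h1.le
  obtain ⟨N, hN⟩ := exists_nat_ge (1 / a)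
  have hK0 : 0 < K := by linarith
  refine ⟨p, q, k, l, N, a, b, (q 0 - p 0) / K, ?_⟩
  refine ⟨hL, hss, ?_, hb0, hb, ?_, ?_, ?_, ha, (hab.trans hb).le, div_pos (hpq 0) hK0, ?_, ?_⟩
  · intro i x hx hc
    have h1 := (hR i).visits_mul_le h (hR (i + 1)) (hss i).1 (δ := a * (q i - p i)) (fun T hT hTs => by
      have := (H1 i _ T ((hR i).isComponent_Icc h) hT hTs).1
      rw [hvol, lt_div_iff₀ (hpq i)] at this
      exact this.le) hx hc
    have h2 : (visits f (Icc (p i) (q i)) (ret c (k (i + 1)) (l (i + 1)) x) x : ℝ) ≤ 1 / a := by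
      rw [le_div_iff₀ ha]
      refine le_of_mul_le_mul_right ?_ (hpq i)
      linarith
    exact_mod_cast h2.trans hN
  · intro i x hx y hy j hj
    refine (hR i).abs_sub_le_of_isPreconnected h (hmesh i)
      (isPreconnected_Ico.image _ ((hR i).left_continuousOn h hj.le)) ?_ ⟨x, hx, rfl⟩ ⟨y, hy, rfl⟩
    rintro _ ⟨z, hz, rfl⟩
    have hr : ret c (k i) (l i) z = k i := if_pos hz.2
    exact (hR i).iterate_mem_level ⟨hz.1, hz.2.le.trans (hR i).lt_right.le⟩ hz.2.ne
      (by rw [hr]; exact hj)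
  · intro i x hx y hy j hj
    have hcont : ContinuousOn f^[j] (Ioc c (q i)) := fun z hz =>
      (h.iterate_continuousWithinAt ((hR i).Icc_subset ⟨(hR i).left_lt.le.trans hz.1.le, hz.2⟩)
        fun n hn => (hR i).right_avoids hz n (hn.trans hj)).mono
        fun w hw => (hR i).Icc_subset ⟨(hR i).left_lt.le.trans hw.1.le, hw.2⟩
    refine (hR i).abs_sub_le_of_isPreconnected h (hmesh i)
      (isPreconnected_Ioc.image _ hcont) ?_ ⟨x, hx, rfl⟩ ⟨y, hy, rfl⟩
    rintro _ ⟨z, hz, rfl⟩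
    have hr : ret c (k i) (l i) z = l i := if_neg hz.1.le.not_gt
    exact (hR i).iterate_mem_level ⟨(hR i).left_lt.le.trans hz.1.le, hz.2⟩ hz.1.ne'
      (by rw [hr]; exact hj)
  · intro i
    rw [← hvol]
    exact hmesh i _ ((hR i).isComponent_Icc h)
  · intro i
    refine le_trans ?_ (hleft i)
    rw [div_mul_eq_mul_div]
    gcongr
    exact hscale i
  · intro i
    refine le_trans ?_ (hright i)
    rw [div_mul_eq_mul_div]
    gcongr
    exact hscale i

lemma Tower.arbitrarilySmallLevels {f : ℝ → ℝ} {c : ℝ} {p q : ℕ → ℝ} {k l : ℕ → ℕ} {N : ℕ}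
    {a b κ : ℝ} (T : Tower f c p q k l N a b κ) : ArbitrarilySmallLevels f c := fun ε hε => by
  obtain ⟨i, hi⟩ := exists_pow_lt_of_lt_one hε T.b_lt
  have h1 := T.width i
  have h2 := (T.level i).left_lt
  have h3 := (T.level i).lt_right
  exact ⟨p i, q i, k i, l i, T.level i, by linarith, by linarith⟩

/-! ### Orbit segments as sequences of return blocks -/

lemma visits_eq_sum (f : ℝ → ℝ) (J : Set ℝ) (n : ℕ) (x : ℝ) :
    visits f J n x = ∑ j ∈ Finset.range n, J.indicator (fun _ => (1 : ℕ)) (f^[j] x) := by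
  classical
  unfold visits
  rw [Finset.card_filter]
  refine Finset.sum_congr rfl fun j _ => ?_
  simp only [Set.indicator]

lemma visits_add (f : ℝ → ℝ) (J : Set ℝ) (m n : ℕ) (x : ℝ) :
    visits f J (m + n) x = visits f J m x + visits f J n (f^[m] x) := by
  rw [visits_eq_sum, visits_eq_sum, visits_eq_sum, Finset.sum_range_add]
  congr 1
  refine Finset.sum_congr rfl fun j _ => ?_
  rw [← Function.iterate_add_apply, add_comm j m]

lemma visits_eq_one {f : ℝ → ℝ} {J : Set ℝ} {n : ℕ} {x : ℝ} (hn : 0 < n) (hx : x ∈ J)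
    (h : ∀ j, 0 < j → j < n → f^[j] x ∉ J) : visits f J n x = 1 := by
  rw [visits_eq_sum, Finset.sum_eq_single_of_mem 0 (Finset.mem_range.2 hn)]
  · simp [hx]
  · intro j hj h0
    exact indicator_of_notMem (h j (Nat.pos_of_ne_zero h0) (Finset.mem_range.1 hj)) _

lemma visits_eq_zero {f : ℝ → ℝ} {J : Set ℝ} {n : ℕ} {x : ℝ}
    (h : ∀ j < n, f^[j] x ∉ J) : visits f J n x = 0 := by
  rw [visits_eq_sum]
  exact Finset.sum_eq_zero fun j hj => indicator_of_notMem (h j (Finset.mem_range.1 hj)) _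

lemma one_le_visits {f : ℝ → ℝ} {J : Set ℝ} {n j : ℕ} {x : ℝ} (hj : j < n) (hJ : f^[j] x ∈ J) :
    1 ≤ visits f J n x := by
  rw [visits_eq_sum]
  calc 1 = J.indicator (fun _ => (1 : ℕ)) (f^[j] x) := by simp [hJ]
    _ ≤ _ := Finset.single_le_sum (f := fun j => J.indicator (fun _ => (1 : ℕ)) (f^[j] x))
      (fun _ _ => Nat.zero_le _) (Finset.mem_range.2 hj)

namespace Level

variable {f : ℝ → ℝ} {c p q : ℝ} {k l : ℕ}

lemma visits_add_visits_le (_L : Level f c p q k l) (n : ℕ) (x : ℝ) :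
    visits f (Ico p c) n x + visits f (Ioc c q) n x ≤ visits f (Icc p q) n x := by
  rw [visits_eq_sum, visits_eq_sum, visits_eq_sum, ← Finset.sum_add_distrib]
  refine Finset.sum_le_sum fun j _ => ?_
  by_cases h1 : f^[j] x ∈ Ico p c
  · have h2 : f^[j] x ∉ Ioc c q := fun h => h1.2.not_gt h.1
    have h3 : f^[j] x ∈ Icc p q := ⟨h1.1, h1.2.le.trans _L.lt_right.le⟩
    simp [h1, h2, h3]
  · by_cases h2 : f^[j] x ∈ Ioc c q
    · have h3 : f^[j] x ∈ Icc p q := ⟨_L.left_lt.le.trans h2.1.le, h2.2⟩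
      simp [h1, h2, h3]
    · simp [h1, h2]

/-- Decomposition of an orbit segment between visits to a return interval into return blocks. -/
lemma block_decomposition (L : Level f c p q k l) {φ : ℝ → ℝ} {α β α' β' : ℝ}
    (hα : ∀ x ∈ Ico p c, birkhoffSum f φ k x ∈ Icc α α')
    (hβ : ∀ x ∈ Ioc c q, birkhoffSum f φ l x ∈ Icc β β') (n : ℕ) :
    ∀ x ∈ Icc p q, (∀ j < n, f^[j] x ≠ c) → f^[n] x ∈ Icc p q →
      n = visits f (Ico p c) n x * k + visits f (Ioc c q) n x * l ∧
      birkhoffSum f φ n x ∈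
        Icc (visits f (Ico p c) n x * α + visits f (Ioc c q) n x * β)
          (visits f (Ico p c) n x * α' + visits f (Ioc c q) n x * β') := by
  induction n using Nat.strong_induction_on with
  | _ n ih =>
    intro x hx hc hn
    rcases Nat.eq_zero_or_pos n with rfl | hn0
    · simp [visits]
    have hxc : x ≠ c := hc 0 hn0
    have hle : ret c k l x ≤ n := by
      by_contra hcon
      exact L.not_mem_of_lt_ret hx hxc hn0 (not_le.1 hcon) hn
    obtain ⟨m, rfl⟩ := Nat.exists_eq_add_of_le hle
    obtain ⟨h1, h2⟩ := ih m (by have := L.ret_pos x; omega) (f^[ret c k l x] x)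
      (L.iterate_ret_mem hx hxc)
      (fun j hj => by rw [← Function.iterate_add_apply]; exact hc _ (by omega))
      (by rw [← Function.iterate_add_apply, add_comm m]; exact hn)
    rw [visits_add, visits_add, birkhoffSum_add]
    have hout : ∀ j, 0 < j → j < ret c k l x → f^[j] x ∉ Icc p q := fun j h0 hj =>
      L.not_mem_of_lt_ret hx hxc h0 hj
    have hsubL : Ico p c ⊆ Icc p q := fun y hy => ⟨hy.1, hy.2.le.trans L.lt_right.le⟩
    have hsubR : Ioc c q ⊆ Icc p q := fun y hy => ⟨L.left_lt.le.trans hy.1.le, hy.2⟩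
    rcases L.mem_cases hx hxc with ⟨hxI, hr⟩ | ⟨hxI, hr⟩
    · have v1 : visits f (Ico p c) (ret c k l x) x = 1 :=
        visits_eq_one (L.ret_pos x) hxI fun j h0 hj hm => hout j h0 hj (hsubL hm)
      have v2 : visits f (Ioc c q) (ret c k l x) x = 0 := visits_eq_zero fun j hj hm => by
        rcases Nat.eq_zero_or_pos j with rfl | h0
        · exact hxI.2.not_gt hm.1
        · exact hout j h0 hj (hsubR hm)
      rw [v1, v2]
      rw [hr] at h1 h2 ⊢
      have h3 := hα x hxI
      refine ⟨by rw [zero_add, add_mul, one_mul, add_assoc, ← h1], ?_, ?_⟩ <;> push_cast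
      · linarith [h3.1, h2.1]
      · linarith [h3.2, h2.2]
    · have v2 : visits f (Ioc c q) (ret c k l x) x = 1 :=
        visits_eq_one (L.ret_pos x) hxI fun j h0 hj hm => hout j h0 hj (hsubR hm)
      have v1 : visits f (Ico p c) (ret c k l x) x = 0 := visits_eq_zero fun j hj hm => by
        rcases Nat.eq_zero_or_pos j with rfl | h0
        · exact hxI.1.not_gt hm.2
        · exact hout j h0 hj (hsubL hm)
      rw [v1, v2]
      rw [hr] at h1 h2 ⊢
      have h3 := hβ x hxI
      refine ⟨by rw [zero_add, add_mul, one_mul]; omega, ?_, ?_⟩ <;> push_cast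
      · linarith [h3.1, h2.1]
      · linarith [h3.2, h2.2]

variable {p' q' : ℝ} {k' l' : ℕ}

/-- From p' the orbit reaches the right half in k steps and needs at least l more before it can be
back in [p, q]. -/
lemma add_le_left (h : Expander f c) (L : Level f c p q k l) (L' : Level f c p' q' k' l')
    (hsub : Icc p' q' ⊂ Icc p q) : k + l ≤ k' := by
  have hx : p' ∈ Ico p' c := ⟨le_rfl, L'.left_lt⟩
  obtain ⟨h1, h2⟩ := L.left_visits h L' hsub hx
  by_contra hcon
  refine L.right_not_mem _ h2 (k' - k) (by omega) (by omega) ?_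
  rw [← Function.iterate_add_apply, Nat.sub_add_cancel h1.le]
  exact hsub.1 (L'.left_mem p' hx)

lemma add_le_right (h : Expander f c) (L : Level f c p q k l) (L' : Level f c p' q' k' l')
    (hsub : Icc p' q' ⊂ Icc p q) : k + l ≤ l' := by
  have hx : q' ∈ Ioc c q' := ⟨L'.lt_right, le_rfl⟩
  obtain ⟨h1, h2⟩ := L.right_visits h L' hsub hx
  by_contra hcon
  refine L.left_not_mem _ h2 (l' - l) (by omega) (by omega) ?_
  rw [← Function.iterate_add_apply, Nat.sub_add_cancel h1.le]
  exact hsub.1 (L'.right_mem q' hx)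

end Level

namespace Tower

variable {f : ℝ → ℝ} {c : ℝ} {p q : ℕ → ℝ} {k l : ℕ → ℕ} {N : ℕ} {a b κ : ℝ}

lemma add_le_ret (h : Expander f c) (T : Tower f c p q k l N a b κ) (i : ℕ) (x : ℝ) :
    k i + l i ≤ ret c (k (i + 1)) (l (i + 1)) x := by
  unfold ret
  split_ifs
  · exact (T.level i).add_le_left h (T.level (i + 1)) (T.ssubset i)
  · exact (T.level i).add_le_right h (T.level (i + 1)) (T.ssubset i)

/-- Both sides of a return interval are visited before the return to the next one. -/
lemma visits_bounds (h : Expander f c) (T : Tower f c p q k l N a b κ) (i : ℕ) {x : ℝ}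
    (hx : x ∈ Icc (p (i + 1)) (q (i + 1))) (hc : x ≠ c) :
    1 ≤ visits f (Ico (p i) c) (ret c (k (i + 1)) (l (i + 1)) x) x ∧
    1 ≤ visits f (Ioc c (q i)) (ret c (k (i + 1)) (l (i + 1)) x) x ∧
    visits f (Ico (p i) c) (ret c (k (i + 1)) (l (i + 1)) x) x +
      visits f (Ioc c (q i)) (ret c (k (i + 1)) (l (i + 1)) x) x ≤ N := by
  have hr := (T.level (i + 1)).ret_pos x
  have hsub := (T.ssubset i).1 hx
  refine ⟨?_, ?_, ((T.level i).visits_add_visits_le _ x).trans (T.visits_le i x hx hc)⟩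
  · rcases (T.level (i + 1)).mem_cases hx hc with ⟨hxI, e⟩ | ⟨hxI, e⟩
    · exact one_le_visits hr (j := 0) ⟨hsub.1, hxI.2⟩
    · obtain ⟨h1, h2⟩ := (T.level i).right_visits h (T.level (i + 1)) (T.ssubset i) hxI
      exact one_le_visits (by rw [e]; exact h1) h2
  · rcases (T.level (i + 1)).mem_cases hx hc with ⟨hxI, e⟩ | ⟨hxI, e⟩
    · obtain ⟨h1, h2⟩ := (T.level i).left_visits h (T.level (i + 1)) (T.ssubset i) hxI
      exact one_le_visits (by rw [e]; exact h1) h2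
    · exact one_le_visits hr (j := 0) ⟨hxI.1, hsub.2⟩

lemma ret_decomposition (T : Tower f c p q k l N a b κ) (i : ℕ) {x : ℝ} {φ : ℝ → ℝ}
    {α β α' β' : ℝ} (hα : ∀ x ∈ Ico (p i) c, birkhoffSum f φ (k i) x ∈ Icc α α')
    (hβ : ∀ x ∈ Ioc c (q i), birkhoffSum f φ (l i) x ∈ Icc β β')
    (hx : x ∈ Icc (p (i + 1)) (q (i + 1))) (hc : x ≠ c) {r A B : ℕ}
    (hr : r = ret c (k (i + 1)) (l (i + 1)) x) (hA : A = visits f (Ico (p i) c) r x)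
    (hB : B = visits f (Ioc c (q i)) r x) :
    r = A * k i + B * l i ∧ birkhoffSum f φ r x ∈ Icc (A * α + B * β) (A * α' + B * β') := by
  subst hr hA hB
  exact (T.level i).block_decomposition hα hβ _ x ((T.ssubset i).1 hx)
    (fun j hj => (T.level (i + 1)).iterate_ne_of_lt_ret hx hc hj)
    ((T.ssubset i).1 ((T.level (i + 1)).iterate_ret_mem hx hc))

/-- The return times of the two sides are comparable. -/
lemma exists_return_bounds (h : Expander f c) (T : Tower f c p q k l N a b κ) (i : ℕ) (x : ℝ)
    (hx : x ∈ Icc (p (i + 1)) (q (i + 1))) (hc : x ≠ c) :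
    ret c (k (i + 1)) (l (i + 1)) x ≤ N * (k i + l i) := by
  obtain ⟨h1, h2, h3⟩ := T.visits_bounds h i hx hc
  -- The zero function is used because only the decomposition of the return time matters.
  have hα : ∀ x ∈ Ico (p i) c, birkhoffSum f (fun _ => (0 : ℝ)) (k i) x ∈ Icc (0 : ℝ) 0 :=
    fun x _ => by simp [birkhoffSum]
  have hβ : ∀ x ∈ Ioc c (q i), birkhoffSum f (fun _ => (0 : ℝ)) (l i) x ∈ Icc (0 : ℝ) 0 :=
    fun x _ => by simp [birkhoffSum]
  obtain ⟨h4, -⟩ := T.ret_decomposition i hα hβ hx hc rfl rfl rfl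
  set A := visits f (Ico (p i) c) (ret c (k (i + 1)) (l (i + 1)) x) x
  set B := visits f (Ioc c (q i)) (ret c (k (i + 1)) (l (i + 1)) x) x
  rw [h4]
  calc A * k i + B * l i ≤ N * k i + N * l i := by gcongr <;> omega
    _ = _ := by ring

end Tower

/-! ### Contraction of averages along the tower -/

/-- The averages of `φ` over the return blocks of `[p, q]` lie in `[α, α']`. -/
def AveragesIn (f : ℝ → ℝ) (c p q : ℝ) (k l : ℕ) (φ : ℝ → ℝ) (α α' : ℝ) : Prop :=
  ∀ x ∈ Icc p q, x ≠ c →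
    birkhoffSum f φ (ret c k l x) x ∈ Icc (ret c k l x * α) (ret c k l x * α')

/-- Each of u and v has relative weight at least η, which keeps the mean at distance η * |u - v|
from both extremes. -/
lemma convex_combination_bounds {s t r η u v : ℝ} (hr : r = s + t) (hs : η * r ≤ s)
    (ht : η * r ≤ t) :
    r * (min u v + η * |u - v|) ≤ s * u + t * v ∧
      s * u + t * v ≤ r * (max u v - η * |u - v|) := by
  subst hr
  rcases le_total u v with h | h
  · rw [min_eq_left h, max_eq_right h, abs_of_nonpos (by linarith)]
    constructor <;> nlinarith
  · rw [min_eq_right h, max_eq_left h, abs_of_nonneg (by linarith)]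
    constructor <;> nlinarith

lemma abs_birkhoffSum_sub_le {f φ : ℝ → ℝ} {n : ℕ} {x y ω : ℝ}
    (h : ∀ j < n, |φ (f^[j] x) - φ (f^[j] y)| ≤ ω) :
    |birkhoffSum f φ n x - birkhoffSum f φ n y| ≤ n * ω := by
  unfold birkhoffSum
  rw [← Finset.sum_sub_distrib]
  refine (Finset.abs_sum_le_sum_abs _ _).trans ?_
  refine (Finset.sum_le_sum fun j hj => h j (Finset.mem_range.1 hj)).trans_eq ?_
  simp

lemma abs_birkhoffSum_le {f φ : ℝ → ℝ} {n : ℕ} {x M : ℝ} (h : ∀ j < n, |φ (f^[j] x)| ≤ M) :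
    |birkhoffSum f φ n x| ≤ n * M := by
  unfold birkhoffSum
  refine (Finset.abs_sum_le_sum_abs _ _).trans ?_
  refine (Finset.sum_le_sum fun j hj => h j (Finset.mem_range.1 hj)).trans_eq ?_
  simp

namespace Tower

variable {f : ℝ → ℝ} {c : ℝ} {p q : ℕ → ℝ} {k l : ℕ → ℕ} {N : ℕ} {a b κ : ℝ}

lemma two_le_N (h : Expander f c) (T : Tower f c p q k l N a b κ) : 2 ≤ N := by
  obtain ⟨h1, h2, h3⟩ := T.visits_bounds h 0 (x := p 1) ⟨le_rfl, (T.level 1).left_lt.le.trans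
    (T.level 1).lt_right.le⟩ (T.level 1).left_lt.ne
  omega

lemma left_bounds (h : Expander f c) (T : Tower f c p q k l N a b κ) (i : ℕ) :
    k i + l i ≤ k (i + 1) ∧ k (i + 1) ≤ N * (k i + l i) := by
  have L := T.level (i + 1)
  have h1 := T.add_le_ret h i (p (i + 1))
  have h2 := T.exists_return_bounds h i (p (i + 1)) ⟨le_rfl, L.left_lt.le.trans L.lt_right.le⟩
    L.left_lt.ne
  rw [ret, if_pos L.left_lt] at h1 h2
  exact ⟨h1, h2⟩

lemma right_bounds (h : Expander f c) (T : Tower f c p q k l N a b κ) (i : ℕ) :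
    k i + l i ≤ l (i + 1) ∧ l (i + 1) ≤ N * (k i + l i) := by
  have L := T.level (i + 1)
  have h1 := T.add_le_ret h i (q (i + 1))
  have h2 := T.exists_return_bounds h i (q (i + 1)) ⟨L.left_lt.le.trans L.lt_right.le, le_rfl⟩
    L.lt_right.ne'
  rw [ret, if_neg L.lt_right.le.not_gt] at h1 h2
  exact ⟨h1, h2⟩

/-- Up to the error ω, all left blocks of level i have the average u and all right blocks the
average v, since the corresponding points of two blocks are within b ^ i. A block of the next level
mixes both with weights bounded below, so the spread drops by the factor 1 - 2η, up to 2ω. -/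
lemma averages_contract (h : Expander f c) (T : Tower f c p q k l N a b κ) {i : ℕ} (hi : 1 ≤ i)
    {φ : ℝ → ℝ} {ω α α' : ℝ}
    (hω : ∀ x ∈ Icc (0 : ℝ) 1, ∀ y ∈ Icc (0 : ℝ) 1, |x - y| ≤ b ^ i → |φ x - φ y| ≤ ω)
    (hα : AveragesIn f c (p i) (q i) (k i) (l i) φ α α') :
    ∃ β β', AveragesIn f c (p (i + 1)) (q (i + 1)) (k (i + 1)) (l (i + 1)) φ β β' ∧
      β' - β ≤ (1 - 1 / (N : ℝ) ^ 2) * (α' - α) + 2 * ω := by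
  have L := T.level i
  have hN := T.two_le_N h
  have hk0 : (0 : ℝ) < k i := by exact_mod_cast L.kpos
  have hl0 : (0 : ℝ) < l i := by exact_mod_cast L.lpos
  have hp : p i ∈ Ico (p i) c := ⟨le_rfl, L.left_lt⟩
  have hq : q i ∈ Ioc c (q i) := ⟨L.lt_right, le_rfl⟩
  set u := birkhoffSum f φ (k i) (p i) / k i with hu
  set v := birkhoffSum f φ (l i) (q i) / l i with hv
  have hu' : birkhoffSum f φ (k i) (p i) = k i * u := by rw [hu]; field_simp
  have hv' : birkhoffSum f φ (l i) (q i) = l i * v := by rw [hv]; field_simp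
  have huα : u ∈ Icc α α' := by
    have := hα (p i) ⟨le_rfl, L.left_lt.le.trans L.lt_right.le⟩ L.left_lt.ne
    rw [ret, if_pos L.left_lt, hu'] at this
    exact ⟨le_of_mul_le_mul_left this.1 hk0, le_of_mul_le_mul_left this.2 hk0⟩
  have hvα : v ∈ Icc α α' := by
    have := hα (q i) ⟨L.left_lt.le.trans L.lt_right.le, le_rfl⟩ L.lt_right.ne'
    rw [ret, if_neg L.lt_right.le.not_gt, hv'] at this
    exact ⟨le_of_mul_le_mul_left this.1 hl0, le_of_mul_le_mul_left this.2 hl0⟩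
  have hleft : ∀ x ∈ Ico (p i) c,
      birkhoffSum f φ (k i) x ∈ Icc (k i * (u - ω)) (k i * (u + ω)) := fun x hx => by
    have := abs_birkhoffSum_sub_le (f := f) (φ := φ) (n := k i) (x := x) (y := p i) (ω := ω)
      fun j hj => hω _ (L.left_iterate_mem_unit h hx hj.le) _ (L.left_iterate_mem_unit h hp hj.le)
        (T.left_mesh i x hx _ hp j hj)
    rw [hu', abs_le] at this
    constructor <;> linarith [this.1, this.2]
  have hright : ∀ x ∈ Ioc c (q i),
      birkhoffSum f φ (l i) x ∈ Icc (l i * (v - ω)) (l i * (v + ω)) := fun x hx => by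
    have hmem : ∀ y ∈ Ioc c (q i), ∀ j < l i, f^[j] y ∈ Icc (0 : ℝ) 1 := fun y hy j hj =>
      h.iterate_mem (L.Icc_subset ⟨L.left_lt.le.trans hy.1.le, hy.2⟩)
        fun n hn => L.right_avoids hy n (hn.trans hj)
    have := abs_birkhoffSum_sub_le (f := f) (φ := φ) (n := l i) (x := x) (y := q i) (ω := ω)
      fun j hj => hω _ (hmem x hx j hj) _ (hmem _ hq j hj) (T.right_mesh i x hx _ hq j hj)
    rw [hv', abs_le] at this
    constructor <;> linarith [this.1, this.2]
  -- With i = j + 1, the return time r is at most N (k i + l i) and hence at most 2 N² (k j + l j),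
  -- while k i and l i are each at least k j + l j. So both weights are at least η; this comparison
  -- needs a level below i.
  set η : ℝ := 1 / (2 * (N : ℝ) ^ 2) with hη
  refine ⟨min u v + η * |u - v| - ω, max u v - η * |u - v| + ω, fun x hx hc => ?_, ?_⟩
  · set r := ret c (k (i + 1)) (l (i + 1)) x with hr
    obtain ⟨hA, hB, hAB⟩ := T.visits_bounds h i hx hc
    obtain ⟨h1, h2⟩ := T.ret_decomposition i hleft hright hx hc hr rfl rfl
    have hrle := T.exists_return_bounds h i x hx hc
    rw [← hr] at hA hB hAB hrle
    set A := visits f (Ico (p i) c) r x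
    set B := visits f (Ioc c (q i)) r x
    obtain ⟨j, rfl⟩ : ∃ j, i = j + 1 := ⟨i - 1, by omega⟩
    have b1 := T.left_bounds h j
    have b2 := T.right_bounds h j
    have hs : r ≤ 2 * N ^ 2 * (k j + l j) := by
      calc r ≤ N * (k (j + 1) + l (j + 1)) := hrle
        _ ≤ N * (N * (k j + l j) + N * (k j + l j)) := by gcongr; exacts [b1.2, b2.2]
        _ = _ := by ring
    have hN2 : (0 : ℝ) < 2 * (N : ℝ) ^ 2 := by positivity
    have hηr : η * r ≤ k j + l j := by
      rw [hη, one_div, inv_mul_le_iff₀ hN2]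
      exact_mod_cast hs
    have h1' : (r : ℝ) = A * k (j + 1) + B * l (j + 1) := by exact_mod_cast h1
    have hA' : η * r ≤ A * k (j + 1) := by
      refine hηr.trans ?_
      have : k j + l j ≤ A * k (j + 1) := b1.1.trans (Nat.le_mul_of_pos_left _ hA)
      exact_mod_cast this
    have hB' : η * r ≤ B * l (j + 1) := by
      refine hηr.trans ?_
      have : k j + l j ≤ B * l (j + 1) := b2.1.trans (Nat.le_mul_of_pos_left _ hB)
      exact_mod_cast this
    obtain ⟨c1, c2⟩ := convex_combination_bounds (u := u) (v := v) h1' hA' hB'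
    have e1 : (A : ℝ) * (k (j + 1) * (u - ω)) + B * (l (j + 1) * (v - ω)) =
      (A * k (j + 1) * u + B * l (j + 1) * v) - r * ω := by rw [h1']; ring
    have e2 : (A : ℝ) * (k (j + 1) * (u + ω)) + B * (l (j + 1) * (v + ω)) =
      (A * k (j + 1) * u + B * l (j + 1) * v) + r * ω := by rw [h1']; ring
    rw [e1, e2] at h2
    constructor
    · linarith [h2.1]
    · linarith [h2.2]
  · have hd : |u - v| ≤ α' - α := by
      rw [abs_le]; constructor <;> linarith [huα.1, huα.2, hvα.1, hvα.2]
    have he : max u v - min u v = |u - v| := by rw [max_sub_min_eq_abs, abs_sub_comm]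
    have hη1 : 0 ≤ 1 - 1 / (N : ℝ) ^ 2 := by
      rw [sub_nonneg, div_le_one (by positivity)]
      have : (1 : ℝ) ≤ N := by exact_mod_cast (by omega : 1 ≤ N)
      exact one_le_pow₀ this
    have h2η : 1 / (N : ℝ) ^ 2 = 2 * η := by rw [hη]; field_simp
    have := mul_le_mul_of_nonneg_left hd hη1
    rw [h2η] at this ⊢
    linarith

/-- With ω = η * ε / 4 the recursion s ↦ (1 - η) * s + 2 * ω for the spread has the fixed point ε /
2, and uniform continuity makes ω admissible at all high levels. -/
lemma exists_averages (h : Expander f c) (T : Tower f c p q k l N a b κ) {φ : ℝ → ℝ}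
    (hφ : ContinuousOn φ (Icc 0 1)) {ε : ℝ} (hε : 0 < ε) :
    ∃ i v, ∀ x ∈ Icc (p i) (q i), x ≠ c →
      |birkhoffSum f φ (ret c (k i) (l i) x) x - ret c (k i) (l i) x * v| ≤
        ret c (k i) (l i) x * ε := by
  have hN := T.two_le_N h
  have hNR : (2 : ℝ) ≤ N := by exact_mod_cast hN
  obtain ⟨M, hM⟩ := isCompact_Icc.exists_bound_of_continuousOn hφ
  set η : ℝ := 1 / (N : ℝ) ^ 2 with hη
  have hη0 : 0 < η := by positivity
  have hη1 : η < 1 := by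
    rw [hη, div_lt_one (by positivity)]
    nlinarith
  set ω : ℝ := η * ε / 4 with hω
  have hω0 : 0 < ω := by positivity
  obtain ⟨δ, hδ, hu⟩ := Metric.uniformContinuousOn_iff_le.1
    (isCompact_Icc.uniformContinuousOn_of_continuous hφ) ω hω0
  obtain ⟨I, hI⟩ := exists_pow_lt_of_lt_one hδ T.b_lt
  have key : ∀ n : ℕ, ∃ β β', AveragesIn f c (p (I + 1 + n)) (q (I + 1 + n)) (k (I + 1 + n))
      (l (I + 1 + n)) φ β β' ∧ β' - β ≤ (1 - η) ^ n * (2 * M) + ε / 2 := by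
    intro n
    induction n with
    | zero =>
      refine ⟨-M, M, fun x hx hc => ?_, by simp; linarith⟩
      have L := T.level (I + 1 + 0)
      have := abs_birkhoffSum_le (f := f) (φ := φ) (n := ret c (k (I + 1 + 0)) (l (I + 1 + 0)) x)
        (x := x) (M := M) fun j hj => by
          simpa using hM _ (h.iterate_mem (L.Icc_subset hx)
            fun n hn => L.iterate_ne_of_lt_ret hx hc (hn.trans hj))
      rw [abs_le] at this
      constructor <;> linarith [this.1, this.2]
    | succ n ih =>
      obtain ⟨β, β', h1, h2⟩ := ih
      obtain ⟨γ, γ', h3, h4⟩ := T.averages_contract h (i := I + 1 + n) (by omega) (ω := ω)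
        (fun x hx y hy hxy => by
          refine hu x hx y hy (hxy.trans (le_trans ?_ hI.le))
          exact pow_le_pow_of_le_one T.b_pos.le T.b_lt.le (by omega)) h1
      refine ⟨γ, γ', h3, h4.trans ?_⟩
      have := mul_le_mul_of_nonneg_left h2 (sub_nonneg.2 hη1.le)
      rw [← hη]
      rw [pow_succ]
      have e : 2 * ω = η * (ε / 2) := by rw [hω]; ring
      rw [e]
      linarith
  have hlim : Tendsto (fun n : ℕ => (1 - η) ^ n * (2 * M) + ε / 2) atTop (𝓝 (0 * (2 * M) + ε / 2)) :=
    ((tendsto_pow_atTop_nhds_zero_of_lt_one (by linarith) (by linarith)).mul_const _).add_const _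
  obtain ⟨n, hn⟩ := (hlim.eventually_lt_const (u := ε) (by linarith)).exists
  obtain ⟨β, β', h1, h2⟩ := key n
  refine ⟨I + 1 + n, β, fun x hx hc => ?_⟩
  obtain ⟨h3, h4⟩ := h1 x hx hc
  set r := ret c (k (I + 1 + n)) (l (I + 1 + n)) x
  have hr0 : (0 : ℝ) ≤ r := Nat.cast_nonneg _
  rw [abs_le]
  have := mul_le_mul_of_nonneg_left (h2.trans hn.le) hr0
  constructor
  · have := mul_nonneg hr0 hε.le; linarith
  · linarith

end Tower

/-- Control of return blocks gives control of orbit segments. -/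
lemma Level.abs_birkhoffSum_sub_le {f : ℝ → ℝ} {c p q : ℝ} {k l : ℕ} (h : Expander f c)
    (L : Level f c p q k l)
    {φ : ℝ → ℝ} {v ε M : ℝ} (hM : ∀ x ∈ Icc (0 : ℝ) 1, |φ x| ≤ M) (hε : 0 ≤ ε)
    (hv : ∀ x ∈ Icc p q, x ≠ c →
      |birkhoffSum f φ (ret c k l x) x - ret c k l x * v| ≤ ret c k l x * ε) (n : ℕ) :
    ∀ x ∈ Icc p q, (∀ j, f^[j] x ≠ c) →
      |birkhoffSum f φ n x - n * v| ≤ n * ε + (k + l) * (M + |v|) := by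
  have hM0 : 0 ≤ M := (abs_nonneg _).trans (hM 0 ⟨le_rfl, zero_le_one⟩)
  induction n using Nat.strong_induction_on with
  | _ n ih =>
    intro x hx hc
    have hxc : x ≠ c := hc 0
    rcases lt_or_ge n (ret c k l x) with hlt | hle
    -- An incomplete last block has at most k + l steps and produces the additive constant.
    · have h1 := abs_birkhoffSum_le (f := f) (φ := φ) (n := n) (x := x) (M := M) fun j _ =>
        hM _ (h.iterate_mem (L.Icc_subset hx) fun i _ => hc i)
      have h2 : (n : ℝ) ≤ k + l := by
        have : ret c k l x ≤ k + l := by unfold ret; split_ifs <;> omega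
        exact_mod_cast hlt.le.trans this
      calc |birkhoffSum f φ n x - n * v| ≤ |birkhoffSum f φ n x| + |n * v| := abs_sub _ _
        _ ≤ n * M + n * |v| := by rw [abs_mul, Nat.abs_cast]; gcongr
        _ = n * (M + |v|) := by ring
        _ ≤ (k + l) * (M + |v|) := by gcongr
        _ ≤ _ := le_add_of_nonneg_left (by positivity)
    · obtain ⟨m, rfl⟩ := Nat.exists_eq_add_of_le hle
      have h1 := ih m (by have := L.ret_pos x; omega) _ (L.iterate_ret_mem hx hxc)
        (fun j => by rw [← Function.iterate_add_apply]; exact hc _)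
      have h2 := hv x hx hxc
      rw [birkhoffSum_add]
      push_cast
      rw [abs_le] at h1 h2 ⊢
      constructor <;> linarith [h1.1, h1.2, h2.1, h2.2]

/-! ### Good points and their common limits -/

/-- A point is good if its orbit avoids the singular point and enters all return intervals. -/
structure IsGood (f : ℝ → ℝ) (c : ℝ) (p q : ℕ → ℝ) (x : ℝ) : Prop where
  mem : x ∈ Icc (0 : ℝ) 1
  ne : ∀ j, f^[j] x ≠ c
  enters : ∀ i, ∃ m, f^[m] x ∈ Icc (p i) (q i)

namespace Tower

variable {f : ℝ → ℝ} {c : ℝ} {p q : ℕ → ℝ} {k l : ℕ → ℕ} {N : ℕ} {a b κ : ℝ}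

/-- The number v comes from the block averages alone, hence is the same for all orbits; the steps
before the entrance into the return interval are negligible. -/
lemma exists_forall_eventually (h : Expander f c) (T : Tower f c p q k l N a b κ) {φ : ℝ → ℝ}
    (hφ : ContinuousOn φ (Icc 0 1)) {ε : ℝ} (hε : 0 < ε) :
    ∃ v, ∀ x, IsGood f c p q x → ∀ᶠ n : ℕ in atTop, |birkhoffSum f φ n x - n * v| ≤ n * ε := by
  obtain ⟨i, v, hv⟩ := T.exists_averages h hφ (half_pos hε)
  obtain ⟨M, hM⟩ := isCompact_Icc.exists_bound_of_continuousOn hφ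
  refine ⟨v, fun x hx => ?_⟩
  obtain ⟨m, hm⟩ := hx.enters i
  set C : ℝ := (k i + l i) * (M + |v|) with hC
  set D : ℝ := |birkhoffSum f φ m x - m * v| with hD
  have hlarge : ∀ᶠ n : ℕ in atTop, (C + D) / (ε / 2) ≤ n :=
    tendsto_natCast_atTop_atTop.eventually_ge_atTop _
  filter_upwards [hlarge, eventually_ge_atTop m] with n h1 h2
  obtain ⟨n, rfl⟩ := Nat.exists_eq_add_of_le h2
  rw [div_le_iff₀ (by positivity)] at h1
  have h3 := (T.level i).abs_birkhoffSum_sub_le h (fun x hx => by simpa using hM x hx)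
    (half_pos hε).le hv n _ hm (fun j => by rw [← Function.iterate_add_apply]; exact hx.ne _)
  rw [birkhoffSum_add]
  have h4 : |birkhoffSum f φ m x - m * v| ≤ D := le_rfl
  push_cast at h1 ⊢
  have h5 : 0 ≤ (m : ℝ) * ε := by positivity
  rw [abs_le] at h3 h4 ⊢
  constructor <;> linarith [h3.1, h3.2, h4.1, h4.2]

/-- The averages of a continuous function have the same limit along all good orbits. -/
lemma exists_limit (h : Expander f c) (T : Tower f c p q k l N a b κ) {φ : ℝ → ℝ}
    (hφ : ContinuousOn φ (Icc 0 1)) :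
    ∃ v, ∀ x, IsGood f c p q x →
      Tendsto (fun n : ℕ => birkhoffSum f φ n x / n) atTop (𝓝 v) := by
  by_cases hne : ∃ x, IsGood f c p q x
  swap
  · exact ⟨0, fun x hx => absurd ⟨x, hx⟩ hne⟩
  obtain ⟨x₀, hx₀⟩ := hne
  have key : ∀ ε > 0, ∃ v, ∀ x, IsGood f c p q x →
      ∀ᶠ n : ℕ in atTop, |birkhoffSum f φ n x / n - v| ≤ ε := fun ε hε => by
    obtain ⟨v, hv⟩ := T.exists_forall_eventually h hφ hε
    refine ⟨v, fun x hx => ?_⟩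
    filter_upwards [hv x hx, eventually_gt_atTop 0] with n hn hn0
    have hn0' : (0 : ℝ) < n := by exact_mod_cast hn0
    have e : birkhoffSum f φ n x / n - v = (birkhoffSum f φ n x - n * v) / n := by field_simp
    rw [e, abs_div, Nat.abs_cast, div_le_iff₀ hn0']
    linarith
  -- The approximate limits depend on ε, and a single good orbit shows that they converge.
  have hcauchy : CauchySeq fun n : ℕ => birkhoffSum f φ n x₀ / n := by
    rw [Metric.cauchySeq_iff']
    intro ε hε
    obtain ⟨v, hv⟩ := key (ε / 3) (by positivity)
    obtain ⟨n₀, hn₀⟩ := eventually_atTop.1 (hv x₀ hx₀)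
    refine ⟨n₀, fun n hn => ?_⟩
    have h1 := hn₀ n hn
    have h2 := hn₀ n₀ le_rfl
    rw [Real.dist_eq]
    rw [abs_le] at h1 h2
    rw [abs_lt]
    constructor <;> linarith [h1.1, h1.2, h2.1, h2.2]
  obtain ⟨v, hv⟩ := cauchySeq_tendsto_of_complete hcauchy
  refine ⟨v, fun x hx => ?_⟩
  rw [Metric.tendsto_nhds]
  intro ε hε
  obtain ⟨w, hw⟩ := key (ε / 4) (by positivity)
  have hvw : |v - w| ≤ ε / 4 := by
    refine le_of_tendsto ((hv.sub_const w).abs) (hw x₀ hx₀)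
  filter_upwards [hw x hx] with n hn
  rw [Real.dist_eq]
  rw [abs_le] at hvw hn
  rw [abs_lt]
  constructor <;> linarith [hvw.1, hvw.2, hn.1, hn.2]

end Tower

/-- Induction on the time, as f is injective on each side of c. -/
lemma Expander.countable_preimage_singular {f : ℝ → ℝ} {c : ℝ} (h : Expander f c) (n : ℕ) :
    {x ∈ Icc (0 : ℝ) 1 | f^[n] x = c ∧ ∀ j < n, f^[j] x ≠ c}.Countable := by
  induction n with
  | zero => exact (countable_singleton c).mono fun x hx => hx.2.1
  | succ n ih =>
    set P := {x ∈ Icc (0 : ℝ) 1 | f^[n] x = c ∧ ∀ j < n, f^[j] x ≠ c}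
    set Q := {x ∈ Icc (0 : ℝ) 1 | f^[n + 1] x = c ∧ ∀ j < n + 1, f^[j] x ≠ c}
    have hQ : ∀ x ∈ Q, x ≠ c ∧ f x ∈ P := fun x hx => by
      have hxc : x ≠ c := hx.2.2 0 (Nat.succ_pos n)
      refine ⟨hxc, h.mapsTo x hx.1 hxc, hx.2.1, fun j hj => ?_⟩
      exact hx.2.2 (j + 1) (by omega)
    have h1 : (Q ∩ Iio c).Countable := by
      refine countable_of_injective_of_countable_image (f := f) ?_
        (ih.mono (by rintro _ ⟨x, hx, rfl⟩; exact (hQ x hx.1).2))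
      have : StrictMonoOn f (Q ∩ Iio c) := fun x hx y hy hxy =>
        h.mono x y hx.1.1.1 hy.1.1.2 (fun hc => (mem_Iio.1 hy.2).not_ge hc.2) hxy
      exact this.injOn
    have h2 : (Q ∩ Ioi c).Countable := by
      refine countable_of_injective_of_countable_image (f := f) ?_
        (ih.mono (by rintro _ ⟨x, hx, rfl⟩; exact (hQ x hx.1).2))
      have : StrictMonoOn f (Q ∩ Ioi c) := fun x hx y hy hxy =>
        h.mono x y hx.1.1.1 hy.1.1.2 (fun hc => (mem_Ioi.1 hx.2).not_ge hc.1) hxy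
      exact this.injOn
    refine (h1.union h2).mono fun x hx => ?_
    rcases lt_or_gt_of_ne (hQ x hx).1 with hlt | hlt
    exacts [Or.inl ⟨hx, hlt⟩, Or.inr ⟨hx, hlt⟩]

lemma Expander.countable_irregular {f : ℝ → ℝ} {c : ℝ} (h : Expander f c) :
    {x ∈ Icc (0 : ℝ) 1 | ∃ n, f^[n] x = c}.Countable := by
  refine (countable_iUnion h.countable_preimage_singular).mono fun x hx => ?_
  classical
  exact mem_iUnion.2 ⟨Nat.find hx.2, hx.1, Nat.find_spec hx.2, fun j hj => Nat.find_min hx.2 hj⟩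

namespace Tower

variable {f : ℝ → ℝ} {c : ℝ} {p q : ℕ → ℝ} {k l : ℕ → ℕ} {N : ℕ} {a b κ : ℝ}

/-- Almost every point is good. -/
lemma volume_not_isGood (h : Expander f c) (T : Tower f c p q k l N a b κ) :
    volume (Icc (0 : ℝ) 1 \ {x | IsGood f c p q x}) = 0 := by
  have h1 : volume (⋃ i, {x | x ∈ Ioo (0 : ℝ) 1 ∧ ∀ j, f^[j] x ∉ Ioo (p i) (q i)}) = 0 :=
    measure_iUnion_null fun i => h.volume_not_enters_eq_zero T.arbitrarilySmallLevels (T.level i)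
  have h2 := h.countable_irregular.measure_zero volume
  have h3 : volume ({0, 1} : Set ℝ) = 0 := (toFinite _).measure_zero _
  refine measure_mono_null ?_ (measure_union_null (measure_union_null h1 h2) h3)
  intro x hx
  by_contra hcon
  simp only [mem_union, mem_iUnion, not_or, not_exists] at hcon
  obtain ⟨⟨c1, c2⟩, c3⟩ := hcon
  have hx01 : x ∈ Ioo (0 : ℝ) 1 := by
    refine ⟨lt_of_le_of_ne hx.1.1 fun e => c3 (Or.inl e.symm), lt_of_le_of_ne hx.1.2 fun e =>
      c3 (Or.inr e)⟩
  refine hx.2 ⟨hx.1, fun j e => c2 ⟨hx.1, j, e⟩, fun i => ?_⟩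
  by_contra hno
  push Not at hno
  exact c1 i ⟨hx01, fun j hj => hno j (Ioo_subset_Icc_self hj)⟩

lemma lt_left (h : Expander f c) (T : Tower f c p q k l N a b κ) (i : ℕ) : i < k i := by
  induction i with
  | zero => exact (T.level 0).kpos
  | succ i ih =>
    have := (T.left_bounds h i).1
    have := (T.level i).lpos
    omega

lemma lt_right (h : Expander f c) (T : Tower f c p q k l N a b κ) (i : ℕ) : i < l i := by
  induction i with
  | zero => exact (T.level 0).lpos
  | succ i ih =>
    have := (T.right_bounds h i).1
    have := (T.level i).kpos
    omega

/-- The left critical value returns to each small return interval just before the return time of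
its left side. -/
lemma left_value_mem_hitSet (h : Expander f c) (T : Tower f c p q k l N a b κ) {w : ℝ}
    (hw : Tendsto f (𝓝[<] c) (𝓝 w)) {i : ℕ} (hi : 1 ≤ i) :
    w ∈ hitSet f (Icc (p i) (q i)) (k i - 1) := by
  have L := T.level i
  refine L.closure_left_subset_hitSet h one_pos (hi.trans_lt (T.lt_left h i)) ?_
  refine mem_closure_of_tendsto hw ?_
  filter_upwards [Ico_mem_nhdsLT L.left_lt] with x hx
  exact ⟨x, hx, rfl⟩

lemma right_value_mem_hitSet (h : Expander f c) (T : Tower f c p q k l N a b κ) {w : ℝ}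
    (hw : Tendsto f (𝓝[>] c) (𝓝 w)) {i : ℕ} (hi : 1 ≤ i) :
    w ∈ hitSet f (Icc (p i) (q i)) (l i - 1) := by
  have L := T.level i
  refine L.closure_right_subset_hitSet h one_pos (hi.trans_lt (T.lt_right h i)) ?_
  refine mem_closure_of_tendsto hw ?_
  filter_upwards [Ioc_mem_nhdsGT L.lt_right] with x hx
  exact ⟨x, hx, rfl⟩

/-- A point whose hitting times of the return intervals tend to infinity is good. -/
lemma isGood_of_mem_hitSet (T : Tower f c p q k l N a b κ) {w : ℝ} (hw : w ∈ Icc (0 : ℝ) 1)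
    {t : ℕ → ℕ} (ht : ∀ i, i ≤ t i)
    (hh : ∀ i, 1 ≤ i → w ∈ hitSet f (Icc (p i) (q i)) (t i)) : IsGood f c p q w := by
  refine ⟨hw, fun j e => ?_, fun i => ⟨t (i + 1), (T.ssubset i).1 (hh (i + 1) (by omega)).1⟩⟩
  -- The interval of level j + 1 contains c but is not hit before time j + 1, so c is not hit at
  -- time j.
  refine (hh (j + 1) (by omega)).2 j (ht (j + 1)) ?_
  rw [e]
  exact (T.level _).center_mem

lemma isGood_left (h : Expander f c) (T : Tower f c p q k l N a b κ) {w : ℝ}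
    (hw : Tendsto f (𝓝[<] c) (𝓝 w)) : IsGood f c p q w := by
  refine T.isGood_of_mem_hitSet ?_ (t := fun i => k i - 1) (fun i => ?_)
    fun i hi => T.left_value_mem_hitSet h hw hi
  · refine isClosed_Icc.mem_of_tendsto hw ?_
    filter_upwards [Ico_mem_nhdsLT h.pos] with x hx
    exact h.mapsTo x ⟨hx.1, hx.2.le.trans h.lt_one.le⟩ hx.2.ne
  · have := T.lt_left h i; omega

lemma isGood_right (h : Expander f c) (T : Tower f c p q k l N a b κ) {w : ℝ}
    (hw : Tendsto f (𝓝[>] c) (𝓝 w)) : IsGood f c p q w := by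
  refine T.isGood_of_mem_hitSet ?_ (t := fun i => l i - 1) (fun i => ?_)
    fun i hi => T.right_value_mem_hitSet h hw hi
  · refine isClosed_Icc.mem_of_tendsto hw ?_
    filter_upwards [Ioc_mem_nhdsGT h.lt_one] with x hx
    exact h.mapsTo x ⟨h.pos.le.trans hx.1.le, hx.2⟩ hx.1.ne'
  · have := T.lt_right h i; omega

end Tower

/-! ### The limit measure -/

open CompactlySupported in
/-- Riesz representation of the limit of averages along an orbit. -/
lemma exists_measure_of_averages {f : ℝ → ℝ} {x : ℝ} (hx : ∀ j, f^[j] x ∈ Icc (0 : ℝ) 1)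
    (hlim : ∀ φ : ℝ → ℝ, ContinuousOn φ (Icc 0 1) →
      ∃ v, Tendsto (fun n : ℕ => birkhoffSum f φ n x / n) atTop (𝓝 v)) :
    ∃ μ : Measure ℝ, IsProbabilityMeasure μ ∧ μ (Icc 0 1)ᶜ = 0 ∧
      ∀ φ : ℝ → ℝ, ContinuousOn φ (Icc 0 1) → Integrable φ μ ∧
        Tendsto (fun n : ℕ => birkhoffSum f φ n x / n) atTop (𝓝 (∫ y, φ y ∂μ)) := by
  set X := Icc (0 : ℝ) 1
  -- Functions on [0, 1] are extended by constants beyond the ends so that Birkhoff sums over ℝ make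
  -- sense; the orbit never sees the extension.
  let ext : C_c(X, ℝ) → ℝ → ℝ := fun g => IccExtend (zero_le_one' ℝ) g
  have hext : ∀ g : C_c(X, ℝ), ContinuousOn (ext g) (Icc 0 1) := fun g =>
    (g.continuous.Icc_extend').continuousOn
  choose Λ hΛ using fun g : C_c(X, ℝ) => hlim (ext g) (hext g)
  let ΛL : C_c(X, ℝ) →ₗ[ℝ] ℝ :=
    { toFun := Λ
      map_add' := fun g₁ g₂ => by
        refine tendsto_nhds_unique (hΛ (g₁ + g₂)) (((hΛ g₁).add (hΛ g₂)).congr fun n => ?_)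
        rw [← add_div, birkhoffSum, birkhoffSum, birkhoffSum, ← Finset.sum_add_distrib]
        rfl
      map_smul' := fun r g => by
        refine tendsto_nhds_unique (hΛ (r • g)) (((hΛ g).const_mul r).congr fun n => ?_)
        rw [← mul_div_assoc, birkhoffSum, birkhoffSum, Finset.mul_sum]
        rfl }
  let ΛP : C_c(X, ℝ) →ₚ[ℝ] ℝ := PositiveLinearMap.mk₀ ΛL fun g hg => by
    refine ge_of_tendsto (hΛ g) (Eventually.of_forall fun n => ?_)
    exact div_nonneg (Finset.sum_nonneg fun j _ => hg _) (Nat.cast_nonneg n)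
  set ν := RealRMK.rieszMeasure ΛP with hν
  have key : ∀ φ : ℝ → ℝ, ContinuousOn φ (Icc 0 1) →
      Tendsto (fun n : ℕ => birkhoffSum f φ n x / n) atTop (𝓝 (∫ y : X, φ y ∂ν)) := by
    intro φ hφ
    let g : C_c(X, ℝ) := ⟨⟨fun y => φ y, continuousOn_iff_continuous_domRestrict.1 hφ⟩,
      HasCompactSupport.of_compactSpace _⟩
    have h1 := hΛ g
    have h2 : ∫ y : X, g y ∂ν = Λ g := RealRMK.integral_rieszMeasure ΛP g
    rw [← h2] at h1
    refine h1.congr fun n => ?_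
    congr 1
    refine Finset.sum_congr rfl fun j _ => ?_
    exact (IccExtend_of_mem (zero_le_one' ℝ) g (hx j))
  have hme : MeasurableEmbedding (Subtype.val : X → ℝ) :=
    MeasurableEmbedding.subtype_coe measurableSet_Icc
  have hfin : IsFiniteMeasure ν := inferInstance
  have hone : ν.real univ = 1 := by
    have h1 := key (fun _ => 1) continuousOn_const
    rw [integral_const, smul_eq_mul, mul_one] at h1
    refine tendsto_nhds_unique h1 (tendsto_const_nhds.congr' ?_)
    filter_upwards [eventually_gt_atTop 0] with n hn
    have : (n : ℝ) ≠ 0 := by exact_mod_cast hn.ne'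
    simp [birkhoffSum, this]
  have hprob : IsProbabilityMeasure ν := ⟨by
    rw [← ENNReal.toReal_eq_one_iff]; exact hone⟩
  refine ⟨ν.map Subtype.val, Measure.isProbabilityMeasure_map measurable_subtype_coe.aemeasurable,
    ?_, fun φ hφ => ⟨?_, ?_⟩⟩
  · rw [Measure.map_apply measurable_subtype_coe measurableSet_Icc.compl]
    have : (Subtype.val : X → ℝ) ⁻¹' (Icc 0 1)ᶜ = ∅ := by
      ext y; simp
    rw [this, measure_empty]
  · rw [hme.integrable_map_iff]
    exact (continuousOn_iff_continuous_domRestrict.1 hφ).integrable_of_hasCompactSupport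
      (HasCompactSupport.of_compactSpace _)
  · rw [hme.integral_map]
    exact key φ hφ

/-- One good orbit defines the measure, and it serves all good orbits because their limits agree. -/
lemma Tower.exists_measure {f : ℝ → ℝ} {c : ℝ} {p q : ℕ → ℝ} {k l : ℕ → ℕ} {N : ℕ} {a b κ : ℝ}
    (h : Expander f c) (T : Tower f c p q k l N a b κ) {w : ℝ} (hw : IsGood f c p q w) :
    ∃ μ : Measure ℝ, IsProbabilityMeasure μ ∧ μ (Icc 0 1)ᶜ = 0 ∧
      ∀ φ : ℝ → ℝ, ContinuousOn φ (Icc 0 1) → Integrable φ μ ∧ ∀ x, IsGood f c p q x →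
        Tendsto (fun n : ℕ => birkhoffSum f φ n x / n) atTop (𝓝 (∫ y, φ y ∂μ)) := by
  obtain ⟨μ, h1, h2, h3⟩ := exists_measure_of_averages (f := f) (x := w)
    (fun j => h.iterate_mem hw.mem fun i _ => hw.ne i)
    fun φ hφ => (T.exists_limit h hφ).imp fun v hv => hv w hw
  refine ⟨μ, h1, h2, fun φ hφ => ⟨(h3 φ hφ).1, fun x hx => ?_⟩⟩
  obtain ⟨v, hv⟩ := T.exists_limit h hφ
  rw [tendsto_nhds_unique (h3 φ hφ).2 (hv w hw)]
  exact hv x hx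

/-! ### Non-flatness and the chain rule -/

/-- Expansion bounds for a diffeomorphism between compact intervals. -/
lemma IsC3Diffeo.exists_bounds {φ : ℝ → ℝ} {A B T z : ℝ} (hφ : IsC3Diffeo φ (Icc A B) (Icc 0 T))
    (hAB : A < B) (hz : z ∈ Icc A B) (hφz : φ z = 0) :
    ∃ G > 0, ∀ x ∈ Icc A B, |x - z| ≤ G * φ x ∧ 1 ≤ G * |derivWithin φ (Icc A B) x| := by
  obtain ⟨h1, h2, g, h3, h4, h5, -⟩ := hφ
  have hA : A ∈ Icc A B := ⟨le_rfl, hAB.le⟩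
  have hB : B ∈ Icc A B := ⟨hAB.le, le_rfl⟩
  have hT : 0 < T := by
    by_contra hT
    have h0 : ∀ x ∈ Icc A B, φ x = 0 := fun x hx =>
      le_antisymm ((h2 hx).2.trans (not_lt.1 hT)) (h2 hx).1
    have := (h5 hA).symm.trans ((congrArg g ((h0 A hA).trans (h0 B hB).symm)).trans (h5 hB))
    exact hAB.ne this
  have hd : DifferentiableOn ℝ g (Icc 0 T) := h3.differentiableOn (by norm_num)
  obtain ⟨G, hG⟩ := isCompact_Icc.exists_bound_of_continuousOn
    (h3.continuousOn_derivWithin (uniqueDiffOn_Icc hT) (by norm_num))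
  have hG' : ∀ y ∈ Icc 0 T, ‖derivWithin g (Icc 0 T) y‖ ≤ |G| + 1 := fun y hy =>
    (hG y hy).trans ((le_abs_self G).trans (by linarith))
  refine ⟨|G| + 1, by positivity, fun x hx => ⟨?_, ?_⟩⟩
  · have := (convex_Icc 0 T).norm_image_sub_le_of_norm_derivWithin_le hd hG' (h2 hz) (h2 hx)
    rw [h5 hx, h5 hz, hφz, sub_zero, Real.norm_eq_abs, Real.norm_of_nonneg (h2 hx).1] at this
    exact this
  · have e1 : HasDerivWithinAt φ (derivWithin φ (Icc A B) x) (Icc A B) x :=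
      ((h1.differentiableOn (by norm_num)) x hx).hasDerivWithinAt
    have e2 : HasDerivWithinAt g (derivWithin g (Icc 0 T) (φ x)) (Icc 0 T) (φ x) :=
      (hd _ (h2 hx)).hasDerivWithinAt
    have e3 := e2.comp x e1 h2
    have e4 : HasDerivWithinAt (g ∘ φ) 1 (Icc A B) x :=
      (hasDerivWithinAt_id x _).congr (fun y hy => h5 hy) (h5 hx)
    have e5 := (uniqueDiffOn_Icc hAB x hx).eq_deriv _ e3 e4
    have e6 := congrArg abs e5
    rw [abs_mul, abs_one] at e6
    exact e6.symm.le.trans (mul_le_mul_of_nonneg_right (hG' _ (h2 hx)) (abs_nonneg _))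

/-- Here |Df| = α φ^(α-1) |φ'|, and the diffeomorphism satisfies φ ≥ |x - z| / G and |φ'| ≥ 1 / G.
-/
lemma exists_le_abs_derivWithin_of_rpow {f φ : ℝ → ℝ} {S : Set ℝ} {A B T z e σ α : ℝ}
    (hφ : IsC3Diffeo φ (Icc A B) (Icc 0 T)) (hAB : A < B) (hz : z ∈ Icc A B) (hφz : φ z = 0)
    (hα : 1 < α) (hσ : |σ| = 1) (hS : dom A B z ⊆ S) (hd : DifferentiableOn ℝ f S)
    (hf : ∀ x ∈ dom A B z, f x = e + σ * φ x ^ α) :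
    ∃ κ > 0, ∀ x ∈ dom A B z, κ * |x - z| ^ (α - 1) ≤ |derivWithin f S x| := by
  obtain ⟨G, hG, H⟩ := hφ.exists_bounds hAB hz hφz
  refine ⟨α * (1 / G) ^ (α - 1) * (1 / G), by positivity, fun x hx => ?_⟩
  obtain ⟨h1, h2⟩ := H x hx.1
  have hxz : 0 < |x - z| := abs_pos.2 (sub_ne_zero.2 hx.2)
  have hφx : 0 < φ x := pos_of_mul_pos_right (hxz.trans_le h1) hG.le
  have e1 : HasDerivWithinAt φ (derivWithin φ (Icc A B) x) (dom A B z) x :=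
    ((hφ.1.differentiableOn (by norm_num)) x hx.1).hasDerivWithinAt.mono sdiff_subset
  have e2 : HasDerivWithinAt f (σ * (derivWithin φ (Icc A B) x * α * φ x ^ (α - 1)))
      (dom A B z) x :=
    (((e1.rpow_const (Or.inl hφx.ne')).const_mul σ).const_add e).congr hf (hf x hx)
  have e3 : HasDerivWithinAt f (derivWithin f S x) (dom A B z) x :=
    (hd x (hS hx)).hasDerivWithinAt.mono hS
  rw [(uniqueDiffOn_dom hAB x hx).eq_deriv _ e3 e2, abs_mul, abs_mul, abs_mul, hσ, one_mul,
    abs_of_pos (by linarith : 0 < α), abs_of_pos (Real.rpow_pos_of_pos hφx _)]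
  have h3 : 1 / G ≤ |derivWithin φ (Icc A B) x| := by rw [div_le_iff₀ hG]; linarith
  have h4 : (1 / G) ^ (α - 1) * |x - z| ^ (α - 1) ≤ φ x ^ (α - 1) := by
    rw [← Real.mul_rpow (by positivity) hxz.le]
    refine Real.rpow_le_rpow (by positivity) ?_ (by linarith)
    rw [one_div, inv_mul_le_iff₀ hG]
    exact h1
  calc α * (1 / G) ^ (α - 1) * (1 / G) * |x - z| ^ (α - 1)
      = (1 / G) * α * ((1 / G) ^ (α - 1) * |x - z| ^ (α - 1)) := by ring
    _ ≤ |derivWithin φ (Icc A B) x| * α * φ x ^ (α - 1) := by gcongr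

/-- Near a non-flat singular point the derivative is bounded below by a power of the distance. -/
lemma IsContractingLorenz.exists_le_derivWithin {f : ℝ → ℝ} {c : ℝ} (h : IsContractingLorenz f c) :
    ∃ κ : ℝ, 0 < κ ∧ ∃ β : ℝ, 0 < β ∧ ∀ x ∈ dom 0 1 c, κ * |x - c| ^ β ≤ derivWithin f (dom 0 1 c) x := by
  obtain ⟨u, -, v, -, α, hα, φ, ψ, hφ, hψ, hφc, hψc, -, -, hfl, hfr⟩ := h.nonFlat
  have hc := h.lorenz.singular_mem
  have hd : DifferentiableOn ℝ f (dom 0 1 c) := h.lorenz.contDiffOn.differentiableOn (by norm_num)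
  obtain ⟨κ₁, hκ₁, H₁⟩ := exists_le_abs_derivWithin_of_rpow (f := f) (S := dom 0 1 c) (e := u) (σ := -1) hφ hc.1
    ⟨hc.1.le, le_rfl⟩ hφc hα (by simp)
    (fun x hx => (⟨⟨hx.1.1, hx.1.2.trans hc.2.le⟩, hx.2⟩ : x ∈ dom 0 1 c)) hd
    (fun x hx => by rw [hfl x ⟨hx.1.1, lt_of_le_of_ne hx.1.2 hx.2⟩]; ring)
  obtain ⟨κ₂, hκ₂, H₂⟩ := exists_le_abs_derivWithin_of_rpow (f := f) (S := dom 0 1 c) (e := 1 - v) (σ := 1) hψ hc.2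
    ⟨le_rfl, hc.2.le⟩ hψc hα (by simp)
    (fun x hx => (⟨⟨hc.1.le.trans hx.1.1, hx.1.2⟩, hx.2⟩ : x ∈ dom 0 1 c)) hd
    (fun x hx => by rw [hfr x ⟨lt_of_le_of_ne hx.1.1 (Ne.symm hx.2), hx.1.2⟩]; ring)
  refine ⟨min κ₁ κ₂, lt_min hκ₁ hκ₂, α - 1, by linarith, fun x hx => ?_⟩
  rw [← abs_of_pos (h.lorenz.deriv_pos x hx)]
  have h0 : 0 ≤ |x - c| ^ (α - 1) := Real.rpow_nonneg (abs_nonneg _) _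
  rcases le_total x c with hxc | hxc
  · exact (mul_le_mul_of_nonneg_right (min_le_left _ _) h0).trans (H₁ x ⟨⟨hx.1.1, hxc⟩, hx.2⟩)
  · exact (mul_le_mul_of_nonneg_right (min_le_right _ _) h0).trans (H₂ x ⟨⟨hxc, hx.1.2⟩, hx.2⟩)

/-- The chain rule along an orbit avoiding the singular point. -/
lemma IsContractingLorenz.log_derivWithin_iterate {f : ℝ → ℝ} {c : ℝ}
    (h : IsContractingLorenz f c) {x : ℝ} (hx : x ∈ Icc (0 : ℝ) 1) (hc : ∀ j, f^[j] x ≠ c)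
    (n : ℕ) :
    Real.log (derivWithin f^[n] (dom 0 1 c) x) = birkhoffSum f (logDeriv f c) n x := by
  have he := h.expander
  have hmem : ∀ j, f^[j] x ∈ dom 0 1 c := fun j => ⟨he.iterate_mem hx fun i _ => hc i, hc j⟩
  have hd : DifferentiableOn ℝ f (dom 0 1 c) := h.lorenz.contDiffOn.differentiableOn (by norm_num)
  have key : HasDerivWithinAt f^[n] (∏ j ∈ Finset.range n, derivWithin f (dom 0 1 c) (f^[j] x))
      (dom 0 1 c) x := by
    induction n with
    | zero => simpa using hasDerivWithinAt_id x (dom 0 1 c)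
    | succ n ih =>
      rw [Function.iterate_succ', Finset.prod_range_succ, mul_comm]
      have e1 := (hd _ (hmem n)).hasDerivWithinAt
      have hnhds : 𝓝[Icc 0 1] (f^[n] x) = 𝓝[dom 0 1 c] (f^[n] x) := by
        rw [dom, sdiff_eq, nhdsWithin_inter_of_mem']
        exact mem_nhdsWithin_of_mem_nhds (isOpen_compl_singleton.mem_nhds (hc n))
      have ht : Tendsto f^[n] (𝓝[dom 0 1 c] x) (𝓝[dom 0 1 c] (f^[n] x)) := by
        rw [← hnhds]
        exact (he.iterate_tendsto hx fun j _ => hc j).mono_left (nhdsWithin_mono _ sdiff_subset)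
      exact HasDerivAtFilter.comp e1 ih (ht.prodMap (tendsto_pure_pure _ _))
  rw [key.derivWithin (uniqueDiffOn_dom zero_lt_one x (hmem 0)), Real.log_prod]
  · rfl
  · intro j _
    exact (h.lorenz.deriv_pos _ (hmem j)).ne'

/-! ### Visits near c and truncations of log Df -/

/-- Successive visits are at least s steps apart; the summand s - 1 pays for the visit at time 0. -/
lemma Level.visits_mul_le {f : ℝ → ℝ} {c p q : ℝ} {k l : ℕ} (L : Level f c p q k l) {s : ℕ}
    (hk : s ≤ k) (hl : s ≤ l) (n : ℕ) :
    ∀ x ∈ Icc p q, (∀ j, f^[j] x ≠ c) → visits f (Icc p q) n x * s ≤ n + (s - 1) := by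
  induction n using Nat.strong_induction_on with
  | _ n ih =>
    intro x hx hc
    rcases Nat.eq_zero_or_pos n with rfl | hn
    · simp [visits]
    have hr : s ≤ ret c k l x := by unfold ret; split_ifs <;> assumption
    have hr0 := L.ret_pos x
    rcases le_or_gt n (ret c k l x) with hle | hlt
    · rw [visits_eq_one hn hx fun j h0 hj => L.not_mem_of_lt_ret hx (hc 0) h0 (hj.trans_le hle)]
      omega
    · obtain ⟨m, rfl⟩ := Nat.exists_eq_add_of_le hlt.le
      have := ih m (by omega) _ (L.iterate_ret_mem hx (hc 0))
        (fun j => by rw [← Function.iterate_add_apply]; exact hc _)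
      rw [visits_add, visits_eq_one hr0 hx fun j h0 hj => L.not_mem_of_lt_ret hx (hc 0) h0 hj,
        add_mul, one_mul]
      omega

/-- A first hit no earlier than time s - 1 absorbs the boundary term, which gives a frequency bound
valid at every time n. -/
lemma Level.visits_mul_le_of_mem_hitSet {f : ℝ → ℝ} {c p q : ℝ} {k l : ℕ} (L : Level f c p q k l)
    {s t : ℕ} (hk : s ≤ k) (hl : s ≤ l) (ht : s ≤ t + 1) {w : ℝ}
    (hw : w ∈ hitSet f (Icc p q) t) (hc : ∀ j, f^[j] w ≠ c) (n : ℕ) :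
    visits f (Icc p q) n w * s ≤ n := by
  rcases le_or_gt n t with hle | hlt
  · rw [visits_eq_zero fun j hj => hw.2 j (hj.trans_le hle), zero_mul]
    exact Nat.zero_le n
  · obtain ⟨m, rfl⟩ := Nat.exists_eq_add_of_le hlt.le
    have := L.visits_mul_le hk hl m _ hw.1
      (fun j => by rw [← Function.iterate_add_apply]; exact hc _)
    rw [visits_add, visits_eq_zero fun j hj => hw.2 j hj, zero_add]
    omega

namespace Tower

variable {f : ℝ → ℝ} {c : ℝ} {p q : ℕ → ℝ} {k l : ℕ → ℕ} {N : ℕ} {a b κ : ℝ}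

/-- Each return time is at least the sum of the two return times one level below. -/
lemma two_pow_le (h : Expander f c) (T : Tower f c p q k l N a b κ) (i : ℕ) :
    2 ^ i ≤ k i ∧ 2 ^ i ≤ l i := by
  induction i with
  | zero => exact ⟨(T.level 0).kpos, (T.level 0).lpos⟩
  | succ i ih =>
    have h1 := (T.left_bounds h i).1
    have h2 := (T.right_bounds h i).1
    rw [pow_succ]
    omega

end Tower

open Classical in
/-- The function `log Df`, truncated from below at the level `-A`. -/
noncomputable def truncLogDeriv (f : ℝ → ℝ) (c A : ℝ) (x : ℝ) : ℝ :=
  Real.log (max (Function.update (derivWithin f (dom 0 1 c)) c 0 x) (Real.exp (-A)))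

section truncLogDeriv

variable {f : ℝ → ℝ} {c : ℝ}

lemma truncLogDeriv_singular (f : ℝ → ℝ) (c A : ℝ) : truncLogDeriv f c A c = -A := by
  rw [truncLogDeriv, Function.update_self, max_eq_right (Real.exp_pos _).le, Real.log_exp]

lemma truncLogDeriv_of_mem (h : IsContractingLorenz f c) (A : ℝ) {x : ℝ} (hx : x ∈ dom 0 1 c) :
    truncLogDeriv f c A x = max (logDeriv f c x) (-A) := by
  have hD := h.lorenz.deriv_pos x hx
  rw [truncLogDeriv, Function.update_of_ne hx.2, logDeriv]
  rcases le_total (derivWithin f (dom 0 1 c) x) (Real.exp (-A)) with hle | hle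
  · rw [max_eq_right hle, Real.log_exp, max_eq_right ((Real.log_le_iff_le_exp hD).2 hle)]
  · rw [max_eq_left hle, max_eq_left ((Real.le_log_iff_exp_le hD).2 hle)]

lemma truncLogDeriv_antitone (h : IsContractingLorenz f c) {x : ℝ} (hx : x ∈ Icc (0 : ℝ) 1)
    {A B : ℝ} (hAB : A ≤ B) : truncLogDeriv f c B x ≤ truncLogDeriv f c A x := by
  by_cases hc : x = c
  · rw [hc, truncLogDeriv_singular, truncLogDeriv_singular]; linarith
  · rw [truncLogDeriv_of_mem h _ ⟨hx, hc⟩, truncLogDeriv_of_mem h _ ⟨hx, hc⟩]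
    exact max_le_max le_rfl (by linarith)

lemma logDeriv_le_truncLogDeriv (h : IsContractingLorenz f c) (A : ℝ) {x : ℝ}
    (hx : x ∈ dom 0 1 c) : logDeriv f c x ≤ truncLogDeriv f c A x := by
  rw [truncLogDeriv_of_mem h A hx]
  exact le_max_left _ _

/-- The value 0 inserted at c is the limit of Df there, since f is contracting. -/
lemma continuousOn_truncLogDeriv (h : IsContractingLorenz f c) (A : ℝ) :
    ContinuousOn (truncLogDeriv f c A) (Icc 0 1) := by
  have hD : ContinuousOn (derivWithin f (dom 0 1 c)) (dom 0 1 c) :=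
    h.lorenz.contDiffOn.continuousOn_derivWithin (uniqueDiffOn_dom zero_lt_one) (by norm_num)
  have hlim : Tendsto (derivWithin f (dom 0 1 c)) (𝓝[≠] c) (𝓝 0) := by
    rw [← Iio_union_Ioi, nhdsWithin_union]
    exact h.contracting_left.sup h.contracting_right
  classical
  have hu : ContinuousOn (Function.update (derivWithin f (dom 0 1 c)) c 0) (Icc 0 1) := by
    rw [continuousOn_update_iff]
    exact ⟨hD, fun _ => hlim.mono_left (nhdsWithin_mono _ fun x hx => hx.2)⟩
  have : ContinuousOn (fun x => Real.log
      (max (Function.update (derivWithin f (dom 0 1 c)) c 0 x) (Real.exp (-A)))) (Icc 0 1) :=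
    (hu.sup continuousOn_const).log fun x _ => ((Real.exp_pos _).trans_le (le_max_right _ _)).ne'
  unfold truncLogDeriv
  convert this

end truncLogDeriv

namespace Tower

variable {f : ℝ → ℝ} {c : ℝ} {p q : ℕ → ℝ} {k l : ℕ → ℕ} {N : ℕ} {a b κ : ℝ}

lemma le_abs_sub (T : Tower f c p q k l N a b κ) {i : ℕ} {x : ℝ} (hx : x ∉ Icc (p i) (q i)) :
    κ * a ^ i ≤ |x - c| := by
  rcases lt_or_ge x (p i) with h | h
  · have := T.left_scale i
    rw [abs_sub_comm]
    exact this.trans ((by linarith : c - p i ≤ c - x).trans (le_abs_self _))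
  · have hq : q i < x := not_le.1 fun h' => hx ⟨h, h'⟩
    have := T.right_scale i
    exact this.trans ((by linarith : q i - c ≤ x - c).trans (le_abs_self _))

/-- Outside the `i`-th return interval `log Df` is at least `-(A + B i)`. -/
lemma exists_le_logDeriv (h : IsContractingLorenz f c) (T : Tower f c p q k l N a b κ) :
    ∃ A B : ℝ, 0 < B ∧ ∀ i, ∀ x ∈ dom 0 1 c, x ∉ Icc (p i) (q i) →
      -(A + B * i) ≤ logDeriv f c x := by
  obtain ⟨κ', hκ', β, hβ, H⟩ := h.exists_le_derivWithin
  have ha := T.a_pos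
  have hκ := T.κ_pos
  have hla : Real.log a ≤ 0 := Real.log_nonpos ha.le T.a_le
  -- These are the constants in the logarithm of κ' * (κ * a ^ i) ^ β. The summand 1 in B only
  -- ensures B > 0, as log a ≤ 0 is all that is used.
  refine ⟨-(Real.log κ' + β * Real.log κ), 1 - β * Real.log a, by nlinarith, fun i x hx hxi => ?_⟩
  have h1 : 0 < κ * a ^ i := by positivity
  have h2 : κ' * (κ * a ^ i) ^ β ≤ derivWithin f (dom 0 1 c) x := by
    refine le_trans ?_ (H x hx)
    gcongr
    exact T.le_abs_sub hxi
  have h3 := Real.log_le_log (by positivity) h2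
  rw [Real.log_mul hκ'.ne' (by positivity), Real.log_rpow h1, Real.log_mul hκ.ne' (by positivity),
    Real.log_pow] at h3
  refine le_trans ?_ h3
  have : (0 : ℝ) ≤ i := Nat.cast_nonneg i
  linarith

/-- If r is the first level whose interval misses x, truncation at level m costs at most B * (r -
m), and r - m is the number of levels i with m ≤ i < r, all of whose intervals contain x. This turns
the error into a count of visits. -/
lemma truncLogDeriv_sub_le (h : IsContractingLorenz f c) {A B : ℝ} (hB : 0 < B) (H : ∀ i, ∀ x ∈ dom 0 1 c, x ∉ Icc (p i) (q i) → -(A + B * i) ≤ logDeriv f c x)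
    {x : ℝ} (hx : x ∈ dom 0 1 c) {m n : ℕ} (hn : x ∉ Icc (p n) (q n)) :
    truncLogDeriv f c (A + B * m) x - logDeriv f c x ≤
      B * ∑ i ∈ Finset.Ico m n, (Icc (p i) (q i)).indicator (fun _ => (1 : ℝ)) x := by
  have hsum : ∀ s : Finset ℕ, 0 ≤ ∑ i ∈ s, (Icc (p i) (q i)).indicator (fun _ => (1 : ℝ)) x :=
    fun s => Finset.sum_nonneg fun i _ => indicator_nonneg (fun _ _ => zero_le_one) _
  classical
  have hex : ∃ n, x ∉ Icc (p n) (q n) := ⟨n, hn⟩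
  set r := Nat.find hex with hr
  have hrn : r ≤ n := Nat.find_min' hex hn
  have h1 := H r x hx (Nat.find_spec hex)
  rw [truncLogDeriv_of_mem h _ hx, sub_le_iff_le_add]
  refine max_le (le_add_of_nonneg_left (mul_nonneg hB.le (hsum _))) ?_
  rcases le_or_gt r m with hrm | hrm
  · have : (r : ℝ) ≤ m := by exact_mod_cast hrm
    have := mul_le_mul_of_nonneg_left this hB.le
    have := mul_nonneg hB.le (hsum (Finset.Ico m n))
    linarith
  · have h2 : ((r - m : ℕ) : ℝ) ≤
        ∑ i ∈ Finset.Ico m n, (Icc (p i) (q i)).indicator (fun _ => (1 : ℝ)) x := by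
      calc ((r - m : ℕ) : ℝ) = ∑ i ∈ Finset.Ico m r, (1 : ℝ) := by simp
        _ = ∑ i ∈ Finset.Ico m r, (Icc (p i) (q i)).indicator (fun _ => (1 : ℝ)) x := by
            refine Finset.sum_congr rfl fun i hi => ?_
            rw [indicator_of_mem]
            exact not_not.1 (Nat.find_min hex (Finset.mem_Ico.1 hi).2)
        _ ≤ _ := Finset.sum_le_sum_of_subset_of_nonneg (Finset.Ico_subset_Ico_right hrn)
            fun i _ _ => indicator_nonneg (fun _ _ => zero_le_one) _
    rw [Nat.cast_sub hrm.le] at h2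
    have := mul_le_mul_of_nonneg_left h2 hB.le
    linarith

/-- The orbit visits level i at most n / 2 ^ i times among its first n points, so the truncation
error is a geometric tail, linear in n. -/
lemma sum_truncLogDeriv_sub_le (h : IsContractingLorenz f c) (T : Tower f c p q k l N a b κ)
    {A B : ℝ} (hB : 0 < B)
    (H : ∀ i, ∀ x ∈ dom 0 1 c, x ∉ Icc (p i) (q i) → -(A + B * i) ≤ logDeriv f c x)
    {w : ℝ} (hw : IsGood f c p q w) {t : ℕ → ℕ} (ht : ∀ i, 2 ^ i ≤ t i + 1)
    (hh : ∀ i, 1 ≤ i → w ∈ hitSet f (Icc (p i) (q i)) (t i)) {m : ℕ} (hm : 1 ≤ m) (n : ℕ) :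
    birkhoffSum f (truncLogDeriv f c (A + B * m)) n w - birkhoffSum f (logDeriv f c) n w ≤
      n * (B * (2 * (1 / 2) ^ m)) := by
  have he := h.expander
  -- Level I is first hit at time t I ≥ 2 ^ I - 1 ≥ n, so only the levels below I contribute.
  set I := n + 1 with hI
  have hIt : n ≤ t I := by
    have h1 := ht I
    have h2 : I < 2 ^ I := Nat.lt_two_pow_self
    omega
  have hmem : ∀ j, f^[j] w ∈ dom 0 1 c := fun j => ⟨he.iterate_mem hw.mem fun i _ => hw.ne i, hw.ne j⟩
  unfold birkhoffSum
  rw [← Finset.sum_sub_distrib]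
  calc ∑ j ∈ Finset.range n, (truncLogDeriv f c (A + B * m) (f^[j] w) - logDeriv f c (f^[j] w))
      ≤ ∑ j ∈ Finset.range n, B * ∑ i ∈ Finset.Ico m I,
          (Icc (p i) (q i)).indicator (fun _ => (1 : ℝ)) (f^[j] w) := by
        refine Finset.sum_le_sum fun j hj => truncLogDeriv_sub_le h hB H (hmem j) ?_
        exact (hh I (by omega)).2 j ((Finset.mem_range.1 hj).trans_le hIt)
    _ = B * ∑ i ∈ Finset.Ico m I, (visits f (Icc (p i) (q i)) n w : ℝ) := by
        rw [← Finset.mul_sum, Finset.sum_comm]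
        congr 1
        refine Finset.sum_congr rfl fun i _ => ?_
        rw [visits_eq_sum, Nat.cast_sum]
        refine Finset.sum_congr rfl fun j _ => ?_
        by_cases hj : f^[j] w ∈ Icc (p i) (q i) <;> simp [hj]
    _ ≤ B * ∑ i ∈ Finset.Ico m I, n * (1 / 2 : ℝ) ^ i := by
        gcongr with i hi
        have h1 := (T.level i).visits_mul_le_of_mem_hitSet (T.two_pow_le he i).1
          (T.two_pow_le he i).2 (ht i) (hh i (hm.trans (Finset.mem_Ico.1 hi).1)) hw.ne n
        rw [one_div, inv_pow, ← div_eq_mul_inv, le_div_iff₀ (by positivity)]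
        exact_mod_cast h1
    _ ≤ B * (n * ((1 / 2 : ℝ) ^ m / (1 - 1 / 2))) := by
        rw [← Finset.mul_sum]
        gcongr
        exact geom_sum_Ico_le_of_lt_one (by norm_num) (by norm_num)
    _ = _ := by ring

end Tower

/-! ### Integrability of log Df and invariance of the measure -/

/-- Birkhoff averages of a decreasing limit of continuous functions whose tails are uniformly
small along an orbit. -/
lemma integrable_of_uniform_tails {f : ℝ → ℝ} {c : ℝ} {μ : Measure ℝ} [IsProbabilityMeasure μ]
    (hμ : μ (Icc 0 1)ᶜ = 0) {w : ℝ} {F : ℝ → ℝ} {ψ : ℕ → ℝ → ℝ} {e : ℕ → ℝ} {B : ℝ} (hB : 0 < B)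
    (hc : c ∈ Icc (0 : ℝ) 1)
    (hψi : ∀ m, Integrable (ψ m) μ)
    (hψ : ∀ m, Tendsto (fun n : ℕ => birkhoffSum f (ψ m) n w / n) atTop (𝓝 (∫ y, ψ m y ∂μ)))
    (hanti : ∀ x ∈ Icc (0 : ℝ) 1, Antitone fun m => ψ m x)
    (hlim : ∀ x ∈ Icc (0 : ℝ) 1, x ≠ c → Tendsto (fun m => ψ m x) atTop (𝓝 (F x)))
    (hsing : ∀ m, ψ 0 c - ψ m c = B * m)
    (hge : ∀ m n, birkhoffSum f F n w ≤ birkhoffSum f (ψ m) n w)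
    (hle : ∀ m n, birkhoffSum f (ψ m) n w - birkhoffSum f F n w ≤ n * e m) :
    μ {c} = 0 ∧ Integrable F μ ∧ Tendsto (fun m => ∫ x, ψ m x ∂μ) atTop (𝓝 (∫ x, F x ∂μ)) := by
  have hae : ∀ᵐ x ∂μ, x ∈ Icc (0 : ℝ) 1 := mem_ae_iff.2 hμ
  -- The orbit averages of ψ 0 - ψ m are at most e 0, whatever m, and the bound passes to the
  -- integrals.
  have hdiff : ∀ m, ∫ x, (ψ 0 x - ψ m x) ∂μ ≤ e 0 := fun m => by
    rw [integral_sub (hψi 0) (hψi m)]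
    refine le_of_tendsto ((hψ 0).sub (hψ m)) ?_
    filter_upwards [eventually_gt_atTop 0] with n hn
    have hn' : (0 : ℝ) < n := by exact_mod_cast hn
    rw [← sub_div, div_le_iff₀ hn']
    linarith [hge m n, hle 0 n]
  have hnonneg : ∀ m, ∀ x ∈ Icc (0 : ℝ) 1, 0 ≤ ψ 0 x - ψ m x := fun m x hx =>
    sub_nonneg.2 (hanti x hx (Nat.zero_le m))
  -- The difference ψ 0 - ψ m equals B * m at c, so an atom there would make these integrals
  -- unbounded.
  have hc0 : μ {c} = 0 := by
    have h1 : ∀ m : ℕ, B * m * μ.real {c} ≤ e 0 := fun m => by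
      refine le_trans ?_ (hdiff m)
      have h2 : ∫ x, ({c} : Set ℝ).indicator (fun _ => B * m) x ∂μ = B * m * μ.real {c} := by
        rw [integral_indicator (measurableSet_singleton c), setIntegral_const, smul_eq_mul, mul_comm]
      rw [← h2]
      refine integral_mono_ae ((integrable_const _).indicator (measurableSet_singleton c))
        ((hψi 0).sub (hψi m)) ?_
      filter_upwards [hae] with x hx
      by_cases hxc : x = c
      · subst hxc; simp [hsing]
      · simpa [hxc] using hanti x hx (Nat.zero_le m)
    have h3 : μ.real {c} = 0 := by
      by_contra hne
      have hpos : 0 < B * μ.real {c} := mul_pos hB (lt_of_le_of_ne measureReal_nonneg (Ne.symm hne))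
      obtain ⟨m, hm⟩ := exists_nat_gt (e 0 / (B * μ.real {c}))
      rw [div_lt_iff₀ hpos] at hm
      linarith [h1 m]
    exact (measureReal_eq_zero_iff).1 h3
  have haec : ∀ᵐ x ∂μ, x ≠ c := by
    rw [ae_iff]; simpa using hc0
  have hlim' : ∀ᵐ x ∂μ, Tendsto (fun m => ψ m x) atTop (𝓝 (F x)) := by
    filter_upwards [hae, haec] with x hx hxc using hlim x hx hxc
  -- Fatou's lemma, with the L¹ norms of the ψ m bounded through `hdiff`.
  have hF : Integrable F μ := by
    refine integrable_of_tendsto hlim' (fun m => (hψi m).1) (ne_of_lt (lt_of_le_of_lt ?_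
      (ENNReal.ofReal_lt_top (r := ∫ x, |ψ 0 x| ∂μ + e 0))))
    refine liminf_le_of_le (by isBoundedDefault) fun b hb => ?_
    obtain ⟨m, hm⟩ := hb.exists
    refine hm.trans ?_
    rw [← ofReal_integral_norm_eq_lintegral_enorm (hψi m)]
    refine ENNReal.ofReal_le_ofReal ?_
    calc ∫ x, ‖ψ m x‖ ∂μ ≤ ∫ x, (|ψ 0 x| + (ψ 0 x - ψ m x)) ∂μ := by
          refine integral_mono_ae (hψi m).norm ((hψi 0).abs.add ((hψi 0).sub (hψi m))) ?_
          filter_upwards [hae] with x hx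
          have h1 := hnonneg m x hx
          have h2 := neg_abs_le (ψ 0 x)
          have h3 := le_abs_self (ψ 0 x)
          simp only [Real.norm_eq_abs]
          rw [abs_le]
          constructor <;> linarith
      _ = ∫ x, |ψ 0 x| ∂μ + ∫ x, (ψ 0 x - ψ m x) ∂μ :=
          integral_add (hψi 0).abs ((hψi 0).sub (hψi m))
      _ ≤ _ := by gcongr; exact hdiff m
  refine ⟨hc0, hF, integral_tendsto_of_tendsto_of_antitone hψi hF ?_ hlim'⟩
  filter_upwards [hae] with x hx using hanti x hx

/-- The truncation error e m is uniform in n, so the limits in n and m may be interchanged. -/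
lemma tendsto_average_of_uniform_tails {f : ℝ → ℝ} {w v : ℝ} {F : ℝ → ℝ} {ψ : ℕ → ℝ → ℝ}
    {e I : ℕ → ℝ}
    (hψ : ∀ m, Tendsto (fun n : ℕ => birkhoffSum f (ψ m) n w / n) atTop (𝓝 (I m)))
    (hge : ∀ m n, birkhoffSum f F n w ≤ birkhoffSum f (ψ m) n w)
    (hle : ∀ m n, birkhoffSum f (ψ m) n w - birkhoffSum f F n w ≤ n * e m)
    (he : Tendsto e atTop (𝓝 0)) (hI : Tendsto I atTop (𝓝 v)) :
    Tendsto (fun n : ℕ => birkhoffSum f F n w / n) atTop (𝓝 v) := by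
  rw [Metric.tendsto_nhds]
  intro ε hε
  obtain ⟨m, hm1, hm2⟩ := ((he.eventually_lt_const (u := ε / 3) (by positivity)).and
    (Metric.tendsto_nhds.1 hI (ε / 3) (by positivity))).exists
  filter_upwards [Metric.tendsto_nhds.1 (hψ m) (ε / 3) (by positivity), eventually_gt_atTop 0]
    with n h1 hn
  have hn' : (0 : ℝ) < n := by exact_mod_cast hn
  have h2 : birkhoffSum f F n w / n ≤ birkhoffSum f (ψ m) n w / n := by
    gcongr; exact hge m n
  have h3 : birkhoffSum f (ψ m) n w / n - birkhoffSum f F n w / n ≤ e m := by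
    rw [← sub_div, div_le_iff₀ hn']; linarith [hle m n]
  rw [Real.dist_eq, abs_lt] at h1 hm2 ⊢
  constructor <;> linarith [h1.1, h1.2, hm2.1, hm2.2]

/-- The basin is defined with times 1 to n, Birkhoff sums with times 0 to n - 1; the two differ by
bounded boundary terms. -/
lemma tendsto_birkhoffSum_apply {f g : ℝ → ℝ} {x v C : ℝ} (hg : ∀ j, |g (f^[j] x)| ≤ C)
    (h : Tendsto (fun n : ℕ => birkhoffSum f g n x / n) atTop (𝓝 v)) :
    Tendsto (fun n : ℕ => birkhoffSum f g n (f x) / n) atTop (𝓝 v) := by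
  have h0 : Tendsto (fun n : ℕ => (g (f^[n] x) - g x) / n) atTop (𝓝 0) := by
    refine squeeze_zero_norm (fun n => ?_)
      (tendsto_const_nhds (x := 2 * C) |>.div_atTop tendsto_natCast_atTop_atTop)
    rw [norm_div, Real.norm_natCast]
    gcongr
    have h1 := hg n
    have h2 := hg 0
    refine (abs_sub _ _).trans ?_
    simp only [Function.iterate_zero, id_eq] at h2
    linarith
  have h1 := h.add h0
  rw [add_zero] at h1
  refine h1.congr fun n => ?_
  rw [← birkhoffSum_apply_sub_birkhoffSum f g n x, ← add_div]
  congr 1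
  ring

/-- The function g ∘ f may jump at c; a factor vanishing there restores continuity, so the limits of
averages apply. -/
lemma continuousOn_cutoff_mul {f g : ℝ → ℝ} {c : ℝ} (h : Expander f c) (hg : Continuous g) {C : ℝ}
    (hC : ∀ x, |g x| ≤ C) (m : ℕ) :
    ContinuousOn (fun x => min 1 (m * |x - c|) * g (f x)) (Icc 0 1) := by
  have hχ : Continuous fun x : ℝ => min 1 (m * |x - c|) := by fun_prop
  intro x hx
  by_cases hxc : x = c
  · subst hxc
    rw [ContinuousWithinAt]
    simp only [sub_self, abs_zero, mul_zero, min_eq_right zero_le_one, zero_mul]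
    have h1 : Tendsto (fun y => min 1 (m * |y - x|) * C) (𝓝[Icc 0 1] x) (𝓝 0) := by
      have := ((hχ.tendsto x).mul_const C).mono_left (nhdsWithin_le_nhds (s := Icc 0 1))
      simpa using this
    refine squeeze_zero_norm (fun y => ?_) h1
    have h0 : 0 ≤ min 1 (m * |y - x|) := le_min zero_le_one (by positivity)
    rw [norm_mul, Real.norm_of_nonneg h0]
    exact mul_le_mul_of_nonneg_left (hC _) h0
  · exact hχ.continuousWithinAt.mul (hg.continuousAt.comp_continuousWithinAt (h.cont x hx hxc))

/-- Limits of averages along an orbit are invariant if they do not charge the singular point. -/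
lemma isInvariant_of_averages {f : ℝ → ℝ} {c : ℝ} (h : Expander f c)
    (hf : ContinuousOn f (dom 0 1 c)) {μ : Measure ℝ}
    [IsProbabilityMeasure μ] (hμ : μ (Icc 0 1)ᶜ = 0) (hμc : μ {c} = 0) {w : ℝ}
    (hlim : ∀ φ : ℝ → ℝ, ContinuousOn φ (Icc 0 1) →
      Tendsto (fun n : ℕ => birkhoffSum f φ n w / n) atTop (𝓝 (∫ y, φ y ∂μ))) :
    IsInvariant f c μ := by
  classical
  have hdom : MeasurableSet (dom 0 1 c) := measurableSet_Icc.diff (measurableSet_singleton c)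
  -- A measurable version of f, equal to f almost everywhere because μ is carried by [0, 1] \ {c}.
  set F : ℝ → ℝ := (dom 0 1 c).piecewise f 0 with hF
  have hFm : Measurable F := hf.measurable_piecewise continuousOn_const hdom
  have hae : ∀ᵐ x ∂μ, x ∈ dom 0 1 c := by
    refine mem_ae_iff.2 (measure_mono_null ?_ (measure_union_null hμ hμc))
    intro x hx
    by_cases hxc : x = c
    · exact Or.inr hxc
    · exact Or.inl fun hx' => hx ⟨hx', hxc⟩
  have hmap : μ.map F = μ := by
    have : IsProbabilityMeasure (μ.map F) := Measure.isProbabilityMeasure_map hFm.aemeasurable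
    refine ext_of_forall_integral_eq_of_IsFiniteMeasure fun g => ?_
    rw [integral_map hFm.aemeasurable g.continuous.aestronglyMeasurable]
    have hC : ∀ x, |g x| ≤ ‖g‖ := g.norm_coe_le_norm
    have hχ0 : ∀ (m : ℕ) (x : ℝ), 0 ≤ min 1 (m * |x - c|) := fun m x =>
      le_min zero_le_one (by positivity)
    have hχ1 : ∀ (m : ℕ) (x : ℝ), min 1 (m * |x - c|) ≤ 1 := fun m x => min_le_left _ _
    have hχlim : ∀ x, x ≠ c → ∀ᶠ m : ℕ in atTop, min 1 (m * |x - c|) = 1 := fun x hx => by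
      have hpos : 0 < |x - c| := abs_pos.2 (sub_ne_zero.2 hx)
      filter_upwards [tendsto_natCast_atTop_atTop.eventually_ge_atTop (1 / |x - c|)] with m hm
      rw [div_le_iff₀ hpos] at hm
      exact min_eq_left hm
    have hshift : Tendsto (fun n : ℕ => birkhoffSum f (fun x => g (f x)) n w / n) atTop
        (𝓝 (∫ x, g x ∂μ)) := by
      refine (tendsto_birkhoffSum_apply (fun j => hC _)
        (hlim g g.continuous.continuousOn)).congr fun n => ?_
      congr 1
      unfold birkhoffSum
      refine Finset.sum_congr rfl fun j _ => ?_
      rw [← Function.iterate_succ_apply, Function.iterate_succ_apply']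
    -- The cutoff changes the average of g ∘ f by at most ‖g‖ times the average of 1 minus the
    -- cutoff. The integral of the latter tends to μ {c} = 0.
    have hbound : ∀ m : ℕ, |∫ x, g x ∂μ - ∫ x, min 1 (m * |x - c|) * g (f x) ∂μ| ≤
        ‖g‖ * ∫ x, (1 - min 1 (m * |x - c|)) ∂μ := fun m => by
      refine le_of_tendsto_of_tendsto'
        (hshift.sub (hlim _ (continuousOn_cutoff_mul h g.continuous hC m))).abs
        ((hlim (fun x => 1 - min 1 (m * |x - c|)) (by fun_prop)).const_mul ‖g‖) fun n => ?_
      rw [← sub_div, abs_div, Nat.abs_cast, ← mul_div_assoc]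
      gcongr
      unfold birkhoffSum
      rw [← Finset.sum_sub_distrib, Finset.mul_sum]
      refine (Finset.abs_sum_le_sum_abs _ _).trans (Finset.sum_le_sum fun j _ => ?_)
      rw [← one_sub_mul, abs_mul, abs_of_nonneg (sub_nonneg.2 (hχ1 m _)), mul_comm]
      exact mul_le_mul_of_nonneg_right (hC _) (sub_nonneg.2 (hχ1 m _))
    have hlim1 : Tendsto (fun m : ℕ => ∫ x, (1 - min 1 (m * |x - c|)) ∂μ) atTop (𝓝 0) := by
      have := tendsto_integral_of_dominated_convergence (μ := μ)
        (F := fun (m : ℕ) x => 1 - min 1 (m * |x - c|)) (f := fun _ => 0) (fun _ => 1)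
        (fun m => (by fun_prop : Continuous _).aestronglyMeasurable) (integrable_const _)
        (fun m => Eventually.of_forall fun x => by
          rw [Real.norm_of_nonneg (sub_nonneg.2 (hχ1 m x))]; linarith [hχ0 m x])
        (by
          filter_upwards [hae] with x hx
          refine tendsto_const_nhds.congr' ?_
          filter_upwards [hχlim x hx.2] with m hm
          rw [hm, sub_self])
      simpa using this
    have hlim2 : Tendsto (fun m : ℕ => ∫ x, min 1 (m * |x - c|) * g (f x) ∂μ) atTop
        (𝓝 (∫ x, g (F x) ∂μ)) := by
      have hcongr : ∀ m : ℕ, ∫ x, min 1 (m * |x - c|) * g (f x) ∂μ =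
          ∫ x, min 1 (m * |x - c|) * g (F x) ∂μ := fun m => by
        refine integral_congr_ae ?_
        filter_upwards [hae] with x hx
        rw [hF, piecewise_eq_of_mem _ _ _ hx]
      simp_rw [hcongr]
      refine tendsto_integral_of_dominated_convergence (fun _ => ‖g‖)
        (fun m => (((by fun_prop : Continuous fun x : ℝ => min 1 (m * |x - c|)).measurable).mul
          (g.continuous.measurable.comp hFm)).aestronglyMeasurable) (integrable_const _)
        (fun m => Eventually.of_forall fun x => ?_) ?_
      · rw [norm_mul, Real.norm_of_nonneg (hχ0 m x)]
        exact (mul_le_of_le_one_left (norm_nonneg _) (hχ1 m x)).trans (hC _)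
      · filter_upwards [hae] with x hx
        refine tendsto_const_nhds.congr' ?_
        filter_upwards [hχlim x hx.2] with m hm
        rw [hm, one_mul]
    have h1 : |∫ x, g x ∂μ - ∫ x, g (F x) ∂μ| ≤ 0 := by
      refine le_of_tendsto_of_tendsto' (hlim2.const_sub _).abs ?_ hbound
      simpa using hlim1.const_mul ‖g‖
    linarith [abs_nonpos_iff.1 h1]
  intro A hA
  calc μ (dom 0 1 c ∩ f ⁻¹' A) = μ (F ⁻¹' A) := by
        refine measure_congr ?_
        filter_upwards [hae] with x hx
        refine propext ⟨fun hx' => ?_, fun hx' => ⟨hx, ?_⟩⟩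
        · change F x ∈ A
          rw [hF, piecewise_eq_of_mem _ _ _ hx]
          exact hx'.2
        · change F x ∈ A at hx'
          rwa [hF, piecewise_eq_of_mem _ _ _ hx] at hx'
    _ = μ.map F A := (Measure.map_apply hFm hA).symm
    _ = μ A := by rw [hmap]

lemma sum_Icc_eq_birkhoffSum (f g : ℝ → ℝ) (n : ℕ) (x : ℝ) :
    ∑ k ∈ Finset.Icc 1 n, g (f^[k] x) = birkhoffSum f g n (f x) := by
  rw [birkhoffSum, Finset.range_eq_Ico]
  exact (Finset.sum_Ico_add' (fun k => g (f^[k] x)) 0 n 1).symm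

lemma IsGood.mem_basin {f : ℝ → ℝ} {c : ℝ} {p q : ℕ → ℝ} (h : Expander f c) {μ : Measure ℝ} {x : ℝ}
    (hx : IsGood f c p q x)
    (hlim : ∀ φ : ℝ → ℝ, ContinuousOn φ (Icc 0 1) →
      Tendsto (fun n : ℕ => birkhoffSum f φ n x / n) atTop (𝓝 (∫ y, φ y ∂μ))) :
    x ∈ basin f c μ := by
  refine ⟨⟨hx.mem, hx.ne⟩, fun g hg => ?_⟩
  obtain ⟨C, hC⟩ := isCompact_Icc.exists_bound_of_continuousOn (s := Icc (0 : ℝ) 1) hg.continuousOn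
  refine (tendsto_birkhoffSum_apply (fun j => hC _ (h.iterate_mem hx.mem fun i _ => hx.ne i))
    (hlim g hg.continuousOn)).congr fun n => ?_
  rw [sum_Icc_eq_birkhoffSum, one_div, inv_mul_eq_div]

/-- A basin of positive measure meets one of full measure in [0, 1], and a common point determines
all integrals of bounded continuous functions. -/
lemma IsPhysical.eq_of_ae_mem_basin {f : ℝ → ℝ} {c : ℝ} {μ ν : Measure ℝ} [IsProbabilityMeasure μ]
    (hν : IsPhysical f c ν) (hμ : volume (Icc (0 : ℝ) 1 \ basin f c μ) = 0) : ν = μ := by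
  have := hν.isProbabilityMeasure
  obtain ⟨x, hxν, hxμ⟩ : ∃ x ∈ basin f c ν, x ∈ basin f c μ := by
    by_contra hcon
    push Not at hcon
    exact hν.basin_pos.ne' (measure_mono_null (show basin f c ν ⊆ Icc (0 : ℝ) 1 \ basin f c μ from
      fun x hx => ⟨hx.1.1, hcon x hx⟩) hμ)
  refine ext_of_forall_integral_eq_of_IsFiniteMeasure fun g => ?_
  exact tendsto_nhds_unique (hxν.2 g g.continuous) (hxμ.2 g g.continuous)

end Lorenz

/-! ### Assembly at the two critical values -/

theorem lemma3p3 (f : ℝ → ℝ) (c : ℝ) (hf : Lorenz.ClassLB f c) :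
    ∃ μ : Measure ℝ,
      Lorenz.IsPhysical f c μ ∧ (∀ ν : Measure ℝ, Lorenz.IsPhysical f c ν → ν = μ) ∧
      Integrable (Lorenz.logDeriv f c) μ ∧
      Lorenz.HasLyapunovExponent f c (Function.leftLim f c) (∫ x, Lorenz.logDeriv f c x ∂μ) ∧
      Lorenz.HasLyapunovExponent f c (Function.rightLim f c) (∫ x, Lorenz.logDeriv f c x ∂μ) := by
  have hcl := hf.1
  have h := hcl.expander
  obtain ⟨p, q, k, l, N, a, b, κ, T⟩ := hf.exists_tower
  have hL := hcl.lorenz.tendsto_leftLim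
  have hR := hcl.lorenz.tendsto_rightLim
  have hgL := T.isGood_left h hL
  have hgR := T.isGood_right h hR
  obtain ⟨μ, hμ, hμI, hlim⟩ := T.exists_measure h hgL
  obtain ⟨A, B, hB, H⟩ := T.exists_le_logDeriv hcl
  -- The shift to m + 1 keeps the truncation at levels at least 1, where the hitting times of the
  -- critical values are known.
  set ψ : ℕ → ℝ → ℝ := fun m => Lorenz.truncLogDeriv f c (A + B * (m + 1 : ℕ)) with hψ
  have hψc : ∀ m, ContinuousOn (ψ m) (Icc 0 1) := fun m => Lorenz.continuousOn_truncLogDeriv hcl _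
  have hmem : ∀ w, Lorenz.IsGood f c p q w → ∀ j, f^[j] w ∈ Lorenz.dom 0 1 c := fun w hw j =>
    ⟨h.iterate_mem hw.mem fun i _ => hw.ne i, hw.ne j⟩
  have hge : ∀ w, Lorenz.IsGood f c p q w → ∀ m n,
      birkhoffSum f (Lorenz.logDeriv f c) n w ≤ birkhoffSum f (ψ m) n w := fun w hw m n =>
    Finset.sum_le_sum fun j _ => Lorenz.logDeriv_le_truncLogDeriv hcl _ (hmem w hw j)
  set e : ℕ → ℝ := fun m => B * (2 * (1 / 2) ^ (m + 1)) with he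
  have hleL : ∀ m n, birkhoffSum f (ψ m) n (Function.leftLim f c) -
      birkhoffSum f (Lorenz.logDeriv f c) n (Function.leftLim f c) ≤ n * e m := fun m n =>
    T.sum_truncLogDeriv_sub_le hcl hB H hgL (t := fun i => k i - 1)
      (fun i => by have := (T.two_pow_le h i).1; omega)
      (fun i hi => T.left_value_mem_hitSet h hL hi) (Nat.succ_pos m) n
  have hleR : ∀ m n, birkhoffSum f (ψ m) n (Function.rightLim f c) -
      birkhoffSum f (Lorenz.logDeriv f c) n (Function.rightLim f c) ≤ n * e m := fun m n =>
    T.sum_truncLogDeriv_sub_le hcl hB H hgR (t := fun i => l i - 1)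
      (fun i => by have := (T.two_pow_le h i).2; omega)
      (fun i hi => T.right_value_mem_hitSet h hR hi) (Nat.succ_pos m) n
  have he0 : Tendsto e atTop (𝓝 0) := by
    have h1 : Tendsto (fun m : ℕ => (1 / 2 : ℝ) ^ (m + 1)) atTop (𝓝 0) :=
      (tendsto_pow_atTop_nhds_zero_of_lt_one (by norm_num) (by norm_num)).comp (tendsto_add_atTop_nat 1)
    simpa [he] using (h1.const_mul 2).const_mul B
  obtain ⟨hc0, hint, hψlim⟩ := Lorenz.integrable_of_uniform_tails (f := f) (c := c) hμI
    (F := Lorenz.logDeriv f c) (ψ := ψ) hB ⟨h.pos.le, h.lt_one.le⟩ (fun m => (hlim _ (hψc m)).1)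
    (fun m => (hlim _ (hψc m)).2 _ hgL)
    (fun x hx m n hmn => Lorenz.truncLogDeriv_antitone hcl hx (by
      have : ((m + 1 : ℕ) : ℝ) ≤ (n + 1 : ℕ) := by exact_mod_cast Nat.succ_le_succ hmn
      gcongr))
    (fun x hx hxc => by
      have h1 : Tendsto (fun m : ℕ => A + B * ((m + 1 : ℕ) : ℝ)) atTop atTop :=
        tendsto_atTop_add_const_left _ _ ((tendsto_natCast_atTop_atTop.comp
          (tendsto_add_atTop_nat 1)).const_mul_atTop hB)
      refine tendsto_const_nhds.congr' ?_
      filter_upwards [h1.eventually_ge_atTop (-Lorenz.logDeriv f c x)] with m hm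
      simp only [hψ]
      rw [Lorenz.truncLogDeriv_of_mem hcl _ ⟨hx, hxc⟩, max_eq_left (by linarith)])
    (fun m => by
      simp only [hψ, Lorenz.truncLogDeriv_singular]
      push_cast
      ring)
    (hge _ hgL) hleL
  have hbasin : volume (Icc (0 : ℝ) 1 \ Lorenz.basin f c μ) = 0 :=
    measure_mono_null (sdiff_subset_sdiff_right fun x hx =>
      Lorenz.IsGood.mem_basin h hx fun φ hφ => (hlim φ hφ).2 x hx) (T.volume_not_isGood h)
  have hexp : ∀ w, Lorenz.IsGood f c p q w → (∀ m n, birkhoffSum f (ψ m) n w -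
      birkhoffSum f (Lorenz.logDeriv f c) n w ≤ n * e m) →
      Lorenz.HasLyapunovExponent f c w (∫ x, Lorenz.logDeriv f c x ∂μ) := fun w hw hle => by
    refine ⟨⟨hw.mem, hw.ne⟩, ?_⟩
    refine (Lorenz.tendsto_average_of_uniform_tails (fun m => (hlim _ (hψc m)).2 w hw) (hge w hw)
      hle he0 hψlim).congr fun n => ?_
    rw [hcl.log_derivWithin_iterate hw.mem hw.ne, one_div, inv_mul_eq_div]
  refine ⟨μ, ⟨hμ, ?_, ?_⟩, fun ν hν => hν.eq_of_ae_mem_basin hbasin, hint, hexp _ hgL hleL,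
    hexp _ hgR hleR⟩
  · exact Lorenz.isInvariant_of_averages h hcl.lorenz.contDiffOn.continuousOn hμI hc0
      fun φ hφ => (hlim φ hφ).2 _ hgL
  · refine pos_iff_ne_zero.2 fun h0 => ?_
    have h1 : volume (Icc (0 : ℝ) 1) = 0 := by
      refine measure_mono_null (fun x hx => ?_) (measure_union_null hbasin h0)
      by_cases hxb : x ∈ Lorenz.basin f c μ
      exacts [Or.inr hxb, Or.inl ⟨hx, hxb⟩]
    simp at h1
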